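/- Let $P_l$ be one of the types $A_l$ ($l\ge 1$), $B_l$ ($l\ge 1$), $D_l$ ($l\ge 4$). Let $\Phi$ be the root system of type $P_l$, with simple roots $\alpha_1,\dots,\alpha_l$ and simple coroots $\alpha_1^\vee,\dots,\alpha_l^\vee$, and let $\Phi_{\ge -1}=\Phi^{+}\sqcup\{-\alpha_1,\dots,-\alpha_l\}$ be the set of almost positive roots. Write $[\beta:\alpha_i]$ for the coefficient of $\alpha_i$ in $\beta$. Give each vertex of the Dynkin diagram one of two signs so that adjacent vertices have different signs, and for each sign $s$ let $\tau_s$ be the map that replaces the coefficient $[\beta:\alpha_i]$ by $-[\beta:\alpha_i]-\sum_{j\ne i}\langle\alpha_j,\alpha_i^\vee\rangle\max([\beta:\alpha_j],0)$ for every $i$ of sign $s$ and leaves the other coefficients unchanged. The compatibility degree $(\alpha\,\|\,\beta)$ of $\alpha,\beta\in\Phi_{\ge -1}$ is determined by $(-\alpha_i\,\|\,\beta)=\max([\beta:\alpha_i],0)$ and $(\tau_s\alpha\,\|\,\tau_s\beta)=(\alpha\,\|\,\beta)$. The cluster complex $\Delta(P_l)$ of Fomin and Zelevinsky is the simplicial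 complex on $\Phi_{\ge -1}$ whose faces are the sets of almost positive roots that pairwise have compatibility degree $0$. Let $f_{i-1}(P_l)$ be the number of faces of $\Delta(P_l)$ with dimension $i-1$ (that is, with $i$ elements), with $f_{-1}(P_l)=1$, and let $$f_{P_l}(t)=\sum_{i=0}^{l} f_{i-1}(P_l)\,(-t)^i .$$ Then for each of the three series $A_l$ ($l\ge1$), $B_l$ ($l\ge 1$) and $D_l$ ($l\ge4$), the polynomial $f_{P_l}(t)$ has a smallest real root $r_{P_l}$ for every $l$ in the stated range, the sequence $r_{P_l}$ is strictly decreasing in $l$, and $r_{P_l}\to 0$ as $l\to\infty$. -/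

import Mathlib

open Filter Topology Polynomial

namespace ClusterComplex

variable {ι : Type*} [Fintype ι] [DecidableEq ι]

/-- The simple reflection `s_j` on the root lattice `ℤ^ι` (coordinates with respect to the simple
roots), for the Cartan matrix `A i j = ⟨α_i, α_j^∨⟩`: `s_j v = v - ⟨v, α_j^∨⟩ α_j`. -/
def simpleReflection (A : Matrix ι ι ℤ) (j : ι) (v : ι → ℤ) : ι → ℤ :=
  v - Pi.single j (∑ i, v i * A i j)

/-- The root system `Φ` with Cartan matrix `A`, in the coordinates with respect to the simple
roots: the closure of the set of simple roots under the simple reflections. -/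
inductive IsRoot (A : Matrix ι ι ℤ) : (ι → ℤ) → Prop
  | simple (i : ι) : IsRoot A (Pi.single i 1)
  | reflect (j : ι) (v : ι → ℤ) : IsRoot A v → IsRoot A (simpleReflection A j v)

/-- The set `Φ_{≥ -1} = Φ⁺ ⊔ (-Π)` of almost positive roots. -/
def almostPositiveRoots (A : Matrix ι ι ℤ) : Set (ι → ℤ) :=
  {v | IsRoot A v ∧ ∀ i, 0 ≤ v i} ∪ {v | ∃ i, v = -Pi.single i 1}

/-- The piecewise linear map `τ_s` of Fomin and Zelevinsky, `s` being one of the two signs of a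
bipartition `ε` of the Dynkin diagram (no two vertices with the same sign are adjacent): it
replaces the coordinate `v_i`, for every `i` of sign `s`, by
`-v_i - ∑_{j ≠ i} ⟨α_j, α_i^∨⟩ max(v_j, 0)`, and it fixes the other coordinates. -/
def tau (A : Matrix ι ι ℤ) (ε : ι → Bool) (s : Bool) (v : ι → ℤ) : ι → ℤ := fun i =>
  if ε i = s then -v i - ∑ j ∈ Finset.univ.erase i, A j i * max (v j) 0 else v i

/-- `HasCompatDegree A ε α β d` says that the compatibility degree `(α ‖ β)` of the almost positive
roots `α` and `β` is `d`. The compatibility degree is determined by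
`(-α_i ‖ β) = max([β : α_i], 0)`, where `[β : α_i]` is the coefficient of `α_i` in `β`, and by
`(τ_s α ‖ τ_s β) = (α ‖ β)` for both signs `s`. -/
inductive HasCompatDegree (A : Matrix ι ι ℤ) (ε : ι → Bool) : (ι → ℤ) → (ι → ℤ) → ℤ → Prop
  | negSimple (i : ι) (β : ι → ℤ) : β ∈ almostPositiveRoots A →
      HasCompatDegree A ε (-Pi.single i 1) β (max (β i) 0)
  | invariant (s : Bool) (α β : ι → ℤ) (d : ℤ) : HasCompatDegree A ε α β d →
      HasCompatDegree A ε (tau A ε s α) (tau A ε s β) d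

/-- The cluster complex: the simplicial complex on the set of almost positive roots whose
(nonempty) faces are the finite sets of mutually compatible almost positive roots, that is, any
two of them have compatibility degree `0`. -/
def clusterComplex (A : Matrix ι ι ℤ) (ε : ι → Bool) : PreAbstractSimplicialComplex (ι → ℤ) where
  faces := {F | F.Nonempty ∧ (∀ α ∈ F, α ∈ almostPositiveRoots A) ∧
    ∀ α ∈ F, ∀ β ∈ F, HasCompatDegree A ε α β 0}
  isRelLowerSet_faces := fun _ hF =>
    ⟨hF.1, fun _ hGF hG => ⟨hG, fun α hα => hF.2.1 α (hGF hα),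
      fun α hα β hβ => hF.2.2 α (hGF hα) β (hGF hβ)⟩⟩

/-- `faceNumber K i` is the number of faces of `K` of dimension `i - 1`, that is, with `i`
vertices; the empty face is counted for `i = 0`. -/
noncomputable def faceNumber {V : Type*} (K : PreAbstractSimplicialComplex V) (i : ℕ) : ℕ :=
  if i = 0 then 1 else {F : Finset V | F ∈ K ∧ F.card = i}.ncard

/-- The `f`-polynomial `∑_{i=0}^{l} f_{i-1} (-t)^i` of the cluster complex, where `l = #ι` is the
rank. -/
noncomputable def fPolynomial (A : Matrix ι ι ℤ) (ε : ι → Bool) : ℝ[X] :=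
  ∑ i ∈ Finset.range (Fintype.card ι + 1),
    (faceNumber (clusterComplex A ε) i : ℝ[X]) * (-X) ^ i

/-- The bipartition of a Dynkin diagram that is a path (types `A_l` and `B_l`). -/
def pathSign (l : ℕ) (i : Fin l) : Bool := decide (i.val % 2 = 0)

/-- The bipartition of the Dynkin diagram of type `D_l`: the last two vertices are both adjacent to
the vertex with index `l - 3` and have the same sign. -/
def forkSign (l : ℕ) (i : Fin l) : Bool := decide (min i.val (l - 2) % 2 = 0)

/-- The `f`-polynomial of type `A_l`. -/
noncomputable def fA (l : ℕ) : ℝ[X] := fPolynomial (CartanMatrix.A l) (pathSign l)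

/-- The `f`-polynomial of type `B_l`. -/
noncomputable def fB (l : ℕ) : ℝ[X] := fPolynomial (CartanMatrix.B l) (pathSign l)

/-- The `f`-polynomial of type `D_l` (meaningful for `l ≥ 4`). -/
noncomputable def fD (l : ℕ) : ℝ[X] := fPolynomial (CartanMatrix.D l) (forkSign l)

end ClusterComplex

/-!
The cluster complexes of types `A`, `B` and `D` are complexes of dissections of polygons. The almost
positive roots of type `A_l` are the diagonals of a polygon with `l + 3` vertices, those of type
`B_l` are the diagonals of a polygon with `2 * (l + 1)` vertices modulo the half turn, and those of
type `D_l` are the tagged arcs of a polygon with `l` vertices and a puncture. Compatible means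
noncrossing, the negative simple roots are the diagonals of a zigzag (together with the two radii at
one vertex in type `D`), a coordinate of a root counts crossings with a diagonal of the zigzag, and
`τ_s` is one of the two reflections of the polygon whose composition is a rotation by one step.
Vertices are integers and arcs are pairs of integers, taken modulo `l + 1` in type `B` and modulo
`l` in type `D`; the reflections are `x ↦ -x` and `x ↦ 1 - x`. That the reflections act on
the coordinates as `τ_s` is the relation `crossNum_exchange` between the crossing numbers of the two
diagonals of a quadrilateral. The structure `IsArcModel` collects what has to be verified, and
`IsArcModel.eval_fPolynomial` then expresses the `f`-polynomial by the counting polynomial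
`indepPoly` of the sets of pairwise compatible arcs. The three models are `isArcModel_A`,
`isArcModel_B` and `isArcModel_D`.

Dissections are counted by the side of a cell or of the central region that covers a fixed edge
of the polygon. With `y = -t`, the generating function of such sides satisfies a quadratic
equation, and this makes `(1 - 2 * (1 + 2 * y) * x + x ^ 2) ^ (-1 / 2)` the generating function of
type `B`. So the polynomials of type `B` are the Legendre polynomials in the variable `1 - 2 * t`
(`symValue_rec`). Those of type `A` are multiples of Jacobi polynomials, with a similar recurrence
(`dissPoly_three_term`), and the one of type `D_l` is a combination, with positive coefficients, of
the one of type `B_l` and `1 - 2 * t` times the one of type `B_{l-1}` (`taggedArcs_eval`).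

By a recurrence `a * p (l + 2) = (a + c) * (1 - 2 * t) * p (l + 1) - c * p l` with positive `a` and
`c`, the polynomial `p (l + 2)` is negative at the smallest root of `p (l + 1)`, so that the
smallest roots decrease; and it implies `p (l + 1) ≤ (1 - (l + 1) * t) * p l` to the left of the
smallest root of `p (l + 1)`, which is therefore at most `1 / (l + 1)` (`least_roots_of_three_term`).
The smallest root of type `D_l` lies strictly between those of types `B_l` and `B_{l-1}`
(`least_roots_of_interlacing`).
-/

namespace ClusterComplex

/-! ### Counting polynomials of flag complexes -/

section IndepPoly

variable {α β : Type*}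

open Classical in
/-- The counting polynomial `∑ X ^ #S` of the flag complex on the finite vertex set `U` whose faces
are the sets `S` of mutually compatible vertices. The relation is meant to be reflexive and
symmetric. -/
noncomputable def indepPoly (c : α → α → Prop) (U : Finset α) : ℝ[X] :=
  ∑ S ∈ U.powerset with (∀ u ∈ S, ∀ w ∈ S, c u w), X ^ S.card

theorem indepPoly_empty (c : α → α → Prop) : indepPoly c ∅ = 1 := by
  classical
  simp [indepPoly, Finset.sum_filter]

theorem indepPoly_coeff (c : α → α → Prop) (U : Finset α) (i : ℕ) :
    (indepPoly c U).coeff i =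
      ({S : Finset α | S ⊆ U ∧ (∀ u ∈ S, ∀ w ∈ S, c u w) ∧ S.card = i}.ncard : ℝ) := by
  classical
  have : {S : Finset α | S ⊆ U ∧ (∀ u ∈ S, ∀ w ∈ S, c u w) ∧ S.card = i} =
      (({S ∈ U.powerset | ∀ u ∈ S, ∀ w ∈ S, c u w}.filter fun S => i = S.card :
        Finset (Finset α)) : Set (Finset α)) := by
    ext S; simp [and_assoc, eq_comm]
  rw [this, Set.ncard_coe_finset, indepPoly, finsetSum_coeff]
  simp only [coeff_X_pow, Finset.sum_boole]

theorem indepPoly_bij {c : α → α → Prop} {c' : β → β → Prop} {U : Finset α} {V : Finset β}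
    (f : α → β) (hf : ∀ u ∈ U, f u ∈ V) (hinj : Set.InjOn f U) (hsurj : ∀ v ∈ V, ∃ u ∈ U, f u = v)
    (hc : ∀ u ∈ U, ∀ w ∈ U, c' (f u) (f w) ↔ c u w) : indepPoly c' V = indepPoly c U := by
  classical
  have hV : V = U.image f := by
    ext v; simp only [Finset.mem_image]
    exact ⟨hsurj v, fun ⟨u, hu, h⟩ => h ▸ hf u hu⟩
  symm
  rw [indepPoly, indepPoly]
  refine Finset.sum_bij (fun S _ => S.image f) ?_ ?_ ?_ ?_
  · intro S hS
    simp only [Finset.mem_filter, Finset.mem_powerset] at hS ⊢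
    refine ⟨hV ▸ Finset.image_subset_image hS.1, ?_⟩
    simp only [Finset.mem_image, forall_exists_index, and_imp, forall_apply_eq_imp_iff₂]
    exact fun u hu w hw => (hc u (hS.1 hu) w (hS.1 hw)).2 (hS.2 u hu w hw)
  · intro S hS T hT h
    simp only [Finset.mem_filter, Finset.mem_powerset] at hS hT
    have := (hinj.image_eq_image_iff (s := U) (s₁ := (S : Set α)) (s₂ := (T : Set α))
      (by exact_mod_cast hS.1) (by exact_mod_cast hT.1)).1 (by exact_mod_cast h)
    exact_mod_cast this
  · intro T hT
    simp only [Finset.mem_filter, Finset.mem_powerset] at hT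
    refine ⟨U.filter (fun u => f u ∈ T), ?_, ?_⟩
    · simp only [Finset.mem_filter, Finset.mem_powerset]
      refine ⟨Finset.filter_subset _ _, ?_⟩
      intro u hu w hw
      exact (hc u hu.1 w hw.1).1 (hT.2 _ hu.2 _ hw.2)
    · ext v
      simp only [Finset.mem_image, Finset.mem_filter]
      constructor
      · rintro ⟨u, hu, rfl⟩; exact hu.2
      · intro hv
        obtain ⟨u, hu, rfl⟩ := hsurj v (hT.1 hv)
        exact ⟨u, ⟨hu, hv⟩, rfl⟩
  · intro S hS
    simp only [Finset.mem_filter, Finset.mem_powerset] at hS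
    rw [Finset.card_image_of_injOn (hinj.mono (by exact_mod_cast hS.1))]

/-- The join of two flag complexes has the product of the counting polynomials. -/
theorem indepPoly_join [DecidableEq α] {c : α → α → Prop} {U V W : Finset α}
    (hW : ∀ w, w ∈ W ↔ w ∈ U ∨ w ∈ V) (hUV : ∀ u ∈ U, u ∉ V)
    (h : ∀ u ∈ U, ∀ v ∈ V, c u v ∧ c v u) :
    indepPoly c W = indepPoly c U * indepPoly c V := by
  classical
  symm
  rw [indepPoly, indepPoly, indepPoly, Finset.sum_mul_sum, ← Finset.sum_product']
  refine Finset.sum_bij' (fun p _ => p.1 ∪ p.2) (fun S _ => (S ∩ U, S ∩ V)) ?_ ?_ ?_ ?_ ?_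
  · rintro ⟨S, T⟩ h1
    simp only [Finset.mem_product, Finset.mem_filter, Finset.mem_powerset] at h1 ⊢
    obtain ⟨⟨hS, hS'⟩, hT, hT'⟩ := h1
    refine ⟨fun w hw => ?_, fun u hu w hw => ?_⟩
    · rcases Finset.mem_union.1 hw with hw | hw
      · exact (hW w).2 (Or.inl (hS hw))
      · exact (hW w).2 (Or.inr (hT hw))
    · rcases Finset.mem_union.1 hu with hu | hu <;> rcases Finset.mem_union.1 hw with hw | hw
      · exact hS' u hu w hw
      · exact (h u (hS hu) w (hT hw)).1
      · exact (h w (hS hw) u (hT hu)).2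
      · exact hT' u hu w hw
  · intro S hS
    simp only [Finset.mem_product, Finset.mem_filter, Finset.mem_powerset] at hS ⊢
    exact ⟨⟨Finset.inter_subset_right, fun u hu w hw =>
      hS.2 u (Finset.mem_inter.1 hu).1 w (Finset.mem_inter.1 hw).1⟩,
      Finset.inter_subset_right, fun u hu w hw =>
      hS.2 u (Finset.mem_inter.1 hu).1 w (Finset.mem_inter.1 hw).1⟩
  · rintro ⟨S, T⟩ h1
    simp only [Finset.mem_product, Finset.mem_filter, Finset.mem_powerset] at h1
    obtain ⟨⟨hS, -⟩, hT, -⟩ := h1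
    ext w
    · simp only [Finset.mem_inter, Finset.mem_union]
      exact ⟨fun ⟨h1, h2⟩ => h1.elim id fun h3 => absurd (hT h3) (hUV w h2),
        fun h1 => ⟨Or.inl h1, hS h1⟩⟩
    · simp only [Finset.mem_inter, Finset.mem_union]
      exact ⟨fun ⟨h1, h2⟩ => h1.elim (fun h3 => absurd h2 (hUV w (hS h3))) id,
        fun h1 => ⟨Or.inr h1, hT h1⟩⟩
  · intro S hS
    simp only [Finset.mem_filter, Finset.mem_powerset] at hS
    ext w
    simp only [Finset.mem_inter, Finset.mem_union]
    constructor
    · rintro (h1 | h1) <;> exact h1.1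
    · intro h1
      rcases (hW w).1 (hS.1 h1) with h2 | h2
      · exact Or.inl ⟨h1, h2⟩
      · exact Or.inr ⟨h1, h2⟩
  · rintro ⟨S, T⟩ h1
    simp only [Finset.mem_product, Finset.mem_filter, Finset.mem_powerset] at h1
    obtain ⟨⟨hS, -⟩, hT, -⟩ := h1
    rw [← pow_add, Finset.card_union_of_disjoint]
    exact Finset.disjoint_left.2 fun w h1 h2 => hUV w (hS h1) (hT h2)

open Classical in
/-- Deletion and link: a face either avoids the vertex `v` or contains it. -/
theorem indepPoly_erase {c : α → α → Prop} {U : Finset α} (hr : ∀ u ∈ U, c u u)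
    (hs : ∀ u ∈ U, ∀ w ∈ U, c u w → c w u) {v : α} (hv : v ∈ U) :
    indepPoly c U = indepPoly c (U.erase v) + X * indepPoly c {w ∈ U | w ≠ v ∧ c v w} := by
  have e1 : indepPoly c U =
      ∑ S ∈ U.powerset with ((∀ u ∈ S, ∀ w ∈ S, c u w) ∧ v ∉ S), X ^ S.card +
      ∑ S ∈ U.powerset with ((∀ u ∈ S, ∀ w ∈ S, c u w) ∧ v ∈ S), (X : ℝ[X]) ^ S.card := by
    rw [indepPoly, ← Finset.sum_filter_add_sum_filter_not _ (fun S => v ∉ S)]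
    simp only [Finset.filter_filter, not_not]
    congr
  rw [e1]
  congr 1
  · rw [indepPoly]
    refine Finset.sum_congr ?_ fun _ _ => rfl
    ext S
    simp only [Finset.mem_filter, Finset.mem_powerset, Finset.subset_erase]
    tauto
  · rw [indepPoly, Finset.mul_sum]
    symm
    refine Finset.sum_bij' (fun S _ => insert v S) (fun S _ => S.erase v) ?_ ?_ ?_ ?_ ?_
    · intro S hS
      simp only [Finset.mem_filter, Finset.mem_powerset] at hS ⊢
      have hS1 : ∀ w ∈ S, w ∈ U ∧ w ≠ v ∧ c v w := fun w hw => by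
        simpa using hS.1 hw
      refine ⟨?_, ?_, Finset.mem_insert_self _ _⟩
      · intro w hw
        rcases Finset.mem_insert.1 hw with rfl | hw
        · exact hv
        · exact (hS1 w hw).1
      · intro u hu w hw
        rcases Finset.mem_insert.1 hu with h1 | h1 <;> rcases Finset.mem_insert.1 hw with h2 | h2
        · rw [h1, h2]; exact hr _ hv
        · rw [h1]; exact (hS1 w h2).2.2
        · rw [h2]; exact hs _ hv _ (hS1 u h1).1 (hS1 u h1).2.2
        · exact hS.2 u h1 w h2
    · intro S hS
      simp only [Finset.mem_filter, Finset.mem_powerset] at hS ⊢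
      refine ⟨fun w hw => ?_, fun u hu w hw => ?_⟩
      · have hw' := Finset.mem_erase.1 hw
        simp only [Finset.mem_filter]
        exact ⟨hS.1 hw'.2, hw'.1, hS.2.1 v hS.2.2 w hw'.2⟩
      · exact hS.2.1 u (Finset.mem_of_mem_erase hu) w (Finset.mem_of_mem_erase hw)
    · intro S hS
      simp only [Finset.mem_filter, Finset.mem_powerset] at hS
      refine Finset.erase_insert fun h => ?_
      have := hS.1 h
      simp at this
    · intro S hS
      simp only [Finset.mem_filter, Finset.mem_powerset] at hS
      exact Finset.insert_erase hS.2.2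
    · intro S hS
      simp only [Finset.mem_filter, Finset.mem_powerset] at hS
      rw [Finset.card_insert_of_notMem, pow_succ, mul_comm]
      intro h
      have := hS.1 h
      simp at this

open Classical in
theorem indepPoly_eq_sum_link {c : α → α → Prop} (ρ : α → ℕ) (V : Finset α) :
    ∀ {U : Finset α}, (∀ u ∈ U, c u u) → (∀ u ∈ U, ∀ w ∈ U, c u w → c w u) → V ⊆ U →
    (∀ u ∈ V, ∀ w ∈ V, u ≠ w → ρ u = ρ w → ¬ c u w) →
    indepPoly c U = indepPoly c (U \ V) +
      ∑ v ∈ V, X * indepPoly c {w ∈ U | w ≠ v ∧ c v w ∧ (w ∈ V → ρ w < ρ v)} := by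
  induction V using Finset.induction_on_max_value ρ with
  | empty => intro U _ _ _ _; simp
  | insert a V ha hmax ih =>
    intro U hr hs hVU hne
    have haU : a ∈ U := hVU (Finset.mem_insert_self _ _)
    rw [indepPoly_erase hr hs haU, ih (U := U.erase a)
      (fun u hu => hr u (Finset.mem_of_mem_erase hu))
      (fun u hu w hw => hs u (Finset.mem_of_mem_erase hu) w (Finset.mem_of_mem_erase hw))
      (fun v hv => Finset.mem_erase.2 ⟨fun h => ha (h ▸ hv), hVU (Finset.mem_insert_of_mem hv)⟩)
      (fun u hu w hw => hne u (Finset.mem_insert_of_mem hu) w (Finset.mem_insert_of_mem hw)),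
      Finset.sum_insert ha]
    have e1 : U.erase a \ V = U \ insert a V := by
      ext w; simp only [Finset.mem_sdiff, Finset.mem_erase, Finset.mem_insert]; tauto
    have e2 : {w ∈ U | w ≠ a ∧ c a w} =
        {w ∈ U | w ≠ a ∧ c a w ∧ (w ∈ insert a V → ρ w < ρ a)} := by
      refine Finset.filter_congr fun w hw => ?_
      constructor
      · rintro ⟨h1, h2⟩
        refine ⟨h1, h2, fun h3 => ?_⟩
        have h4 : w ∈ V := (Finset.mem_insert.1 h3).resolve_left h1
        refine lt_of_le_of_ne (hmax w h4) fun h5 => ?_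
        exact hne a (Finset.mem_insert_self _ _) w h3 h1.symm h5.symm h2
      · rintro ⟨h1, h2, -⟩; exact ⟨h1, h2⟩
    have e3 : ∀ v ∈ V, {w ∈ U.erase a | w ≠ v ∧ c v w ∧ (w ∈ V → ρ w < ρ v)} =
        {w ∈ U | w ≠ v ∧ c v w ∧ (w ∈ insert a V → ρ w < ρ v)} := by
      intro v hv
      ext w
      simp only [Finset.mem_filter, Finset.mem_erase, Finset.mem_insert]
      constructor
      · rintro ⟨⟨h1, h2⟩, h3, h4, h5⟩
        exact ⟨h2, h3, h4, fun h6 => h5 (h6.resolve_left h1)⟩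
      · rintro ⟨h2, h3, h4, h5⟩
        refine ⟨⟨?_, h2⟩, h3, h4, fun h6 => h5 (Or.inr h6)⟩
        rintro rfl
        exact absurd (h5 (Or.inl rfl)) (not_lt.2 (hmax v hv))
    rw [e1, e2, Finset.sum_congr rfl fun v hv => by rw [e3 v hv]]
    ring

/-- A face is sorted by its element of `V` of largest rank `ρ`, which is unique because distinct
vertices of `V` with equal rank are incompatible. Here `U'` is the complement of `V`, and `L v` is
the set of the vertices that can occur together with `v`. -/
theorem indepPoly_rank {c : α → α → Prop} {U V U' : Finset α} {L : α → Finset α} (ρ : α → ℕ)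
    (hr : ∀ u ∈ U, c u u) (hs : ∀ u ∈ U, ∀ w ∈ U, c u w → c w u) (hVU : V ⊆ U)
    (hne : ∀ u ∈ V, ∀ w ∈ V, u ≠ w → ρ u = ρ w → ¬ c u w) (hU' : ∀ w, w ∈ U' ↔ w ∈ U ∧ w ∉ V)
    (hL : ∀ v ∈ V, ∀ w, w ∈ L v ↔ w ∈ U ∧ w ≠ v ∧ c v w ∧ (w ∈ V → ρ w < ρ v)) :
    indepPoly c U = indepPoly c U' + ∑ v ∈ V, X * indepPoly c (L v) := by
  classical
  rw [indepPoly_eq_sum_link ρ V hr hs hVU hne]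
  congr 1
  · congr 1; ext w; rw [hU', Finset.mem_sdiff]
  · refine Finset.sum_congr rfl fun v hv => ?_
    congr 2; ext w; rw [hL v hv, Finset.mem_filter]

end IndepPoly

/-! ### Dissections of a polygon -/

section Linear

/-- Two arcs `u` and `w` (with endpoints `u.1 < u.2` and `w.1 < w.2` on a line) do not cross. -/
def Noncrossing (u w : ℤ × ℤ) : Prop :=
  ¬ ((u.1 < w.1 ∧ w.1 < u.2 ∧ u.2 < w.2) ∨ (w.1 < u.1 ∧ u.1 < w.2 ∧ w.2 < u.2))

/-- The arcs of length at least `2` with endpoints in `[p, q]`: the diagonals and the base edge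
`(p, q)` of a polygon with the vertices `p, p + 1, …, q`. -/
noncomputable def linearArcs (p q : ℤ) : Finset (ℤ × ℤ) :=
  {u ∈ Finset.Icc p q ×ˢ Finset.Icc p q | u.1 + 2 ≤ u.2}

theorem mem_linearArcs {p q : ℤ} {u : ℤ × ℤ} :
    u ∈ linearArcs p q ↔ p ≤ u.1 ∧ u.1 + 2 ≤ u.2 ∧ u.2 ≤ q := by
  simp only [linearArcs, Finset.mem_filter, Finset.mem_product, Finset.mem_Icc]
  omega

/-- The generating polynomial of the dissections of the polygon with vertices `0, …, n`, where the
base edge `(0, n)` may be used as an additional arc if `2 ≤ n`. -/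
noncomputable def basedPoly (n : ℕ) : ℝ[X] := indepPoly Noncrossing (linearArcs 0 n)

/-- The generating polynomial of the dissections of the polygon with vertices `0, …, n`. -/
noncomputable def dissPoly (n : ℕ) : ℝ[X] := indepPoly Noncrossing ((linearArcs 0 n).erase (0, n))

/-- The generating polynomial of a side of length `n` of a cell of a dissection: either an edge of
the polygon, or an arc together with a dissection of the polygon that it cuts off. -/
noncomputable def sidePoly (n : ℕ) : ℝ[X] :=
  if n = 0 then 0 else if n = 1 then 1 else X * dissPoly n

theorem Noncrossing.refl (u : ℤ × ℤ) : Noncrossing u u := by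
  simp [Noncrossing]

theorem Noncrossing.symm {u w : ℤ × ℤ} (h : Noncrossing u w) : Noncrossing w u :=
  fun h' => h h'.symm

theorem indepPoly_linearArcs {p q : ℤ} {n : ℕ} (h : q - p = n) :
    indepPoly Noncrossing (linearArcs p q) = basedPoly n := by
  refine indepPoly_bij (fun u => (u.1 + p, u.2 + p)) ?_ ?_ ?_ ?_
  · intro u hu
    rw [mem_linearArcs] at hu ⊢
    omega
  · intro u _ w _ h
    simpa [Prod.ext_iff] using h
  · intro v hv
    refine ⟨(v.1 - p, v.2 - p), ?_, by simp⟩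
    rw [mem_linearArcs] at hv ⊢
    omega
  · intro u _ w _
    simp only [Noncrossing]
    omega

theorem basedPoly_zero : basedPoly 0 = 1 := by
  have : linearArcs 0 ((0 : ℕ) : ℤ) = ∅ := by
    ext u; simp only [mem_linearArcs, Finset.notMem_empty, iff_false]; omega
  rw [basedPoly, this, indepPoly_empty]

theorem basedPoly_one : basedPoly 1 = 1 := by
  have : linearArcs 0 ((1 : ℕ) : ℤ) = ∅ := by
    ext u; simp only [mem_linearArcs, Finset.notMem_empty, iff_false]; omega
  rw [basedPoly, this, indepPoly_empty]

/-- A single vertex that is compatible with itself. -/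
theorem indepPoly_singleton {α : Type*} {c : α → α → Prop} {v : α} (h : c v v) :
    indepPoly c {v} = 1 + X := by
  classical
  rw [indepPoly_erase (v := v) (by simpa using h) (by simp) (by simp)]
  have e1 : ({v} : Finset α).erase v = ∅ := by simp
  have e2 : ({w ∈ ({v} : Finset α) | w ≠ v ∧ c v w}) = ∅ := by
    ext w; simp +contextual
  rw [e1, e2, indepPoly_empty, mul_one]

/-- The base edge crosses no arc, so that it is a cone point. -/
theorem basedPoly_eq {n : ℕ} (hn : 2 ≤ n) : basedPoly n = (1 + X) * dissPoly n := by
  rw [basedPoly, dissPoly, ← indepPoly_singleton (Noncrossing.refl (0, (n : ℤ)))]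
  refine indepPoly_join ?_ ?_ ?_
  · intro w
    simp only [Finset.mem_singleton, Finset.mem_erase, mem_linearArcs]
    by_cases h : w = (0, (n : ℤ))
    · subst h; simp; omega
    · simp [h]
  · simp
  · intro u hu v hv
    simp only [Finset.mem_singleton, Finset.mem_erase, mem_linearArcs] at hu hv
    subst hu
    simp only [Noncrossing]
    omega

/-- The side covering the edge `[0, 1]` of the cell at the base edge cuts off a polygon, and the
rest of the dissection lies on its other side. -/
theorem basedPoly_rec {n : ℕ} (hn : 1 ≤ n) :
    basedPoly n = ∑ b ∈ Finset.Icc 1 n, sidePoly b * basedPoly (n - b) := by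
  rw [basedPoly, indepPoly_rank (fun u => u.2.toNat) (V := {u ∈ linearArcs 0 n | u.1 = 0})
    (U' := linearArcs 1 n) (L := fun v => (linearArcs 0 v.2).erase (0, v.2) ∪ linearArcs v.2 n)
    (fun u _ => Noncrossing.refl u) (fun u _ w _ h => h.symm) (Finset.filter_subset _ _),
    indepPoly_linearArcs (n := n - 1) (by omega),
    ← Finset.add_sum_Ioc_eq_sum_Icc hn]
  rotate_left
  · intro u hu w hw h1 h2
    simp only [Finset.mem_filter, mem_linearArcs] at hu hw
    exact absurd (Prod.ext (by omega) (by omega)) h1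
  · intro u
    simp only [Finset.mem_filter, mem_linearArcs]
    omega
  · rintro ⟨a, b⟩ hv ⟨a', b'⟩
    simp only [Finset.mem_filter, Finset.mem_union, Finset.mem_erase, mem_linearArcs, Noncrossing,
      ne_eq, Prod.mk.injEq] at hv ⊢
    grind
  congr 1
  · simp [sidePoly]
  symm
  refine Finset.sum_bij (fun b _ => ((0 : ℤ), (b : ℤ))) ?_ ?_ ?_ ?_
  · intro b hb
    simp only [Finset.mem_Ioc, Finset.mem_filter, mem_linearArcs] at hb ⊢
    exact ⟨by omega, trivial⟩
  · intro b _ b' _ h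
    simpa using h
  · intro v hv
    simp only [Finset.mem_filter, mem_linearArcs] at hv
    refine ⟨v.2.toNat, ?_, ?_⟩
    · simp only [Finset.mem_Ioc]; omega
    · exact Prod.ext (by simp; omega) (by simp; omega)
  · intro b hb
    simp only [Finset.mem_Ioc] at hb
    rw [sidePoly, if_neg (by omega), if_neg (by omega), mul_assoc, dissPoly,
      ← indepPoly_linearArcs (p := b) (q := n) (n := n - b) (by omega)]
    congr 1
    symm
    refine indepPoly_join ?_ ?_ ?_
    · exact fun w => Finset.mem_union
    · intro u hu hv
      simp only [Finset.mem_erase, mem_linearArcs] at hu hv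
      omega
    · intro u hu v hv
      simp only [Finset.mem_erase, mem_linearArcs] at hu hv
      simp only [Noncrossing]
      omega

theorem dissPoly_eq {n : ℕ} (hn : 2 ≤ n) :
    dissPoly n = ∑ b ∈ Finset.Ico 1 n, sidePoly b * basedPoly (n - b) := by
  have h := basedPoly_rec (n := n) (by omega)
  rw [← Finset.sum_Ico_add_eq_sum_Icc (by omega), Nat.sub_self, basedPoly_zero, mul_one,
    basedPoly_eq hn] at h
  have h1 : sidePoly n = X * dissPoly n := by
    rw [sidePoly, if_neg (by omega), if_neg (by omega)]
  rw [h1] at h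
  linear_combination h

theorem natDegree_dissPoly_le (n : ℕ) :
    (dissPoly n).natDegree ≤ n - 2 := by
  induction n using Nat.strong_induction_on with
  | _ n ih =>
  have hb : ∀ m < n, (basedPoly m).natDegree ≤ m - 1 := by
    intro m hm
    rcases (by omega : m = 0 ∨ m = 1 ∨ 2 ≤ m) with rfl | rfl | h
    · simp [basedPoly_zero]
    · simp [basedPoly_one]
    · rw [basedPoly_eq h]
      refine natDegree_mul_le.trans ?_
      have h1 : (1 + X : ℝ[X]).natDegree ≤ 1 := by compute_degree
      have := ih m hm
      omega
  have hs : ∀ m < n, (sidePoly m).natDegree ≤ m - 1 := by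
    intro m hm
    rw [sidePoly]
    split_ifs with h0 h1
    · simp
    · simp
    · refine natDegree_mul_le.trans ?_
      have := ih m hm
      rw [natDegree_X]
      omega
  rcases lt_or_ge n 2 with h | h
  · have : (linearArcs 0 (n : ℤ)).erase (0, (n : ℤ)) = ∅ := by
      ext u; simp only [Finset.mem_erase, mem_linearArcs, Finset.notMem_empty, iff_false]; omega
    rw [dissPoly, this, indepPoly_empty]; simp
  · rw [dissPoly_eq h]
    refine natDegree_sum_le_of_forall_le _ _ fun b hb' => natDegree_mul_le.trans ?_
    simp only [Finset.mem_Ico] at hb'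
    have h1 := hs b (by omega)
    have h2 := hb (n - b) (by omega)
    omega

theorem natDegree_basedPoly_le (n : ℕ) : (basedPoly n).natDegree ≤ n - 1 := by
  rcases (by omega : n = 0 ∨ n = 1 ∨ 2 ≤ n) with rfl | rfl | h
  · simp [basedPoly_zero]
  · simp [basedPoly_one]
  · rw [basedPoly_eq h]
    refine natDegree_mul_le.trans ?_
    have h1 : (1 + X : ℝ[X]).natDegree ≤ 1 := by compute_degree
    have := natDegree_dissPoly_le n
    omega

theorem natDegree_sidePoly_le (n : ℕ) : (sidePoly n).natDegree ≤ n - 1 := by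
  rw [sidePoly]
  split_ifs with h0 h1
  · simp
  · simp
  · refine natDegree_mul_le.trans ?_
    have := natDegree_dissPoly_le n
    rw [natDegree_X]
    omega

end Linear

/-! ### Dissections of a punctured polygon -/

section Cyclic

/-- Two arcs on the line do not cross after any translation by a multiple of `N`. For arcs of length
at most `N` whose left endpoints differ by less than `N`, the three translations occurring here
suffice. -/
def CyclicNoncrossing (N : ℕ) (u w : ℤ × ℤ) : Prop :=
  Noncrossing u w ∧ Noncrossing u (w.1 + N, w.2 + N) ∧ Noncrossing u (w.1 - N, w.2 - N)

/-- The variant of `CyclicNoncrossing` in which the arcs of length `N`, thought of as the radii of a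
punctured polygon, are compatible with each other. -/
def RadialCompat (N : ℕ) (u w : ℤ × ℤ) : Prop :=
  CyclicNoncrossing N u w ∨ (u.2 = u.1 + N ∧ w.2 = w.1 + N)

/-- Representatives, with left endpoint in `[L, L + N)`, of the arcs of length between `2` and `N`
modulo translation by `N`. -/
noncomputable def cyclicArcs (L : ℤ) (N : ℕ) : Finset (ℤ × ℤ) :=
  {u ∈ Finset.Ico L (L + N) ×ˢ Finset.Icc L (L + 2 * N) | u.1 + 2 ≤ u.2 ∧ u.2 ≤ u.1 + N}

theorem mem_cyclicArcs {L : ℤ} {N : ℕ} {u : ℤ × ℤ} :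
    u ∈ cyclicArcs L N ↔ L ≤ u.1 ∧ u.1 < L + N ∧ u.1 + 2 ≤ u.2 ∧ u.2 ≤ u.1 + N := by
  simp only [cyclicArcs, Finset.mem_filter, Finset.mem_product, Finset.mem_Icc, Finset.mem_Ico]
  omega

theorem CyclicNoncrossing.symm {N : ℕ} {u w : ℤ × ℤ} (h : CyclicNoncrossing N u w) :
    CyclicNoncrossing N w u := by
  simp only [CyclicNoncrossing, Noncrossing] at *
  omega

theorem CyclicNoncrossing.refl {L : ℤ} {N : ℕ} {u : ℤ × ℤ} (h : u ∈ cyclicArcs L N) :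
    CyclicNoncrossing N u u := by
  rw [mem_cyclicArcs] at h
  simp only [CyclicNoncrossing, Noncrossing]
  omega

theorem RadialCompat.symm {N : ℕ} {u w : ℤ × ℤ} (h : RadialCompat N u w) : RadialCompat N w u :=
  h.imp (·.symm) And.symm

theorem RadialCompat.refl {L : ℤ} {N : ℕ} {u : ℤ × ℤ} (h : u ∈ cyclicArcs L N) :
    RadialCompat N u u := Or.inl (.refl h)

/-- The arcs of `[a, b]`, with `b ≤ a + N`, represented modulo `N`, are the same as the arcs on a
line. -/
theorem indepPoly_inside {α : Type*} {c : α → α → Prop} {L a b : ℤ} {N : ℕ} {I : Finset α}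
    (f : α → ℤ × ℤ) (ha : L ≤ a) (ha' : a < L + N) (hab : a + 2 ≤ b) (hb : b ≤ a + N)
    (hf : Set.InjOn f I)
    (hI : ∀ w ∈ I, f w ∈ cyclicArcs L N ∧ (f w).2 < (f w).1 + N ∧ f w ≠ (a, b) ∧
      ((a ≤ (f w).1 ∧ (f w).2 ≤ b) ∨ (a ≤ (f w).1 + N ∧ (f w).2 + N ≤ b)))
    (hI' : ∀ u, u ∈ cyclicArcs L N ∧ u.2 < u.1 + N ∧ u ≠ (a, b) ∧
      ((a ≤ u.1 ∧ u.2 ≤ b) ∨ (a ≤ u.1 + N ∧ u.2 + N ≤ b)) → ∃ w ∈ I, f w = u)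
    (hc : ∀ w ∈ I, ∀ w' ∈ I, c w w' ↔ CyclicNoncrossing N (f w) (f w')) :
    indepPoly c I = dissPoly (b - a).toNat := by
  symm
  refine indepPoly_bij
    (fun w => if a ≤ (f w).1 then ((f w).1 - a, (f w).2 - a)
      else ((f w).1 + N - a, (f w).2 + N - a))
    ?_ ?_ ?_ ?_
  · intro w hw
    have h := hI w hw
    generalize f w = u at h
    obtain ⟨u1, u2⟩ := u
    simp only [mem_cyclicArcs, ne_eq, Prod.mk.injEq, Finset.mem_erase, mem_linearArcs] at h ⊢
    split_ifs <;> simp only [Prod.mk.injEq] <;> omega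
  · intro w hw w' hw' h
    refine hf hw hw' ?_
    have h1 := hI w hw
    have h2 := hI w' hw'
    revert h
    dsimp only
    generalize f w = u at *
    generalize f w' = u' at *
    obtain ⟨u1, u2⟩ := u
    obtain ⟨v1, v2⟩ := u'
    simp only [mem_cyclicArcs, ne_eq, Prod.mk.injEq] at h1 h2 ⊢
    split_ifs <;> simp only [Prod.mk.injEq] <;> omega
  · rintro ⟨v1, v2⟩ hv
    simp only [ne_eq, Prod.mk.injEq, Finset.mem_erase, mem_linearArcs] at hv
    obtain ⟨w, hw, hw'⟩ := hI' (if v1 + a < L + N then (v1 + a, v2 + a)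
      else (v1 + a - N, v2 + a - N)) (by
        split_ifs <;> simp only [mem_cyclicArcs, ne_eq, Prod.mk.injEq] <;> omega)
    refine ⟨w, hw, ?_⟩
    rw [hw']
    split_ifs <;> simp only at * <;> simp only [Prod.mk.injEq] <;> omega
  · intro w hw w' hw'
    rw [hc w hw w' hw']
    have h1 := hI w hw
    have h2 := hI w' hw'
    generalize f w = u at *
    generalize f w' = u' at *
    obtain ⟨u1, u2⟩ := u
    obtain ⟨v1, v2⟩ := u'
    simp only [mem_cyclicArcs, ne_eq, Prod.mk.injEq, CyclicNoncrossing] at h1 h2 ⊢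
    split_ifs <;> simp only [Noncrossing] <;> omega

/-- The arcs of length less than `N`. -/
noncomputable def shortArcs (L : ℤ) (N : ℕ) : Finset (ℤ × ℤ) :=
  {u ∈ cyclicArcs L N | u.2 < u.1 + N}

theorem mem_shortArcs {L : ℤ} {N : ℕ} {u : ℤ × ℤ} :
    u ∈ shortArcs L N ↔ L ≤ u.1 ∧ u.1 < L + N ∧ u.1 + 2 ≤ u.2 ∧ u.2 < u.1 + N := by
  simp only [shortArcs, Finset.mem_filter, mem_cyclicArcs]
  omega

theorem radialCompat_iff_of_short {N : ℕ} {u w : ℤ × ℤ} (h : u.2 < u.1 + N ∨ w.2 < w.1 + N) :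
    RadialCompat N u w ↔ CyclicNoncrossing N u w := by
  simp only [RadialCompat]
  constructor
  · rintro (h | h)
    · exact h
    · omega
  · exact Or.inl

theorem indepPoly_insideShort {L a b : ℤ} {N : ℕ} (ha : L ≤ a) (ha' : a < L + N)
    (hab : a + 2 ≤ b) (hb : b ≤ a + N) {c : ℤ × ℤ → ℤ × ℤ → Prop}
    (hc : ∀ u w : ℤ × ℤ, u.2 < u.1 + N → w.2 < w.1 + N → (c u w ↔ CyclicNoncrossing N u w)) :
    indepPoly c {w ∈ shortArcs L N | w ≠ (a, b) ∧
      ((a ≤ w.1 ∧ w.2 ≤ b) ∨ (a ≤ w.1 + N ∧ w.2 + N ≤ b))} = dissPoly (b - a).toNat := by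
  refine indepPoly_inside id ha ha' hab hb (Set.injOn_id _) ?_ ?_ ?_
  · intro w hw
    simp only [Finset.mem_filter, mem_shortArcs, id, mem_cyclicArcs] at hw ⊢
    exact ⟨by omega, by omega, hw.2⟩
  · rintro u ⟨h1, h2, h3⟩
    refine ⟨u, ?_, rfl⟩
    rw [mem_cyclicArcs] at h1
    simp only [Finset.mem_filter, mem_shortArcs]
    exact ⟨by omega, h3⟩
  · intro w hw w' hw'
    simp only [Finset.mem_filter, mem_shortArcs] at hw hw'
    exact hc w w' hw.1.2.2.2 hw'.1.2.2.2

/-- Summation over the short arcs that cover the edge `[L + N - 1, L + N]`: there are `k - 1` of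
them of length `k` that have this edge in their interior, and one starting with it. -/
theorem sum_covering {L : ℤ} {N : ℕ} (F : ℕ → ℝ[X]) :
    ∑ v ∈ shortArcs L N with L + N ≤ v.2, F (v.2 - v.1).toNat =
      ∑ k ∈ Finset.Ioo 1 N, k * F k := by
  rw [← Finset.sum_fiberwise_of_maps_to (t := Finset.Ioo 1 N) (g := fun v => (v.2 - v.1).toNat)]
  · refine Finset.sum_congr rfl fun k hk => ?_
    rw [Finset.sum_congr rfl (g := fun _ => F k), Finset.sum_const, nsmul_eq_mul]
    · congr
      have e : ({v ∈ {v ∈ shortArcs L N | L + N ≤ v.2} | (v.2 - v.1).toNat = k}) =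
          (Finset.Ico (L + N - k) (L + N)).image fun a => (a, a + (k : ℤ)) := by
        ext ⟨a, b⟩
        simp only [Finset.mem_Ioo] at hk
        simp only [Finset.mem_filter, mem_shortArcs, Finset.mem_image, Finset.mem_Ico,
          Prod.mk.injEq]
        constructor
        · intro h
          exact ⟨a, by omega, rfl, by omega⟩
        · rintro ⟨a', h1, rfl, rfl⟩
          omega
      rw [e, Finset.card_image_of_injective _ fun a b h => (Prod.mk.inj h).1, Int.card_Ico]
      omega
    · intro v hv
      rw [(Finset.mem_filter.1 hv).2]
  · intro v hv
    simp only [Finset.mem_filter, mem_shortArcs] at hv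
    simp only [Finset.mem_Ioo]
    omega

/-- The side of the central region that covers the edge `[L + N - 1, L + N]` cuts off a polygon.
The vertices of the complex `U` are the short arcs and possibly radii; the polynomial `Q n` counts
the faces that lie between two vertices of the punctured polygon at distance `n`. -/
theorem indepPoly_centralSide {L : ℤ} {N : ℕ} {U : Finset (ℤ × ℤ)} {Q : ℕ → ℝ[X]}
    (hN : 2 ≤ N) (hU : U ⊆ cyclicArcs L N) (hU' : shortArcs L N ⊆ U)
    (hQ : ∀ p q : ℤ, L ≤ p → p < q → q < L + N →
      indepPoly (RadialCompat N)
        {w ∈ U | p ≤ w.1 ∧ (w.2 ≤ q ∨ (w.2 = w.1 + N ∧ w.1 ≤ q))} = Q (q - p).toNat) :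
    indepPoly (RadialCompat N) U =
      ∑ k ∈ Finset.Ico 1 N, k * (sidePoly k * Q (N - k)) := by
  classical
  rw [indepPoly_rank (fun u => (u.2 - u.1).toNat) (V := {v ∈ shortArcs L N | L + N ≤ v.2})
    (U' := {w ∈ U | L ≤ w.1 ∧ (w.2 ≤ L + N - 1 ∨ (w.2 = w.1 + N ∧ w.1 ≤ L + N - 1))})
    (L := fun v => {w ∈ shortArcs L N | w ≠ (v.1, v.2) ∧
      ((v.1 ≤ w.1 ∧ w.2 ≤ v.2) ∨ (v.1 ≤ w.1 + N ∧ w.2 + N ≤ v.2))} ∪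
      {w ∈ U | v.2 - N ≤ w.1 ∧ (w.2 ≤ v.1 ∨ (w.2 = w.1 + N ∧ w.1 ≤ v.1))})
    (fun u hu => .refl (hU hu)) (fun u _ w _ h => h.symm)
    ((Finset.filter_subset _ _).trans hU')]
  rotate_left
  · rintro ⟨a, b⟩ h1 ⟨a', b'⟩ h2 h3 h4
    simp only [Finset.mem_filter, mem_shortArcs] at h1 h2
    rw [radialCompat_iff_of_short (Or.inl h1.1.2.2.2)]
    simp only [CyclicNoncrossing, Noncrossing, ne_eq, Prod.mk.injEq] at *
    omega
  · intro w
    have h1 := fun hw : w ∈ U => mem_cyclicArcs.1 (hU hw)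
    simp only [Finset.mem_filter, mem_shortArcs]
    constructor
    · rintro ⟨h2, h3⟩
      have := h1 h2
      exact ⟨h2, by omega⟩
    · rintro ⟨h2, h3⟩
      have := h1 h2
      exact ⟨h2, by omega⟩
  · rintro ⟨a, b⟩ hv ⟨a', b'⟩
    have h1 := fun hw : (a', b') ∈ U => mem_cyclicArcs.1 (hU hw)
    have h2 := @hU' (a', b')
    simp only [Finset.mem_filter, mem_shortArcs] at hv
    rw [radialCompat_iff_of_short (Or.inl hv.1.2.2.2)]
    simp only [Finset.mem_filter, Finset.mem_union, mem_shortArcs, ne_eq, Prod.mk.injEq,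
      CyclicNoncrossing, Noncrossing] at *
    constructor
    · rintro (h3 | ⟨h3, h4⟩)
      · refine ⟨h2 h3.1, ?_, ?_, ?_⟩
        · omega
        · omega
        · omega
      · have := h1 h3
        refine ⟨h3, ?_, ?_, ?_⟩
        · omega
        · omega
        · omega
    · rintro ⟨h3, h4, h5, h6⟩
      have h7 := h1 h3
      by_cases h8 : b' < a' + N ∧ ((a ≤ a' ∧ b' ≤ b) ∨ (a ≤ a' + N ∧ b' + N ≤ b))
      · exact Or.inl ⟨by omega, h4, h8.2⟩
      · refine Or.inr ⟨h3, ?_⟩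
        grind
  rw [hQ L (L + N - 1) le_rfl (by omega) (by omega), ← Finset.sum_Ioo_add_eq_sum_Ico (by omega)]
  rw [add_comm]
  congr 1
  · rw [← sum_covering (L := L) (F := fun k => sidePoly k * Q (N - k))]
    refine Finset.sum_congr rfl ?_
    rintro ⟨a, b⟩ hv
    simp only [Finset.mem_filter, mem_shortArcs] at hv
    rw [sidePoly, if_neg (by omega), if_neg (by omega), mul_assoc,
      ← indepPoly_insideShort hv.1.1 hv.1.2.1 hv.1.2.2.1 hv.1.2.2.2.le (c := RadialCompat N)
        (fun u w hu _ => radialCompat_iff_of_short (Or.inl hu))]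
    have e : N - (b - a).toNat = (a - (b - N)).toNat := by omega
    rw [e, ← hQ (b - N) a (by omega) (by omega) (by omega)]
    congr 1
    refine indepPoly_join (fun w => Finset.mem_union) ?_ ?_
    · rintro ⟨a', b'⟩ h1 h2
      simp only [Finset.mem_filter, mem_shortArcs] at h1 h2
      omega
    · rintro ⟨a', b'⟩ h1 ⟨a'', b''⟩ h2
      simp only [Finset.mem_filter, mem_shortArcs] at h1 h2
      have h3 := mem_cyclicArcs.1 (hU h2.1)
      rw [radialCompat_iff_of_short (Or.inl h1.1.2.2.2),
        radialCompat_iff_of_short (Or.inr h1.1.2.2.2)]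
      simp only [CyclicNoncrossing, Noncrossing]
      omega
  · have e : (L + N - 1 - L).toNat = N - 1 := by omega
    simp [sidePoly, e]

theorem indepPoly_shortArcs {L : ℤ} {N : ℕ} (hN : 2 ≤ N) :
    indepPoly (RadialCompat N) (shortArcs L N) =
      ∑ k ∈ Finset.Ico 1 N, (k : ℝ[X]) * (sidePoly k * basedPoly (N - k)) := by
  refine indepPoly_centralSide (L := L) hN (Finset.filter_subset _ _) subset_rfl ?_
  intro p q hp hpq hq
  rw [← indepPoly_linearArcs (p := p) (q := q) (by omega)]
  refine indepPoly_bij id ?_ (Set.injOn_id _) ?_ ?_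
  · intro w hw
    simp only [mem_linearArcs, Finset.mem_filter, mem_shortArcs, id] at hw ⊢
    omega
  · intro w hw
    refine ⟨w, ?_, rfl⟩
    simp only [mem_linearArcs, Finset.mem_filter, mem_shortArcs] at hw ⊢
    omega
  · intro u hu w hw
    simp only [mem_linearArcs] at hu hw
    rw [radialCompat_iff_of_short (Or.inl (by simp only [id]; omega))]
    simp only [CyclicNoncrossing, Noncrossing, id]
    omega

/-- Cutting the punctured polygon along the side of the central region from `p` to `q` leaves a
polygon with the puncture as an additional vertex, in which the radii at `p` and `q` are edges. -/
theorem indepPoly_fan {L p q : ℤ} {N : ℕ} (hp : L ≤ p) (hpq : p < q) (hq : q < L + N) :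
    indepPoly (RadialCompat N)
      {w ∈ cyclicArcs L N | p ≤ w.1 ∧ (w.2 ≤ q ∨ (w.2 = w.1 + N ∧ w.1 ≤ q))} =
      (1 + X) * basedPoly ((q - p).toNat + 1) := by
  rw [← indepPoly_linearArcs (p := p) (q := q + 1) (n := (q - p).toNat + 1) (by omega),
    ← indepPoly_singleton (c := RadialCompat N) (v := (q, q + N))
      (.refl (L := q) (by simp only [mem_cyclicArcs]; omega))]
  rw [indepPoly_join (U := {(q, q + (N : ℤ))}) (V := {w ∈ cyclicArcs L N | p ≤ w.1 ∧
    (w.2 ≤ q ∨ (w.2 = w.1 + N ∧ w.1 < q))})]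
  · congr 1
    symm
    refine indepPoly_bij (fun w => if w.2 = w.1 + N then (w.1, q + 1) else w) ?_ ?_ ?_ ?_
    · rintro ⟨a, b⟩ hw
      simp only [Finset.mem_filter, mem_cyclicArcs] at hw ⊢
      split_ifs <;> simp only [mem_linearArcs] <;> omega
    · rintro ⟨a, b⟩ hu ⟨a', b'⟩ hw
      simp only [Finset.coe_filter, Set.mem_ofPred_eq, mem_cyclicArcs] at hu hw
      dsimp only
      split_ifs <;> simp only [Prod.mk.injEq] <;> omega
    · rintro ⟨a, b⟩ hw
      simp only [mem_linearArcs] at hw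
      by_cases h : b = q + 1
      · refine ⟨(a, a + N), ?_, ?_⟩
        · simp only [Finset.mem_filter, mem_cyclicArcs]; grind
        · simp [h]
      · refine ⟨(a, b), ?_, ?_⟩
        · simp only [Finset.mem_filter, mem_cyclicArcs]; omega
        · have h1 : b ≠ a + N := by omega
          simp [h1]
    · rintro ⟨a, b⟩ hu ⟨a', b'⟩ hw
      simp only [Finset.mem_filter, mem_cyclicArcs] at hu hw
      simp only [RadialCompat, CyclicNoncrossing]
      split_ifs <;> simp only [Noncrossing] <;> omega
  · rintro ⟨a, b⟩
    simp only [Finset.mem_filter, mem_cyclicArcs, Finset.mem_singleton, Prod.mk.injEq]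
    omega
  · intro u hu
    simp only [Finset.mem_singleton] at hu
    subst hu
    simp only [Finset.mem_filter, mem_cyclicArcs]
    omega
  · intro u hu v hv
    simp only [Finset.mem_singleton] at hu
    subst hu
    simp only [Finset.mem_filter, mem_cyclicArcs] at hv
    simp only [RadialCompat, CyclicNoncrossing, Noncrossing, true_and, and_true]
    omega

theorem indepPoly_cyclicArcs_radial {L : ℤ} {N : ℕ} (hN : 2 ≤ N) :
    indepPoly (RadialCompat N) (cyclicArcs L N) =
      ∑ k ∈ Finset.Ico 1 N, (k : ℝ[X]) * (sidePoly k * ((1 + X) * basedPoly (N - k + 1))) :=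
  indepPoly_centralSide (Q := fun n => (1 + X) * basedPoly (n + 1)) hN subset_rfl
    (Finset.filter_subset _ _) fun _ _ => indepPoly_fan

/-- The generating polynomial of the dissections of a `2N`-gon that are symmetric under the
rotation by `180` degrees. -/
theorem indepPoly_cyclicArcs {L : ℤ} {N : ℕ} (hN : 2 ≤ N) :
    indepPoly (CyclicNoncrossing N) (cyclicArcs L N) =
      ∑ k ∈ Finset.Icc 1 N, (k : ℝ[X]) * (sidePoly k * basedPoly (N - k)) := by
  rw [← Finset.sum_Ico_add_eq_sum_Icc (by omega), ← indepPoly_shortArcs (L := L) hN,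
    indepPoly_rank (fun _ => 0) (V := {v ∈ cyclicArcs L N | v.2 = v.1 + (N : ℤ)})
    (U' := shortArcs L N)
    (L := fun v => {w ∈ shortArcs L N | w ≠ (v.1, v.2) ∧
      ((v.1 ≤ w.1 ∧ w.2 ≤ v.2) ∨ (v.1 ≤ w.1 + (N : ℤ) ∧ w.2 + (N : ℤ) ≤ v.2))})
    (fun u hu => .refl hu) (fun u _ w _ h => h.symm) (Finset.filter_subset _ _)]
  rotate_left
  · rintro ⟨a, b⟩ h1 ⟨a', b'⟩ h2 h3 h4
    simp only [Finset.mem_filter, mem_cyclicArcs] at h1 h2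
    simp only [CyclicNoncrossing, Noncrossing, ne_eq, Prod.mk.injEq] at *
    omega
  · intro w
    simp only [Finset.mem_filter, mem_cyclicArcs, mem_shortArcs]
    omega
  · rintro ⟨a, b⟩ hv ⟨a', b'⟩
    simp only [Finset.mem_filter, mem_cyclicArcs, mem_shortArcs, CyclicNoncrossing, Noncrossing,
      ne_eq, Prod.mk.injEq] at *
    omega
  congr 1
  · refine indepPoly_bij id ?_ (Set.injOn_id _) ?_ ?_
    · exact fun u hu => hu
    · exact fun u hu => ⟨u, hu, rfl⟩
    · intro u hu w _
      rw [mem_shortArcs] at hu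
      exact (radialCompat_iff_of_short (Or.inl hu.2.2.2)).symm
  · rw [Finset.sum_congr rfl (g := fun _ => X * dissPoly N)]
    · rw [Finset.sum_const, nsmul_eq_mul, sidePoly, if_neg (by omega), if_neg (by omega),
        Nat.sub_self, basedPoly_zero, mul_one]
      congr
      have e : ({v ∈ cyclicArcs L N | v.2 = v.1 + (N : ℤ)}) =
          (Finset.Ico L (L + N)).image fun a => (a, a + (N : ℤ)) := by
        ext ⟨a, b⟩
        simp only [Finset.mem_filter, mem_cyclicArcs, Finset.mem_image, Finset.mem_Ico,
          Prod.mk.injEq]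
        constructor
        · intro h
          exact ⟨a, by omega, rfl, by omega⟩
        · rintro ⟨a', h1, rfl, rfl⟩
          omega
      rw [e, Finset.card_image_of_injective _ fun a b h => (Prod.mk.inj h).1, Int.card_Ico]
      omega
    · intro v hv
      simp only [Finset.mem_filter, mem_cyclicArcs] at hv
      rw [indepPoly_insideShort (by omega) (by omega) (by omega) (by omega)
        (fun _ _ _ _ => Iff.rfl)]
      congr 2
      omega

/-! ### Tagged arcs -/

/-- Compatibility of tagged arcs: distinct radii are compatible if they have equal tags or equal
endpoints, and all other pairs are compatible if they do not cross. -/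
def TaggedCompat (N : ℕ) (u w : (ℤ × ℤ) × Bool) : Prop :=
  CyclicNoncrossing N u.1 w.1 ∨ (u.1.2 = u.1.1 + N ∧ w.1.2 = w.1.1 + N ∧ u.2 = w.2)

/-- The tagged arcs of a punctured polygon with `N` vertices: the short arcs, with the tag `false`,
and two radii, of length `N`, at each vertex. -/
noncomputable def taggedArcs (L : ℤ) (N : ℕ) : Finset ((ℤ × ℤ) × Bool) :=
  {u ∈ cyclicArcs L N ×ˢ Finset.univ | u.1.2 < u.1.1 + N → u.2 = false}

theorem mem_taggedArcs {L : ℤ} {N : ℕ} {u : (ℤ × ℤ) × Bool} :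
    u ∈ taggedArcs L N ↔ L ≤ u.1.1 ∧ u.1.1 < L + N ∧ u.1.1 + 2 ≤ u.1.2 ∧ u.1.2 ≤ u.1.1 + N ∧
      (u.1.2 < u.1.1 + N → u.2 = false) := by
  simp only [taggedArcs, Finset.mem_filter, Finset.mem_product, mem_cyclicArcs, Finset.mem_univ,
    and_true, and_assoc]

theorem TaggedCompat.symm {N : ℕ} {u w : (ℤ × ℤ) × Bool} (h : TaggedCompat N u w) :
    TaggedCompat N w u :=
  h.imp (·.symm) fun h => ⟨h.2.1, h.1, h.2.2.symm⟩

theorem TaggedCompat.refl {L : ℤ} {N : ℕ} {u : (ℤ × ℤ) × Bool} (h : u ∈ taggedArcs L N) :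
    TaggedCompat N u u := by
  refine Or.inl (.refl (L := L) ?_)
  rw [mem_taggedArcs] at h
  rw [mem_cyclicArcs]
  omega

/-- The subcomplex of the tagged arcs without the radii of tag `!s`. -/
theorem indepPoly_oneTag {L : ℤ} {N : ℕ} (s : Bool) :
    indepPoly (TaggedCompat N) {u ∈ taggedArcs L N | u.1.2 < u.1.1 + N ∨ u.2 = s} =
      indepPoly (RadialCompat N) (cyclicArcs L N) := by
  refine indepPoly_bij (fun u => (u, if u.2 < u.1 + N then false else s)) ?_ ?_ ?_ ?_
  · rintro ⟨a, b⟩ h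
    simp only [mem_cyclicArcs, Finset.mem_filter, mem_taggedArcs] at h ⊢
    split_ifs with h1
    · simp only [implies_true, and_true]; omega
    · simp only [or_true, and_true, h1, false_implies]; omega
  · intro u _ w _ h
    exact (Prod.mk.inj h).1
  · rintro ⟨⟨a, b⟩, s'⟩ h
    simp only [Finset.mem_filter, mem_taggedArcs] at h
    refine ⟨(a, b), ?_, ?_⟩
    · rw [mem_cyclicArcs]; dsimp only; omega
    · dsimp only
      split_ifs with h1
      · rw [h.1.2.2.2.2 h1]
      · rw [h.2.resolve_left h1]
  · intro u hu w hw
    simp only [TaggedCompat, RadialCompat]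
    constructor
    · rintro (h | h)
      · exact Or.inl h
      · exact Or.inr ⟨h.1, h.2.1⟩
    · rintro (h | h)
      · exact Or.inl h
      · refine Or.inr ⟨h.1, h.2, ?_⟩
        rw [if_neg (by omega), if_neg (by omega)]

theorem indepPoly_noTag {L : ℤ} {N : ℕ} :
    indepPoly (TaggedCompat N) {u ∈ taggedArcs L N | u.1.2 < u.1.1 + N} =
      indepPoly (RadialCompat N) (shortArcs L N) := by
  refine indepPoly_bij (fun u => (u, false)) ?_ ?_ ?_ ?_
  · rintro ⟨a, b⟩ h
    simp only [mem_shortArcs, Finset.mem_filter, mem_taggedArcs, implies_true, and_true] at h ⊢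
    omega
  · intro u _ w _ h
    exact (Prod.mk.inj h).1
  · rintro ⟨⟨a, b⟩, s'⟩ h
    simp only [Finset.mem_filter, mem_taggedArcs] at h
    refine ⟨(a, b), ?_, ?_⟩
    · rw [mem_shortArcs]; dsimp only; omega
    · rw [h.1.2.2.2.2 h.2]
  · intro u hu w hw
    rw [mem_shortArcs] at hu
    rw [radialCompat_iff_of_short (Or.inl hu.2.2.2)]
    simp only [TaggedCompat]
    constructor
    · rintro (h | h)
      · exact h
      · omega
    · exact Or.inl

theorem cyclicNoncrossing_radii {L : ℤ} {N : ℕ} {u w : ℤ × ℤ} (hu : u ∈ cyclicArcs L N)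
    (hw : w ∈ cyclicArcs L N) (hu' : u.2 = u.1 + N) (hw' : w.2 = w.1 + N) :
    CyclicNoncrossing N u w ↔ u = w := by
  rw [mem_cyclicArcs] at hu hw
  rw [Prod.ext_iff]
  simp only [CyclicNoncrossing, Noncrossing]
  omega

/-- A face of the complex of tagged arcs contains no radii of tag `true`, or no radii of tag
`false`, or exactly two radii, which then have equal endpoints. -/
theorem indepPoly_taggedArcs {L : ℤ} {N : ℕ} (hN : 2 ≤ N) :
    indepPoly (TaggedCompat N) (taggedArcs L N) =
      2 * indepPoly (RadialCompat N) (cyclicArcs L N) -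
      indepPoly (RadialCompat N) (shortArcs L N) + (N : ℝ[X]) * (X ^ 2 * dissPoly N) := by
  classical
  have key : ∀ v ∈ taggedArcs L N, v.2 = true → v.1.2 = v.1.1 + N := by
    intro v hv h
    rw [mem_taggedArcs] at hv
    by_contra h1
    have := hv.2.2.2.2 (by omega)
    simp [h] at this
  have cyc : ∀ v ∈ taggedArcs L N, v.1 ∈ cyclicArcs L N := by
    intro v hv
    rw [mem_taggedArcs] at hv
    rw [mem_cyclicArcs]
    omega
  have hne : ∀ u ∈ taggedArcs L N, ∀ w ∈ taggedArcs L N, u.2 = true → w.2 = true →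
      u.1.1 = w.1.1 → u = w := by
    intro u hu w hw hu' hw' h
    have h1 := key u hu hu'
    have h2 := key w hw hw'
    exact Prod.ext (Prod.ext h (by omega)) (by rw [hu', hw'])
  -- the faces that contain radii of tag `true` only, the last of which is `v`
  set K : (ℤ × ℤ) × Bool → Finset ((ℤ × ℤ) × Bool) := fun v =>
    {w ∈ taggedArcs L N | w ≠ v ∧ (w.1.2 < w.1.1 + N ∨ w.2 = true) ∧ TaggedCompat N v w ∧
      (w.2 = true → (w.1.1 - L).toNat < (v.1.1 - L).toNat)} with hK
  set V : Finset ((ℤ × ℤ) × Bool) := {v ∈ taggedArcs L N | v.2 = true} with hV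
  have hVmem : ∀ v, v ∈ V ↔ v ∈ taggedArcs L N ∧ v.2 = true := fun v => by simp [hV]
  have h1 : indepPoly (TaggedCompat N) {u ∈ taggedArcs L N | u.1.2 < u.1.1 + N ∨ u.2 = true} =
      indepPoly (TaggedCompat N) {u ∈ taggedArcs L N | u.1.2 < u.1.1 + N} +
        ∑ v ∈ V, X * indepPoly (TaggedCompat N) (K v) := by
    refine indepPoly_rank (fun v => (v.1.1 - L).toNat)
      (fun u hu => .refl (Finset.mem_filter.1 hu).1)
      (fun u _ w _ h => h.symm) ?_ ?_ ?_ ?_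
    · intro v hv
      rw [hVmem] at hv
      exact Finset.mem_filter.2 ⟨hv.1, Or.inr hv.2⟩
    · intro u hu w hw h2 h3
      rw [hVmem] at hu hw
      have h4 := mem_taggedArcs.1 hu.1
      have h5 := mem_taggedArcs.1 hw.1
      exact absurd (hne u hu.1 w hw.1 hu.2 hw.2 (by omega)) h2
    · intro w
      rw [hVmem]
      simp only [Finset.mem_filter]
      constructor
      · rintro ⟨h2, h3⟩
        refine ⟨⟨h2, Or.inl h3⟩, fun h4 => ?_⟩
        have := key w h2 h4.2
        omega
      · rintro ⟨⟨h2, h3⟩, h4⟩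
        exact ⟨h2, h3.resolve_right fun h5 => h4 ⟨h2, h5⟩⟩
    · intro v hv w
      rw [hVmem]
      simp only [hK, Finset.mem_filter]
      tauto
  have h2 : indepPoly (TaggedCompat N) (taggedArcs L N) =
      indepPoly (TaggedCompat N) {u ∈ taggedArcs L N | u.1.2 < u.1.1 + N ∨ u.2 = false} +
        ∑ v ∈ V, X * indepPoly (TaggedCompat N) (insert (v.1, false) (K v)) := by
    refine indepPoly_rank (fun v => (v.1.1 - L).toNat) (fun u hu => .refl hu)
      (fun u _ w _ h => h.symm) (Finset.filter_subset _ _) ?_ ?_ ?_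
    · intro u hu w hw h2 h3
      rw [hVmem] at hu hw
      have h4 := mem_taggedArcs.1 hu.1
      have h5 := mem_taggedArcs.1 hw.1
      exact absurd (hne u hu.1 w hw.1 hu.2 hw.2 (by omega)) h2
    · intro w
      rw [hVmem]
      simp only [Finset.mem_filter]
      constructor
      · rintro ⟨h2, h3⟩
        refine ⟨h2, fun h4 => ?_⟩
        have := key w h2 h4.2
        rcases h3 with h3 | h3
        · omega
        · simp [h4.2] at h3
      · rintro ⟨h2, h4⟩
        exact ⟨h2, Or.inr (by simpa using fun h5 => h4 ⟨h2, h5⟩)⟩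
    · intro v hv w
      rw [hVmem] at hv ⊢
      have h3 := key v hv.1 hv.2
      have h4 := mem_taggedArcs.1 hv.1
      simp only [hK, Finset.mem_filter, Finset.mem_insert]
      constructor
      · rintro (rfl | h)
        · refine ⟨?_, ?_, ?_, ?_⟩
          · rw [mem_taggedArcs]; simp only [implies_true, and_true]; omega
          · intro h5
            have := congrArg Prod.snd h5
            simp [hv.2] at this
          · exact Or.inl (.refl (cyc v hv.1))
          · simp
        · exact ⟨h.1, h.2.1, h.2.2.2.1, fun h5 => h.2.2.2.2 h5.2⟩
      · rintro ⟨h5, h6, h7, h8⟩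
        by_cases h9 : w.1.2 < w.1.1 + N ∨ w.2 = true
        · exact Or.inr ⟨h5, h6, h9, h7, fun h10 => h8 ⟨h5, h10⟩⟩
        · left
          simp only [not_or, Bool.not_eq_true] at h9
          rcases h7 with h7 | h7
          · rw [cyclicNoncrossing_radii (cyc v hv.1) (cyc w h5) h3
              (by have := mem_taggedArcs.1 h5; omega)] at h7
            exact Prod.ext h7.symm h9.2
          · simp [hv.2, h9.2] at h7
  have h3 : ∀ v ∈ V, indepPoly (TaggedCompat N) (insert (v.1, false) (K v)) =
      indepPoly (TaggedCompat N) (K v) + X * dissPoly N := by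
    intro v hv
    rw [hVmem] at hv
    have h3 := key v hv.1 hv.2
    have h4 := mem_taggedArcs.1 hv.1
    have h5 : (v.1, false) ∉ K v := by
      simp only [hK, Finset.mem_filter]
      rintro ⟨-, -, h, -⟩
      simp at h
      omega
    have h6 : insert (v.1, false) (K v) ⊆ taggedArcs L N := by
      intro w hw
      rcases Finset.mem_insert.1 hw with rfl | hw
      · rw [mem_taggedArcs]; simp only [implies_true, and_true]; omega
      · exact (Finset.mem_filter.1 hw).1
    have h7 : (v.1, false) ∈ taggedArcs L N := h6 (Finset.mem_insert_self _ _)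
    rw [indepPoly_rank (V := {(v.1, false)}) (U' := K v) (L := fun _ =>
      {w ∈ taggedArcs L N | w.1.2 < w.1.1 + N ∧ TaggedCompat N (v.1, false) w}) (fun _ => 0)
      (fun u hu => .refl (h6 hu)) (fun u _ w _ h => h.symm) (by simp)]
    · rw [Finset.sum_singleton]
      congr 2
      rw [indepPoly_inside (a := v.1.1) (b := v.1.2) Prod.fst (L := L) (N := N) h4.1 h4.2.1 h4.2.2.1
        h4.2.2.2.1]
      · congr 1; omega
      · rintro w hw w' hw' h
        simp only [Finset.coe_filter, Set.mem_ofPred_eq, mem_taggedArcs] at hw hw'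
        exact Prod.ext h (by rw [hw.1.2.2.2.2 hw.2.1, hw'.1.2.2.2.2 hw'.2.1])
      · rintro ⟨⟨a, b⟩, s⟩ hw
        obtain ⟨⟨a', b'⟩, s'⟩ := v
        rw [Finset.mem_filter] at hw
        simp only [mem_taggedArcs, TaggedCompat, CyclicNoncrossing, Noncrossing] at hw h3 h4
        simp only [mem_cyclicArcs, ne_eq, Prod.mk.injEq]
        omega
      · rintro ⟨a, b⟩ hw
        obtain ⟨⟨a', b'⟩, s'⟩ := v
        refine ⟨((a, b), false), Finset.mem_filter.2 ?_, rfl⟩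
        simp only [mem_taggedArcs, TaggedCompat, CyclicNoncrossing,
          Noncrossing, mem_cyclicArcs, ne_eq, Prod.mk.injEq] at hw h3 h4 ⊢
        simp only [implies_true, and_true]
        omega
      · intro w hw w' hw'
        simp only [Finset.mem_filter] at hw
        simp only [TaggedCompat]
        constructor
        · rintro (h | h)
          · exact h
          · omega
        · exact Or.inl
    · intro u hu w hw h
      rw [Finset.mem_singleton] at hu hw
      exact absurd (hu.trans hw.symm) h
    · intro w
      rw [Finset.mem_insert, Finset.mem_singleton]
      constructor
      · intro h
        exact ⟨Or.inr h, fun h8 => h5 (h8 ▸ h)⟩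
      · rintro ⟨h8, h9⟩
        exact h8.resolve_left h9
    · intro u hu w
      rw [Finset.mem_singleton] at hu
      subst hu
      rw [Finset.mem_insert, Finset.mem_singleton]
      simp only [hK, Finset.mem_filter]
      have h10 : TaggedCompat N v w ∧ w.1.2 < w.1.1 + N ↔
          TaggedCompat N (v.1, false) w ∧ w.1.2 < w.1.1 + N := by
        simp only [TaggedCompat]
        constructor
        · rintro ⟨h | h, h'⟩
          · exact ⟨Or.inl h, h'⟩
          · omega
        · rintro ⟨h | h, h'⟩
          · exact ⟨Or.inl h, h'⟩
          · omega
      constructor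
      · rintro ⟨h8, h9, h11⟩
        have h12 : w.2 = false := (mem_taggedArcs.1 h8).2.2.2.2 h9
        have h13 : w ≠ (v.1, false) := by rintro rfl; dsimp only at h9; omega
        have h14 : w ≠ v := by rintro rfl; omega
        refine ⟨Or.inr ⟨h8, h14, Or.inl h9, (h10.2 ⟨h11, h9⟩).1, by simp [h12]⟩, h13, h11, ?_⟩
        exact fun h => absurd h h13
      · rintro ⟨h8, h9, h11, h12⟩
        obtain ⟨h8, h13, h14, h15, h16⟩ := h8.resolve_left h9
        refine ⟨h8, ?_, h11⟩
        rcases h14 with h14 | h14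
        · exact h14
        · have h17 := key w h8 h14
          have h18 := h16 h14
          rcases h11 with h11 | h11
          · rw [cyclicNoncrossing_radii (cyc v hv.1) (cyc w h8) h3 h17] at h11
            rw [h11] at h18
            omega
          · simp [h14] at h11
  have hcard : V.card = N := by
    have e : V = (Finset.Ico L (L + N)).image fun a => ((a, a + (N : ℤ)), true) := by
      ext ⟨⟨a, b⟩, s⟩
      rw [hVmem, mem_taggedArcs]
      simp only [Finset.mem_image, Finset.mem_Ico, Prod.mk.injEq]
      constructor
      · rintro ⟨h4, rfl⟩
        exact ⟨a, by omega, ⟨rfl, by simp at h4; omega⟩, rfl⟩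
      · rintro ⟨a', h4, ⟨rfl, rfl⟩, rfl⟩
        simp only [and_true]
        simp
        omega
    rw [e, Finset.card_image_of_injective _ fun a b h => (Prod.mk.inj (Prod.mk.inj h).1).1,
      Int.card_Ico]
    omega
  rw [h2, Finset.sum_congr rfl fun v hv => by rw [h3 v hv, mul_add], Finset.sum_add_distrib,
    Finset.sum_const, hcard, nsmul_eq_mul, indepPoly_oneTag]
  rw [indepPoly_oneTag, indepPoly_noTag] at h1
  linear_combination -h1

end Cyclic

/-! ### Three-term recurrences -/

section Series

open PowerSeries (mk derivative)

/-- The generating function of the sides. -/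
noncomputable def sideSeries (y : ℝ) : PowerSeries ℝ := mk fun n => (sidePoly n).eval y

/-- The generating function of the dissections with an optional base edge. -/
noncomputable def basedSeries (y : ℝ) : PowerSeries ℝ := mk fun n => (basedPoly n).eval y

/-- The value at `y` of the generating polynomial of the centrally symmetric dissections of the
polygon with `2l + 2` vertices. -/
noncomputable def symValue (y : ℝ) (l : ℕ) : ℝ :=
  ∑ k ∈ Finset.Icc 1 (l + 1), k * ((sidePoly k).eval y * (basedPoly (l + 1 - k)).eval y)

theorem sidePoly_zero : sidePoly 0 = 0 := if_pos rfl

theorem two_mul_C (a : ℝ) : (2 * PowerSeries.C a : PowerSeries ℝ) = PowerSeries.C (2 * a) := by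
  rw [map_mul, map_ofNat]

theorem two_mul_C_ne_zero {a : ℝ} (ha : a ≠ 0) : (2 * PowerSeries.C a : PowerSeries ℝ) ≠ 0 := by
  intro h
  rw [two_mul_C] at h
  have := congrArg (PowerSeries.coeff 0) h
  simp [ha] at this

theorem derivative_C_mul (a : ℝ) (F : PowerSeries ℝ) :
    derivative ℝ (PowerSeries.C a * F) = PowerSeries.C a * derivative ℝ F := by
  rw [← PowerSeries.smul_eq_C_mul, Derivation.map_smul, PowerSeries.smul_eq_C_mul]

theorem basedSeries_eq (y : ℝ) : basedSeries y = 1 + sideSeries y * basedSeries y := by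
  ext n
  rw [map_add, PowerSeries.coeff_mul, basedSeries, sideSeries]
  simp only [PowerSeries.coeff_mk, PowerSeries.coeff_one]
  rw [Finset.Nat.sum_antidiagonal_eq_sum_range_succ
    (fun i j => (sidePoly i).eval y * (basedPoly j).eval y)]
  rcases Nat.eq_zero_or_pos n with rfl | hn
  · simp [basedPoly_zero, sidePoly]
  · rw [if_neg hn.ne', basedPoly_rec hn, eval_finsetSum, Finset.sum_range_succ',
      Finset.range_eq_Ico, Finset.sum_Ico_add' (fun k => (sidePoly k).eval y *
        (basedPoly (n - k)).eval y) 0 n 1]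
    simp [sidePoly_zero, Finset.Ico_add_one_right_eq_Icc]

theorem sideSeries_sub_X (y : ℝ) :
    PowerSeries.C (1 + y) * (sideSeries y - PowerSeries.X) =
      PowerSeries.C y * (basedSeries y - 1 - PowerSeries.X) := by
  ext n
  rw [PowerSeries.coeff_C_mul, PowerSeries.coeff_C_mul]
  simp only [map_sub, sideSeries, basedSeries, PowerSeries.coeff_mk, PowerSeries.coeff_one,
    PowerSeries.coeff_X]
  rcases (by omega : n = 0 ∨ n = 1 ∨ 2 ≤ n) with rfl | rfl | h
  · simp [basedPoly_zero, sidePoly]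
  · simp [basedPoly_one, sidePoly]
  · rw [if_neg (by omega), if_neg (by omega), sidePoly, if_neg (by omega), if_neg (by omega),
      basedPoly_eq h]
    simp
    ring

/-- The generating function of the sides satisfies a quadratic equation. -/
theorem sideSeries_quadratic (y : ℝ) :
    (1 + PowerSeries.X) * sideSeries y - PowerSeries.X =
      PowerSeries.C (1 + y) * sideSeries y ^ 2 := by
  have h1 := basedSeries_eq y
  have h2 := sideSeries_sub_X y
  rw [map_add, map_one] at h2 ⊢
  linear_combination (1 - sideSeries y) * h2 + PowerSeries.C y * h1

/-- The square root of `1 - 2 (1 + 2y) x + x ^ 2` as a power series in `x`. -/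
noncomputable def rootSeries (y : ℝ) : PowerSeries ℝ :=
  1 + PowerSeries.X - 2 * PowerSeries.C (1 + y) * sideSeries y

theorem rootSeries_sq (y : ℝ) :
    rootSeries y ^ 2 = 1 - 2 * PowerSeries.C (1 + 2 * y) * PowerSeries.X + PowerSeries.X ^ 2 := by
  have h := sideSeries_quadratic y
  have e1 : PowerSeries.C (1 + 2 * y) = 1 + 2 * PowerSeries.C y := by
    rw [map_add, map_mul, map_one, map_ofNat]
  rw [rootSeries, e1]
  rw [map_add, map_one] at h ⊢
  linear_combination -4 * (1 + PowerSeries.C y) * h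

theorem rootSeries_mul_derivative (y : ℝ) :
    rootSeries y * derivative ℝ (rootSeries y) =
      PowerSeries.X - PowerSeries.C (1 + 2 * y) := by
  have h := congrArg (derivative ℝ) (rootSeries_sq y)
  rw [pow_two, Derivation.leibniz, map_add, map_sub, two_mul_C, derivative_C_mul, pow_two,
    Derivation.leibniz, Derivation.map_one_eq_zero, PowerSeries.derivative_X, ← two_mul_C,
    smul_eq_mul, smul_eq_mul] at h
  have h3 := two_mul_C_ne_zero (one_ne_zero : (1 : ℝ) ≠ 0)
  apply mul_left_cancel₀ h3
  rw [map_one]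
  linear_combination h

/-- The generating function of the centrally symmetric dissections is the inverse of
`rootSeries`. -/
noncomputable def symSeries (y : ℝ) : PowerSeries ℝ :=
  derivative ℝ (sideSeries y) * basedSeries y

theorem coeff_symSeries (y : ℝ) (l : ℕ) : PowerSeries.coeff l (symSeries y) = symValue y l := by
  rw [symSeries, PowerSeries.coeff_mul, symValue]
  simp only [PowerSeries.coeff_derivative, sideSeries, basedSeries, PowerSeries.coeff_mk]
  rw [Finset.Nat.sum_antidiagonal_eq_sum_range_succ
    (fun i j => (sidePoly (i + 1)).eval y * (i + 1) * (basedPoly j).eval y),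
    Finset.range_eq_Ico, ← Finset.Ico_add_one_right_eq_Icc,
    ← Finset.sum_Ico_add' (fun k : ℕ => (k : ℝ) * ((sidePoly k).eval y *
        (basedPoly (l + 1 - k)).eval y)) 0 (l + 1) 1]
  refine Finset.sum_congr rfl fun k hk => ?_
  rw [Nat.add_sub_add_right]
  push_cast
  ring

theorem derivative_rootSeries (y : ℝ) :
    derivative ℝ (rootSeries y) = 1 - 2 * PowerSeries.C (1 + y) * derivative ℝ (sideSeries y) := by
  rw [rootSeries, map_sub, map_add, two_mul_C, derivative_C_mul, Derivation.map_one_eq_zero,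
    PowerSeries.derivative_X, zero_add]

theorem rootSeries_mul_symSeries {y : ℝ} (hy : 1 + y ≠ 0) :
    rootSeries y * symSeries y = 1 := by
  have h1 := rootSeries_mul_derivative y
  rw [derivative_rootSeries] at h1
  have h3 : rootSeries y * derivative ℝ (sideSeries y) = 1 - sideSeries y := by
    apply mul_left_cancel₀ (two_mul_C_ne_zero hy)
    have h4 : rootSeries y = 1 + PowerSeries.X - 2 * PowerSeries.C (1 + y) * sideSeries y := rfl
    have e1 : PowerSeries.C (1 + 2 * y) = 2 * PowerSeries.C (1 + y) - 1 := by
      rw [two_mul_C, ← map_one (PowerSeries.C (R := ℝ)), ← map_sub]; congr 1; ring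
    rw [e1] at h1
    linear_combination h4 - h1
  have h5 := basedSeries_eq y
  rw [symSeries]
  linear_combination basedSeries y * h3 + h5

theorem derivative_rootSeries_eq {y : ℝ} (hy : 1 + y ≠ 0) :
    derivative ℝ (rootSeries y) = (PowerSeries.X - PowerSeries.C (1 + 2 * y)) * symSeries y := by
  linear_combination symSeries y * rootSeries_mul_derivative y -
    derivative ℝ (rootSeries y) * rootSeries_mul_symSeries hy

theorem derivative_symSeries {y : ℝ} (hy : 1 + y ≠ 0) :
    (1 - 2 * PowerSeries.C (1 + 2 * y) * PowerSeries.X + PowerSeries.X ^ 2) *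
      derivative ℝ (symSeries y) = (PowerSeries.C (1 + 2 * y) - PowerSeries.X) * symSeries y := by
  have h1 := congrArg (derivative ℝ) (rootSeries_mul_symSeries hy)
  rw [Derivation.leibniz, Derivation.map_one_eq_zero, smul_eq_mul, smul_eq_mul] at h1
  have h2 := rootSeries_mul_symSeries hy
  have h3 := rootSeries_sq y
  have h4 := derivative_rootSeries_eq hy
  rw [← h3]
  linear_combination rootSeries y * h1 - derivative ℝ (rootSeries y) * h2 - h4

theorem coeff_quadratic_mul (a : ℝ) (F : PowerSeries ℝ) (n : ℕ) :
    PowerSeries.coeff (n + 1) ((1 - 2 * PowerSeries.C a * PowerSeries.X + PowerSeries.X ^ 2) *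
      derivative ℝ F) = (n + 2) * PowerSeries.coeff (n + 2) F -
        2 * a * (n + 1) * PowerSeries.coeff (n + 1) F + n * PowerSeries.coeff n F := by
  have e : (1 - 2 * PowerSeries.C a * PowerSeries.X + PowerSeries.X ^ 2) * derivative ℝ F =
      derivative ℝ F - PowerSeries.C (2 * a) * (PowerSeries.X * derivative ℝ F) +
        PowerSeries.X * (PowerSeries.X * derivative ℝ F) := by
    rw [map_mul, map_ofNat]; ring
  rw [e, map_add, map_sub, PowerSeries.coeff_C_mul, PowerSeries.coeff_succ_X_mul,
    PowerSeries.coeff_succ_X_mul, PowerSeries.coeff_derivative, PowerSeries.coeff_derivative]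
  cases n with
  | zero => simp; ring
  | succ m =>
    rw [PowerSeries.coeff_succ_X_mul, PowerSeries.coeff_derivative]
    push_cast
    ring

theorem coeff_linear_mul (a : ℝ) (F : PowerSeries ℝ) (n : ℕ) :
    PowerSeries.coeff (n + 1) ((PowerSeries.X - PowerSeries.C a) * F) =
      PowerSeries.coeff n F - a * PowerSeries.coeff (n + 1) F := by
  rw [sub_mul, map_sub, PowerSeries.coeff_C_mul, PowerSeries.coeff_succ_X_mul]

/-- The recurrence of the Legendre polynomials in the variable `1 + 2y`. -/
theorem symValue_rec {y : ℝ} (hy : 1 + y ≠ 0) (n : ℕ) :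
    (n + 2) * symValue y (n + 2) =
      (2 * n + 3) * (1 + 2 * y) * symValue y (n + 1) - (n + 1) * symValue y n := by
  have h := congrArg (PowerSeries.coeff (n + 1)) (derivative_symSeries hy)
  rw [← neg_sub PowerSeries.X, neg_mul, map_neg, coeff_quadratic_mul, coeff_linear_mul,
    coeff_symSeries, coeff_symSeries, coeff_symSeries] at h
  linear_combination h

theorem coeff_rootSeries (y : ℝ) (n : ℕ) :
    PowerSeries.coeff (n + 2) (rootSeries y) = -2 * (1 + y) * y * (dissPoly (n + 2)).eval y := by
  rw [rootSeries, map_sub, map_add, two_mul_C, PowerSeries.coeff_C_mul, sideSeries,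
    PowerSeries.coeff_mk, PowerSeries.coeff_one, PowerSeries.coeff_X, sidePoly]
  simp
  ring

/-- The recurrence of the Jacobi polynomials with both parameters equal to `1`. -/
theorem dissPoly_three_term {y : ℝ} (hy : 1 + y ≠ 0) (hy' : y ≠ 0) (n : ℕ) :
    (n + 4) * (dissPoly (n + 4)).eval y =
      (2 * n + 5) * (1 + 2 * y) * (dissPoly (n + 3)).eval y -
        (n + 1) * (dissPoly (n + 2)).eval y := by
  have h0 : (1 - 2 * PowerSeries.C (1 + 2 * y) * PowerSeries.X + PowerSeries.X ^ 2) *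
      derivative ℝ (rootSeries y) = (PowerSeries.X - PowerSeries.C (1 + 2 * y)) * rootSeries y := by
    rw [← rootSeries_sq]
    linear_combination rootSeries y * rootSeries_mul_derivative y
  have h := congrArg (PowerSeries.coeff (n + 3)) h0
  rw [coeff_quadratic_mul, coeff_linear_mul, coeff_rootSeries, coeff_rootSeries,
    coeff_rootSeries] at h
  have h2 : -2 * (1 + y) * y ≠ 0 := mul_ne_zero (mul_ne_zero (by norm_num) hy) hy'
  apply mul_left_cancel₀ h2
  push_cast at h
  linear_combination h

theorem sidePoly_eval {y : ℝ} (hy : 1 + y ≠ 0) (n : ℕ) :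
    2 * (1 + y) * ((n + 2) * (sidePoly (n + 2)).eval y) =
      (1 + 2 * y) * symValue y (n + 1) - symValue y n := by
  have h := congrArg (PowerSeries.coeff (n + 1)) (derivative_rootSeries_eq hy)
  rw [derivative_rootSeries, map_sub, two_mul_C, PowerSeries.coeff_C_mul, coeff_linear_mul,
    PowerSeries.coeff_derivative, sideSeries, PowerSeries.coeff_mk, coeff_symSeries,
    coeff_symSeries, PowerSeries.coeff_one, if_neg (by omega)] at h
  push_cast at h
  linear_combination -h

/-- The value of the counting polynomial of the tagged arcs in terms of Legendre polynomials. -/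
theorem taggedArcs_eval {y : ℝ} (hy : 1 + y ≠ 0) (L : ℤ) (n : ℕ) :
    2 * (n + 1) * (indepPoly (TaggedCompat (n + 2)) (taggedArcs L (n + 2))).eval y =
      n * symValue y (n + 2) + (n + 2) * (1 + 2 * y) * symValue y (n + 1) := by
  rw [indepPoly_taggedArcs (by omega), indepPoly_cyclicArcs_radial (by omega),
    indepPoly_shortArcs (by omega)]
  simp only [eval_add, eval_sub, eval_mul, eval_finsetSum, eval_natCast, eval_X, eval_one,
    eval_pow, eval_ofNat]
  have e1 : symValue y (n + 2) = ∑ k ∈ Finset.Ico 1 (n + 2),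
      (k * ((sidePoly k).eval y * (basedPoly (n + 2 - k + 1)).eval y) : ℝ) +
      (n + 2) * (sidePoly (n + 2)).eval y + (n + 3) * (sidePoly (n + 3)).eval y := by
    rw [symValue, ← Finset.Ico_add_one_right_eq_Icc, Finset.sum_Ico_succ_top (by omega),
      Finset.sum_Ico_succ_top (by omega), Nat.sub_self, basedPoly_zero, Nat.add_sub_cancel_left,
      basedPoly_one]
    simp only [eval_one, mul_one]
    push_cast
    rw [Finset.sum_congr rfl fun k hk => by
      rw [show n + 2 + 1 - k = n + 2 - k + 1 by have := Finset.mem_Ico.1 hk; omega]]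
    ring
  have e2 : symValue y (n + 1) = ∑ k ∈ Finset.Ico 1 (n + 2),
      (k * ((sidePoly k).eval y * (basedPoly (n + 2 - k)).eval y) : ℝ) +
      (n + 2) * (sidePoly (n + 2)).eval y := by
    rw [symValue, ← Finset.Ico_add_one_right_eq_Icc, Finset.sum_Ico_succ_top (by omega),
      Nat.sub_self, basedPoly_zero]
    simp only [eval_one, mul_one]
    push_cast
    ring
  have e3 : (sidePoly (n + 2)).eval y = y * (dissPoly (n + 2)).eval y := by
    rw [sidePoly, if_neg (by omega), if_neg (by omega), eval_mul, eval_X]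
  have e4 : ∑ k ∈ Finset.Ico 1 (n + 2),
      (k * ((sidePoly k).eval y * ((1 + y) * (basedPoly (n + 2 - k + 1)).eval y)) : ℝ) =
      (1 + y) * ∑ k ∈ Finset.Ico 1 (n + 2),
      (k * ((sidePoly k).eval y * (basedPoly (n + 2 - k + 1)).eval y) : ℝ) := by
    rw [Finset.mul_sum]
    exact Finset.sum_congr rfl fun k _ => by ring
  have h1 := sidePoly_eval hy n
  have h2 := sidePoly_eval hy (n + 1)
  have h3 := symValue_rec hy n
  rw [e4]
  generalize ∑ k ∈ Finset.Ico 1 (n + 2),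
      (k * ((sidePoly k).eval y * (basedPoly (n + 2 - k + 1)).eval y) : ℝ) = S1 at *
  generalize ∑ k ∈ Finset.Ico 1 (n + 2),
      (k * ((sidePoly k).eval y * (basedPoly (n + 2 - k)).eval y) : ℝ) = S2 at *
  push_cast at *
  have e5 : (n : ℝ) + 1 + 2 = n + 3 := by ring
  rw [e5, show n + 1 + 2 = n + 3 by ring, show n + 1 + 1 = n + 2 by ring] at h2
  linear_combination (-4 * (1 + y) * (n + 1)) * e1 + (2 * (n + 1)) * e2 - (n + 1) * h1 -
    2 * (n + 1) * h2 - 2 * (n + 1) * (n + 2) * y * e3 + h3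

end Series

/-! ### Smallest roots -/

section Roots

/-- A polynomial that is positive on `(-∞, 0]` and not positive at `s` has a smallest root, and is
positive to the left of it. -/
theorem exists_least_root {p : ℝ[X]} (hp : ∀ t ≤ 0, 0 < p.eval t) {s : ℝ} (hs : p.eval s ≤ 0) :
    ∃ r, 0 < r ∧ r ≤ s ∧ IsLeast {t : ℝ | p.IsRoot t} r ∧ ∀ t < r, 0 < p.eval t := by
  have hs0 : 0 ≤ s := by
    by_contra h
    exact absurd (hp s (not_le.1 h).le) (not_lt.2 hs)
  have hp0 : p ≠ 0 := by
    rintro rfl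
    simpa using hp 0 le_rfl
  have ivt : ∀ s : ℝ, p.eval s ≤ 0 → ∃ t ≤ s, p.IsRoot t := by
    intro s hs
    have h0 : 0 ≤ s := by
      by_contra h
      exact absurd (hp s (not_le.1 h).le) (not_lt.2 hs)
    obtain ⟨t, ht, ht'⟩ := intermediate_value_Icc' h0 (p.continuous.continuousOn (s := Set.Icc 0 s))
      ⟨hs, (hp 0 le_rfl).le⟩
    exact ⟨t, ht.2, ht'⟩
  obtain ⟨t₀, ht₀, hroot⟩ := ivt s hs
  obtain ⟨r, hr, hmin⟩ := p.roots.toFinset.exists_min_image id ⟨t₀, by simpa [hp0] using hroot⟩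
  simp only [Multiset.mem_toFinset, mem_roots hp0, id] at hr hmin
  refine ⟨r, ?_, (hmin t₀ hroot).trans ht₀, ⟨hr, fun t ht => hmin t ht⟩, fun t ht => ?_⟩
  · by_contra h
    have := hp r (not_lt.1 h)
    rw [hr] at this
    exact lt_irrefl _ this
  · by_contra h
    obtain ⟨t', h1, h2⟩ := ivt t (not_lt.1 h)
    exact absurd (hmin t' h2) (not_le.2 (h1.trans_lt ht))

/-- The smallest roots of a sequence of polynomials with a three-term recurrence, such as the
shifted Jacobi polynomials. The recurrence makes `p (l + 2)` negative at the smallest root of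
`p (l + 1)`. It also implies `p (l + 1) ≤ (1 - (l + 1) t) p l` to the left of the smallest root of
`p (l + 1)`, which bounds this root by `1 / (l + 1)`. -/
theorem least_roots_of_three_term {p : ℕ → ℝ[X]} {a c : ℕ → ℝ}
    (h0 : ∀ t, (p 0).eval t = 1) (h1 : ∀ t, (p 1).eval t = 1 - 2 * t)
    (hpos : ∀ l, ∀ t ≤ 0, 0 < (p l).eval t) (ha : ∀ l, 0 < a l) (hc : ∀ l, 0 < c l)
    (hrec : ∀ l t, 0 < t → t < 1 → a l * (p (l + 2)).eval t =
      (a l + c l) * (1 - 2 * t) * (p (l + 1)).eval t - c l * (p l).eval t)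
    (hac : ∀ l : ℕ, (l + 2) * a l ≤ (l + 1) * c l + 2 * (a l + c l)) :
    ∃ r : ℕ → ℝ, (∀ l, 1 ≤ l → IsLeast {t : ℝ | (p l).IsRoot t} (r l)) ∧
      StrictAntiOn r (Set.Ici 1) ∧ Tendsto r atTop (𝓝 0) ∧
      (∀ l, 1 ≤ l → 0 < r l ∧ r l ≤ 1 / 2) ∧ (∀ l, 1 ≤ l → ∀ t < r l, 0 < (p l).eval t) ∧
      (∀ l, 1 ≤ l → (p (l + 1)).eval (r l) < 0) := by
  have hneg : ∀ l r, 0 < r → r ≤ 1 / 2 → (p (l + 1)).IsRoot r → 0 < (p l).eval r →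
      (p (l + 2)).eval r < 0 := by
    intro l r hr hr' hroot hl
    have h := hrec l r hr (by linarith)
    rw [hroot.eq_zero, mul_zero, zero_sub] at h
    by_contra h2
    have := mul_nonneg (ha l).le (not_lt.1 h2)
    have := mul_pos (hc l) hl
    linarith
  have key : ∀ l, ∃ r, 0 < r ∧ r ≤ 1 / 2 ∧ IsLeast {t : ℝ | (p (l + 1)).IsRoot t} r ∧
      (∀ t < r, 0 < (p (l + 1)).eval t) ∧ ∀ t ≤ r, 0 < (p l).eval t := by
    intro l
    induction l with
    | zero =>
      obtain ⟨r, hr1, hr2, hr3, hr4⟩ := exists_least_root (hpos 1) (s := 1 / 2)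
        (by rw [h1]; norm_num)
      exact ⟨r, hr1, hr2, hr3, hr4, fun t _ => by rw [h0]; exact one_pos⟩
    | succ l ih =>
      obtain ⟨r, hr1, hr2, hr3, hr4, hr5⟩ := ih
      have h2 := hneg l r hr1 hr2 hr3.1 (hr5 r le_rfl)
      obtain ⟨r', hr1', hr2', hr3', hr4'⟩ := exists_least_root (hpos (l + 2)) h2.le
      have hlt : r' < r := by
        refine lt_of_le_of_ne hr2' ?_
        rintro rfl
        exact h2.ne hr3'.1
      exact ⟨r', hr1', hr2'.trans hr2, hr3', hr4', fun t ht => hr4 t (ht.trans_lt hlt)⟩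
  choose s hs0 hs1 hs2 hs3 hs4 using key
  have hanti : StrictAnti s := by
    refine strictAnti_nat_of_succ_lt fun l => ?_
    by_contra h
    have := hs4 (l + 1) (s l) (not_lt.1 h)
    rw [(hs2 l).1.eq_zero] at this
    exact lt_irrefl _ this
  have hbound : ∀ l, s l ≤ 1 / ((l : ℝ) + 1) := by
    intro l
    have aux : ∀ t, 0 < t → ∀ l, t < s l →
        (p (l + 1)).eval t ≤ (1 - t * (l + 1)) * (p l).eval t := by
      intro t ht l
      induction l with
      | zero =>
        intro _
        rw [h1, h0]
        push_cast
        linarith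
      | succ l ih =>
        intro htl
        have htl' : t < s l := htl.trans (hanti (Nat.lt_succ_self l))
        have e1 := ih htl'
        have e2 := hrec l t ht (by linarith [hs1 l])
        have e3 := hs3 l t htl'
        have e4 := hs4 l t htl'.le
        have e5 : (p (l + 1)).eval t ≤ (p l).eval t := by
          have : 0 ≤ t * ((l : ℝ) + 1) * (p l).eval t := by positivity
          linarith
        have e6 := mul_le_mul_of_nonneg_right (hac l) (mul_nonneg ht.le e3.le)
        have e7 := mul_le_mul_of_nonneg_left e1 (hc l).le
        have e8 : c l * t * (l + 1) * (p (l + 1)).eval t ≤ c l * t * (l + 1) * (p l).eval t :=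
          mul_le_mul_of_nonneg_left e5 (by have := hc l; positivity)
        have e9 : a l * (p (l + 2)).eval t ≤
            a l * ((1 - t * (((l + 1 : ℕ) : ℝ) + 1)) * (p (l + 1)).eval t) := by
          push_cast
          rw [e2]
          linarith
        exact le_of_mul_le_mul_left e9 (ha l)
    refine le_of_forall_lt fun t ht => ?_
    rcases le_or_gt t 0 with h | h
    · exact h.trans_lt (by positivity)
    · have e1 := aux t h l ht
      have e2 := hs3 l t ht
      have e3 := hs4 l t ht.le
      have e4 : 0 < 1 - t * ((l : ℝ) + 1) := by
        by_contra h5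
        have := mul_nonneg (neg_nonneg.2 (not_lt.1 h5)) e3.le
        linarith
      rw [lt_div_iff₀ (by positivity)]
      linarith
  have hlim : Tendsto s atTop (𝓝 0) :=
    squeeze_zero (fun l => (hs0 l).le) hbound tendsto_one_div_add_atTop_nhds_zero_nat
  refine ⟨fun l => s (l - 1), ?_, ?_, ?_, ?_, ?_, ?_⟩
  · intro l hl
    obtain ⟨m, rfl⟩ := Nat.exists_eq_add_of_le' hl
    exact hs2 m
  · intro l hl m hm hlm
    simp only [Set.mem_Ici] at hl hm
    exact hanti (by omega)
  · exact hlim.comp (tendsto_sub_atTop_nat 1)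
  · exact fun l _ => ⟨hs0 _, hs1 _⟩
  · intro l hl
    obtain ⟨m, rfl⟩ := Nat.exists_eq_add_of_le' hl
    exact hs3 m
  · intro l hl
    obtain ⟨m, rfl⟩ := Nat.exists_eq_add_of_le' hl
    exact hneg m _ (hs0 m) (hs1 m) (hs2 m).1 (hs4 m _ le_rfl)

/-- If `q l` is a combination with positive coefficients of `p l` and `(1 - 2t) p (l - 1)`, then the
smallest root of `q l` lies strictly between those of `p l` and `p (l - 1)`. -/
theorem least_roots_of_interlacing {p q : ℕ → ℝ[X]} {r : ℕ → ℝ} {l₀ : ℕ} (hl₀ : 2 ≤ l₀)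
    {a c : ℕ → ℝ} (ha : ∀ l, l₀ ≤ l → 0 < a l) (hc : ∀ l, l₀ ≤ l → 0 < c l)
    (hq : ∀ l, l₀ ≤ l → ∀ t, 0 < t → t < 1 →
      (q l).eval t = a l * (p l).eval t + c l * (1 - 2 * t) * (p (l - 1)).eval t)
    (hpos : ∀ l, l₀ ≤ l → ∀ t ≤ 0, 0 < (q l).eval t)
    (hr : ∀ l, 1 ≤ l → IsLeast {t : ℝ | (p l).IsRoot t} (r l))
    (hanti : StrictAntiOn r (Set.Ici 1)) (hlim : Tendsto r atTop (𝓝 0))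
    (hr0 : ∀ l, 1 ≤ l → 0 < r l ∧ r l ≤ 1 / 2)
    (hppos : ∀ l, 1 ≤ l → ∀ t < r l, 0 < (p l).eval t)
    (hneg : ∀ l, 1 ≤ l → (p (l + 1)).eval (r l) < 0) :
    ∃ s : ℕ → ℝ, (∀ l, l₀ ≤ l → IsLeast {t : ℝ | (q l).IsRoot t} (s l)) ∧
      StrictAntiOn s (Set.Ici l₀) ∧ Tendsto s atTop (𝓝 0) := by
  have key : ∀ l, ∃ s, l₀ ≤ l → IsLeast {t : ℝ | (q l).IsRoot t} s ∧ r l < s ∧ s < r (l - 1) := by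
    intro l
    by_cases hl : l₀ ≤ l
    swap
    · exact ⟨0, fun h => absurd h hl⟩
    have h1 : (q l).eval (r (l - 1)) < 0 := by
      have h2 := hneg (l - 1) (by omega)
      rw [Nat.sub_add_cancel (by omega)] at h2
      have h3 := hr0 (l - 1) (by omega)
      rw [hq l hl _ h3.1 (by linarith), (hr (l - 1) (by omega)).1.eq_zero, mul_zero, add_zero]
      exact mul_neg_of_pos_of_neg (ha l hl) h2
    obtain ⟨s, hs1, hs2, hs3, hs4⟩ := exists_least_root (hpos l hl) h1.le
    refine ⟨s, fun _ => ⟨hs3, ?_, ?_⟩⟩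
    · by_contra h
      have h4 := not_lt.1 h
      have h5 : r l < r (l - 1) := hanti (Set.mem_Ici.2 (by omega)) (Set.mem_Ici.2 (by omega))
        (by omega)
      have h6 := hr0 (l - 1) (by omega)
      have h7 : 0 ≤ (p l).eval s := by
        rcases h4.lt_or_eq with h4 | h4
        · exact (hppos l (by omega) s h4).le
        · rw [h4, (hr l (by omega)).1.eq_zero]
      have h8 := hppos (l - 1) (by omega) s (h4.trans_lt h5)
      have h9 : 0 < (q l).eval s := by
        rw [hq l hl s hs1 (by linarith)]
        have h10 := mul_nonneg (ha l hl).le h7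
        have h11 : 0 < c l * (1 - 2 * s) * (p (l - 1)).eval s :=
          mul_pos (mul_pos (hc l hl) (by linarith)) h8
        linarith
      exact h9.ne' hs3.1
    · refine lt_of_le_of_ne hs2 ?_
      rintro rfl
      exact h1.ne hs3.1
  choose s hs using key
  refine ⟨s, fun l hl => (hs l hl).1, ?_, ?_⟩
  · intro l hl m hm hlm
    rw [Set.mem_Ici] at hl hm
    calc s m < r (m - 1) := (hs m hm).2.2
      _ ≤ r l := hanti.antitoneOn (Set.mem_Ici.2 (by omega)) (Set.mem_Ici.2 (by omega)) (by omega)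
      _ < s l := (hs l hl).2.1
  · refine tendsto_of_tendsto_of_tendsto_of_le_of_le' hlim
      (hlim.comp (tendsto_sub_atTop_nat 1)) ?_ ?_
    · filter_upwards [eventually_ge_atTop l₀] with l hl using (hs l hl).2.1.le
    · filter_upwards [eventually_ge_atTop l₀] with l hl using (hs l hl).2.2.le

end Roots

/-! ### Geometric models of cluster complexes -/

section Model

theorem neg_single_not_nonneg {ι : Type*} [DecidableEq ι] (i : ι) :
    ¬ ∀ j, 0 ≤ (-Pi.single i 1 : ι → ℤ) j := by
  intro h
  have := h i
  simp at this

variable {ι : Type*} [Fintype ι] [DecidableEq ι] {α : Type*}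

/-- A geometric model of the cluster complex with Cartan matrix `A`: a finite set `U` of arcs, where
`vec u` is the almost positive root of the arc `u`, `neg i` is the arc of `-α_i`, and the symmetry
`refl s` of the set of arcs corresponds to `τ_s`. -/
structure IsArcModel (A : Matrix ι ι ℤ) (ε : ι → Bool) (U : Finset α) (vec : α → ι → ℤ)
    (refl : Bool → α → α) (compat : α → α → Prop) (neg : ι → α) : Prop where
  diag : ∀ i, A i i = 2
  bipartite : ∀ i j, i ≠ j → ε i = ε j → A i j = 0
  refl_mem : ∀ s, ∀ u ∈ U, refl s u ∈ U
  refl_refl : ∀ s, ∀ u ∈ U, refl s (refl s u) = u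
  vec_refl : ∀ s, ∀ u ∈ U, vec (refl s u) = tau A ε s (vec u)
  compat_refl : ∀ s, ∀ u ∈ U, ∀ w ∈ U, compat u w → compat (refl s u) (refl s w)
  neg_mem : ∀ i, neg i ∈ U
  vec_neg : ∀ i, vec (neg i) = -Pi.single i 1
  compat_neg : ∀ i, ∀ w ∈ U, compat (neg i) w ↔ vec w i ≤ 0
  nonneg_or : ∀ u ∈ U, (∀ i, 0 ≤ vec u i) ∨ ∃ i, u = neg i
  induction : ∀ P : α → Prop, (∀ i, P (neg i)) → (∀ s, ∀ u ∈ U, P u → P (refl s u)) →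
    ∀ u ∈ U, P u
  surj : ∀ v, IsRoot A v → (∀ i, 0 ≤ v i) → ∃ u ∈ U, vec u = v

/-- On the nonnegative vectors, `τ_s` is a product of commuting simple reflections. -/
theorem isRoot_tau {A : Matrix ι ι ℤ} {ε : ι → Bool} (hd : ∀ i, A i i = 2)
    (hb : ∀ i j, i ≠ j → ε i = ε j → A i j = 0) (s : Bool) {v : ι → ℤ} (hv : IsRoot A v)
    (h0 : ∀ i, 0 ≤ v i) : IsRoot A (tau A ε s v) := by
  have key : ∀ T : Finset ι, (∀ i ∈ T, ε i = s) → IsRoot A fun i =>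
      if i ∈ T then -v i - ∑ j ∈ Finset.univ.erase i, A j i * v j else v i := by
    intro T
    induction T using Finset.induction_on with
    | empty => intro _; simpa using hv
    | insert i T hi ih =>
      intro hT
      have h1 := IsRoot.reflect i _ (ih fun j hj => hT j (Finset.mem_insert_of_mem hj))
      convert h1 using 1
      ext k
      by_cases hk : k = i
      · subst hk
        simp only [simpleReflection, Finset.mem_insert, true_or, if_true, Pi.sub_apply, hi,
          if_false, Pi.single_eq_same]
        rw [← Finset.add_sum_erase _ _ (Finset.mem_univ k), if_neg hi, hd]
        have : ∑ x ∈ Finset.univ.erase k, (if x ∈ T then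
            -v x - ∑ j ∈ Finset.univ.erase x, A j x * v j else v x) * A x k =
            ∑ j ∈ Finset.univ.erase k, A j k * v j := by
          refine Finset.sum_congr rfl fun j hj => ?_
          split_ifs with h
          · rw [hb j k (Finset.ne_of_mem_erase hj) ((hT j (Finset.mem_insert_of_mem h)).trans
              (hT k (Finset.mem_insert_self _ _)).symm)]
            simp
          · ring
        rw [this]
        ring
      · simp [simpleReflection, hk]
  have e : tau A ε s v = fun i => if i ∈ ({i | ε i = s} : Finset ι) then
      -v i - ∑ j ∈ Finset.univ.erase i, A j i * v j else v i := by
    ext i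
    simp only [tau, Finset.mem_filter, Finset.mem_univ, true_and, max_eq_left (h0 _)]
  rw [e]
  exact key _ (by simp)

theorem tau_neg_single (A : Matrix ι ι ℤ) (ε : ι → Bool) (s : Bool) (i : ι) :
    tau A ε s (-Pi.single i 1) = if ε i = s then Pi.single i 1 else -Pi.single i 1 := by
  have h0 : ∀ j, max ((-Pi.single i 1 : ι → ℤ) j) 0 = 0 := by
    intro j
    rw [Pi.neg_apply, Pi.single_apply]
    split_ifs <;> simp
  ext k
  simp only [tau, h0, mul_zero, Finset.sum_const_zero, sub_zero]
  by_cases hk : k = i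
  · subst hk
    split_ifs <;> simp
  · split_ifs <;> simp [hk]

namespace IsArcModel

variable {A : Matrix ι ι ℤ} {ε : ι → Bool} {U : Finset α} {vec : α → ι → ℤ}
  {refl : Bool → α → α} {compat : α → α → Prop} {neg : ι → α}

/-- If two arcs have the same root, then so have their images under the reflections, and the claim
is clear if one of them is `neg i`. -/
theorem vec_injOn (M : IsArcModel A ε U vec refl compat neg) : Set.InjOn vec U := by
  have key : ∀ u ∈ U, ∀ w ∈ U, vec u = vec w → u = w := by
    refine M.induction _ ?_ ?_
    · intro i w hw h
      rw [M.vec_neg] at h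
      rcases M.nonneg_or w hw with h1 | ⟨j, rfl⟩
      · rw [← h] at h1
        exact absurd h1 (neg_single_not_nonneg i)
      · rw [M.vec_neg, neg_inj] at h
        have : i = j := by
          by_contra hij
          have := congrFun h i
          simp [hij] at this
        rw [this]
    · intro s u hu ih w hw h
      have h1 := ih _ (M.refl_mem s w hw) (by
        rw [M.vec_refl s w hw, ← h, ← M.vec_refl s _ (M.refl_mem s u hu), M.refl_refl s u hu])
      rw [h1, M.refl_refl s w hw]
  exact fun u hu w hw h => key u hu w hw h

theorem vec_mem (M : IsArcModel A ε U vec refl compat neg) {u : α} (hu : u ∈ U) :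
    vec u ∈ almostPositiveRoots A := by
  have key : ∀ u ∈ U, (∀ i, 0 ≤ vec u i) → IsRoot A (vec u) := by
    refine M.induction _ ?_ ?_
    · intro i h
      rw [M.vec_neg] at h
      exact absurd h (neg_single_not_nonneg i)
    · intro s u hu ih h
      rcases M.nonneg_or u hu with h1 | ⟨i, rfl⟩
      · rw [M.vec_refl s u hu]
        exact isRoot_tau M.diag M.bipartite s (ih h1) h1
      · rw [M.vec_refl s _ hu, M.vec_neg, tau_neg_single] at h ⊢
        split_ifs at h ⊢
        · exact .simple i
        · exact absurd h (neg_single_not_nonneg i)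
  rcases M.nonneg_or u hu with h | ⟨i, rfl⟩
  · exact Or.inl ⟨key u hu h, h⟩
  · exact Or.inr ⟨i, M.vec_neg i⟩

theorem exists_vec_eq (M : IsArcModel A ε U vec refl compat neg) {v : ι → ℤ}
    (hv : v ∈ almostPositiveRoots A) : ∃ u ∈ U, vec u = v := by
  rcases hv with ⟨h1, h2⟩ | ⟨i, h⟩
  · exact M.surj v h1 h2
  · exact ⟨neg i, M.neg_mem i, (M.vec_neg i).trans h.symm⟩

/-- As `vec` is injective, each value of the compatibility degree that can be derived from its
defining relations comes with a pair of arcs, and compatibility is known for the arcs `neg i` and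
is preserved by the reflections. -/
theorem hasCompatDegree_zero (M : IsArcModel A ε U vec refl compat neg) {u w : α} (hu : u ∈ U)
    (hw : w ∈ U) : HasCompatDegree A ε (vec u) (vec w) 0 ↔ compat u w := by
  constructor
  · intro h
    have key : ∀ v v' d, HasCompatDegree A ε v v' d →
        ∃ u ∈ U, ∃ w ∈ U, vec u = v ∧ vec w = v' ∧ (d ≤ 0 → compat u w) := by
      intro v v' d h
      induction h with
      | negSimple i β hβ =>
        obtain ⟨w, hw, rfl⟩ := M.exists_vec_eq hβ
        refine ⟨neg i, M.neg_mem i, w, hw, M.vec_neg i, rfl, fun h => ?_⟩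
        exact (M.compat_neg i w hw).2 ((le_max_left _ _).trans h)
      | invariant s v v' d _ ih =>
        obtain ⟨u, hu, w, hw, rfl, rfl, h⟩ := ih
        exact ⟨refl s u, M.refl_mem s u hu, refl s w, M.refl_mem s w hw, M.vec_refl s u hu,
          M.vec_refl s w hw, fun hd => M.compat_refl s u hu w hw (h hd)⟩
    obtain ⟨u', hu', w', hw', h1, h2, h3⟩ := key _ _ _ h
    rw [← M.vec_injOn hu' hu h1, ← M.vec_injOn hw' hw h2]
    exact h3 le_rfl
  · have key : ∀ u ∈ U, ∀ w ∈ U, compat u w → HasCompatDegree A ε (vec u) (vec w) 0 := by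
      refine M.induction _ ?_ ?_
      · intro i w hw h
        have h1 := HasCompatDegree.negSimple (ε := ε) i (vec w) (M.vec_mem hw)
        rwa [max_eq_right ((M.compat_neg i w hw).1 h), ← M.vec_neg] at h1
      · intro s u hu ih w hw h
        have h1 := M.compat_refl s _ (M.refl_mem s u hu) w hw h
        rw [M.refl_refl s u hu] at h1
        have h2 := HasCompatDegree.invariant s _ _ _ (ih _ (M.refl_mem s w hw) h1)
        rwa [← M.vec_refl s u hu, ← M.vec_refl s _ (M.refl_mem s w hw), M.refl_refl s w hw] at h2
    exact key u hu w hw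

theorem faceNumber_eq (M : IsArcModel A ε U vec refl compat neg) (n : ℕ) :
    (faceNumber (clusterComplex A ε) n : ℝ) = (indepPoly compat U).coeff n := by
  classical
  rw [indepPoly_coeff]
  norm_cast
  rw [faceNumber]
  split_ifs with hn
  · subst hn
    have : {S : Finset α | S ⊆ U ∧ (∀ u ∈ S, ∀ w ∈ S, compat u w) ∧ S.card = 0} = {∅} := by
      ext S
      simp only [Finset.card_eq_zero, Set.mem_ofPred_eq, Set.mem_singleton_iff]
      exact ⟨fun h => h.2.2, fun h => by simp [h]⟩
    rw [this, Set.ncard_singleton]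
  · symm
    refine Set.ncard_congr (fun S _ => S.image vec) ?_ ?_ ?_
    · rintro S ⟨h1, h2, h3⟩
      refine ⟨⟨?_, ?_, ?_⟩, ?_⟩
      · rw [Finset.image_nonempty, ← Finset.card_pos, h3]
        exact Nat.pos_of_ne_zero hn
      · simp only [Finset.mem_image, forall_exists_index, and_imp, forall_apply_eq_imp_iff₂]
        exact fun u hu => M.vec_mem (h1 hu)
      · simp only [Finset.mem_image, forall_exists_index, and_imp, forall_apply_eq_imp_iff₂]
        exact fun u hu w hw => (M.hasCompatDegree_zero (h1 hu) (h1 hw)).2 (h2 u hu w hw)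
      · rw [Finset.card_image_of_injOn (M.vec_injOn.mono (by exact_mod_cast h1)), h3]
    · rintro S T ⟨h1, -⟩ ⟨h2, -⟩ h
      have := (M.vec_injOn.image_eq_image_iff (s := U) (s₁ := (S : Set α)) (s₂ := (T : Set α))
        (by exact_mod_cast h1) (by exact_mod_cast h2)).1 (by exact_mod_cast h)
      exact_mod_cast this
    · rintro F ⟨⟨-, h2, h3⟩, h4⟩
      have hF : ({u ∈ U | vec u ∈ F} : Finset α).image vec = F := by
        ext v
        simp only [Finset.mem_image, Finset.mem_filter]
        constructor
        · rintro ⟨u, hu, rfl⟩; exact hu.2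
        · intro hv
          obtain ⟨u, hu, rfl⟩ := M.exists_vec_eq (h2 v hv)
          exact ⟨u, ⟨hu, hv⟩, rfl⟩
      refine ⟨{u ∈ U | vec u ∈ F}, ⟨Finset.filter_subset _ _, ?_, ?_⟩, hF⟩
      · intro u hu w hw
        rw [Finset.mem_filter] at hu hw
        exact (M.hasCompatDegree_zero hu.1 hw.1).1 (h3 _ hu.2 _ hw.2)
      · rw [← h4, ← congrArg Finset.card hF, Finset.card_image_of_injOn]
        exact M.vec_injOn.mono (by exact_mod_cast Finset.filter_subset _ _)

theorem eval_fPolynomial (M : IsArcModel A ε U vec refl compat neg)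
    (hdeg : (indepPoly compat U).natDegree ≤ Fintype.card ι) (t : ℝ) :
    (fPolynomial A ε).eval t = (indepPoly compat U).eval (-t) := by
  rw [fPolynomial, eval_finsetSum, eval_eq_sum_range' (Nat.lt_succ_of_le hdeg)]
  refine Finset.sum_congr rfl fun n _ => ?_
  rw [← M.faceNumber_eq]
  simp

end IsArcModel

end Model

/-! ### The zigzag of diagonals of the negative simple roots -/

section Snake

/-- The crossing number of the arcs `u` and `(s, t)`, which is `-1` if they coincide. -/
def crossNum (u : ℤ × ℤ) (s t : ℤ) : ℤ :=
  if u.1 = s ∧ u.2 = t then -1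
  else if (u.1 < s ∧ s < u.2 ∧ u.2 < t) ∨ (s < u.1 ∧ u.1 < t ∧ t < u.2) then 1 else 0

/-- The left endpoint of the `i`-th diagonal of the zigzag `(-1, 1), (-1, 2), (-2, 2), …`. -/
def snakeL (i : ℤ) : ℤ := -1 - i / 2

/-- The right endpoint of the `i`-th diagonal of the zigzag `(-1, 1), (-1, 2), (-2, 2), …`. -/
def snakeR (i : ℤ) : ℤ := 1 + (i + 1) / 2

/-- The reflection `x ↦ c - x` of the line corresponding to `τ_s` has `c = shift s`. -/
def shift (s : Bool) : ℤ := if s then 1 else 0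

theorem shift_eq (s : Bool) : (s = true ∧ shift s = 1) ∨ (s = false ∧ shift s = 0) := by
  cases s <;> simp [shift]

/-- The `j`-th vertex of the zigzag, so that the `i`-th diagonal joins the vertices `i + 1` and
`i + 2`. -/
def snakeVertex (j : ℤ) : ℤ := if j % 2 = 0 then -(j / 2) else (j + 1) / 2

theorem max_crossNum (u : ℤ × ℤ) (s t : ℤ) : max (crossNum u s t) 0 =
    if (u.1 < s ∧ s < u.2 ∧ u.2 < t) ∨ (s < u.1 ∧ u.1 < t ∧ t < u.2) then 1 else 0 := by
  simp only [crossNum]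
  split_ifs <;> omega

/-- The two diagonals of a quadrilateral two of whose sides are edges of the polygon. -/
theorem crossNum_exchange {u : ℤ × ℤ} {s t : ℤ} (hu : u.1 + 2 ≤ u.2) (hst : s + 2 ≤ t) :
    crossNum u s t + crossNum u (s + 1) (t + 1) =
      max (crossNum u (s + 1) t) 0 + max (crossNum u s (t + 1)) 0 := by
  obtain ⟨a, b⟩ := u
  simp only [max_crossNum]
  simp only [crossNum] at *
  split_ifs <;> omega

theorem crossNum_reflect (u : ℤ × ℤ) (c s t : ℤ) :
    crossNum (c - u.2, c - u.1) s t = crossNum u (c - t) (c - s) := by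
  obtain ⟨a, b⟩ := u
  simp only [crossNum]
  grind

/-- The reflection of the line belonging to `τ_s` fixes the diagonals of the zigzag whose sign is
not `s`, and it exchanges the other ones with the other diagonal of a quadrilateral. -/
theorem crossNum_reflect_snake {u : ℤ × ℤ} (hu : u.1 + 2 ≤ u.2) {i : ℤ} (hi : 0 ≤ i) (s : Bool) :
    crossNum u (shift s - snakeR i) (shift s - snakeL i) =
      if decide (i % 2 = 0) = s then -crossNum u (snakeL i) (snakeR i) +
        (max (crossNum u (snakeL (i - 1)) (snakeR (i - 1))) 0 +
          max (crossNum u (snakeL (i + 1)) (snakeR (i + 1))) 0)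
      else crossNum u (snakeL i) (snakeR i) := by
  have h2 : snakeL i + 2 ≤ snakeR i := by simp only [snakeL, snakeR]; omega
  rcases shift_eq s with ⟨rfl, hs⟩ | ⟨rfl, hs⟩ <;> rw [hs]
  · by_cases h : i % 2 = 0
    · rw [if_pos (by simpa using h)]
      have h1 := crossNum_exchange (s := snakeL i) (t := snakeR i) hu h2
      have e1 : 1 - snakeR i = snakeL i + 1 := by simp only [snakeL, snakeR]; omega
      have e2 : 1 - snakeL i = snakeR i + 1 := by simp only [snakeL, snakeR]; omega
      have e3 : snakeL (i - 1) = snakeL i + 1 := by simp only [snakeL]; omega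
      have e4 : snakeR (i - 1) = snakeR i := by simp only [snakeR]; omega
      have e5 : snakeL (i + 1) = snakeL i := by simp only [snakeL]; omega
      have e6 : snakeR (i + 1) = snakeR i + 1 := by simp only [snakeR]; omega
      rw [e1, e2, e3, e4, e5, e6]
      linarith
    · rw [if_neg (by simpa using h)]
      congr 1 <;> simp only [snakeL, snakeR] <;> omega
  · by_cases h : i % 2 = 0
    · rw [if_neg (by simpa using h)]
      congr 1 <;> simp only [snakeL, snakeR] <;> omega
    · rw [if_pos (by simpa using h)]
      have h1 := crossNum_exchange (s := snakeL i - 1) (t := snakeR i - 1) hu (by omega)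
      have e1 : 0 - snakeR i = snakeL i - 1 := by simp only [snakeL, snakeR]; omega
      have e2 : 0 - snakeL i = snakeR i - 1 := by simp only [snakeL, snakeR]; omega
      have e3 : snakeL (i - 1) = snakeL i := by simp only [snakeL]; omega
      have e4 : snakeR (i - 1) = snakeR i - 1 := by simp only [snakeR]; omega
      have e5 : snakeL (i + 1) = snakeL i - 1 := by simp only [snakeL]; omega
      have e6 : snakeR (i + 1) = snakeR i := by simp only [snakeR]; omega
      rw [sub_add_cancel, sub_add_cancel] at h1
      rw [e1, e2, e3, e4, e5, e6]
      linarith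

theorem sum_fin_ite (l : ℕ) (m : ℤ) (F : ℤ → ℤ) :
    ∑ j : Fin l, (if ((j : ℕ) : ℤ) = m then F j else 0) = if 0 ≤ m ∧ m < l then F m else 0 := by
  split_ifs with h
  · rw [Finset.sum_eq_single ⟨m.toNat, by omega⟩]
    · have : ((m.toNat : ℕ) : ℤ) = m := by omega
      simp [this]
    · intro j _ hj
      rw [if_neg]
      intro h1
      exact hj (Fin.ext (by simp; omega))
    · simp
  · refine Finset.sum_eq_zero fun j _ => if_neg ?_
    have := j.2
    omega

theorem simpleReflection_apply {ι : Type*} [Fintype ι] [DecidableEq ι] {A : Matrix ι ι ℤ}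
    (hd : ∀ i, A i i = 2) (j : ι) (v : ι → ℤ) (k : ι) :
    simpleReflection A j v k =
      if k = j then -v j - ∑ i ∈ Finset.univ.erase j, A i j * v i else v k := by
  rw [simpleReflection, Pi.sub_apply, Pi.single_apply]
  split_ifs with h
  · subst h
    rw [← Finset.add_sum_erase _ _ (Finset.mem_univ k), hd]
    simp only [mul_comm (v _)]
    ring
  · simp

end Snake

/-! ### Type `A` -/

section TypeA

theorem sum_erase_cartanA {l : ℕ} (F : ℤ → ℤ) (h0 : F (-1) = 0) (hl : F l = 0) (i : Fin l) :
    ∑ j ∈ Finset.univ.erase i, CartanMatrix.A l j i * F (j : ℕ) =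
      -(F ((i : ℕ) - 1) + F ((i : ℕ) + 1)) := by
  have e : ∀ j : Fin l, (if j = i then 0 else CartanMatrix.A l j i * F (j : ℕ)) =
      -((if ((j : ℕ) : ℤ) = (i : ℕ) - 1 then F (j : ℕ) else 0) +
        (if ((j : ℕ) : ℤ) = (i : ℕ) + 1 then F (j : ℕ) else 0)) := by
    intro j
    simp only [CartanMatrix.A, Matrix.of_apply, Fin.ext_iff]
    split_ifs <;> omega
  have e1 : ∑ j ∈ Finset.univ.erase i, CartanMatrix.A l j i * F (j : ℕ) =
      ∑ j, (if j = i then 0 else CartanMatrix.A l j i * F (j : ℕ)) := by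
    rw [← Finset.add_sum_erase _ _ (Finset.mem_univ i), if_pos rfl, zero_add]
    exact Finset.sum_congr rfl fun j hj => (if_neg (Finset.ne_of_mem_erase hj)).symm
  rw [e1, Finset.sum_congr rfl fun j _ => e j, Finset.sum_neg_distrib, Finset.sum_add_distrib,
    sum_fin_ite, sum_fin_ite]
  have hi := i.2
  congr 2
  · split_ifs with h
    · rfl
    · have : ((i : ℕ) : ℤ) = 0 := by omega
      rw [this, zero_sub, h0]
  · split_ifs with h
    · rfl
    · have : ((i : ℕ) : ℤ) + 1 = l := by omega
      rw [this, hl]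

/-- The roots of type `A_l` are the differences of two of the vectors with coordinates
`if p ≤ i then 1 else 0`, for `0 ≤ p ≤ l`. -/
theorem isRoot_A {l : ℕ} {v : Fin l → ℤ} (hv : IsRoot (CartanMatrix.A l) v) :
    ∃ p q : ℤ, 0 ≤ p ∧ p ≤ l ∧ 0 ≤ q ∧ q ≤ l ∧ p ≠ q ∧
      ∀ i : Fin l, v i = (if p ≤ (i : ℕ) then 1 else 0) - (if q ≤ (i : ℕ) then 1 else 0) := by
  induction hv with
  | simple j =>
    have hj := j.2
    refine ⟨(j : ℕ), (j : ℕ) + 1, by omega, by omega, by omega, by omega, by omega, fun i => ?_⟩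
    simp only [Pi.single_apply, Fin.ext_iff]
    split_ifs <;> omega
  | reflect j v _ ih =>
    obtain ⟨p, q, hp, hp', hq, hq', hpq, h⟩ := ih
    have hj := j.2
    have hdiag : ∀ i, CartanMatrix.A l i i = 2 := fun i => congrFun (CartanMatrix.A_diag l) i
    set F : ℤ → ℤ := fun i => (if p ≤ i then 1 else 0) - (if q ≤ i then 1 else 0) with hF
    have h1 := sum_erase_cartanA F
      (by simp only [hF]; rw [if_neg (by omega), if_neg (by omega)]; rfl)
      (by simp only [hF]; rw [if_pos (by omega), if_pos (by omega)]; rfl) j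
    have hv : ∀ i : Fin l, v i = F (i : ℕ) := h
    have h2 : ∀ k, simpleReflection (CartanMatrix.A l) j v k =
        if k = j then F ((j : ℕ) - 1) + F ((j : ℕ) + 1) - F (j : ℕ) else F (k : ℕ) := by
      intro k
      rw [simpleReflection_apply hdiag, Finset.sum_congr rfl fun i _ => by rw [hv i], h1, hv, hv]
      split_ifs <;> ring
    refine ⟨if p = (j : ℕ) then (j : ℕ) + 1 else if p = (j : ℕ) + 1 then (j : ℕ) else p,
      if q = (j : ℕ) then (j : ℕ) + 1 else if q = (j : ℕ) + 1 then (j : ℕ) else q,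
      by split_ifs <;> omega, by split_ifs <;> omega, by split_ifs <;> omega,
      by split_ifs <;> omega, by split_ifs <;> omega, fun k => ?_⟩
    have aux : ∀ p : ℤ, (if (if p = (j : ℕ) then ((j : ℕ) : ℤ) + 1 else if p = (j : ℕ) + 1 then
        (j : ℕ) else p) ≤ (k : ℕ) then (1 : ℤ) else 0) = if k = j then
        (if p ≤ ((j : ℕ) : ℤ) - 1 then 1 else 0) + (if p ≤ ((j : ℕ) : ℤ) + 1 then 1 else 0) -
          (if p ≤ (j : ℕ) then 1 else 0) else (if p ≤ (k : ℕ) then 1 else 0) := by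
      intro p
      simp only [Fin.ext_iff]
      split_ifs <;> omega
    rw [h2, aux, aux]
    simp only [hF]
    by_cases hk : k = j
    · simp only [hk, if_true]; ring
    · simp only [hk, if_false]

/-- The left endpoint of the polygon with `l + 3` vertices. -/
def polyL (l : ℕ) : ℤ := snakeL l

/-- The right endpoint of the polygon with `l + 3` vertices. -/
def polyR (l : ℕ) : ℤ := snakeR l

/-- The diagonals of the polygon with `l + 3` vertices. -/
noncomputable def arcsA (l : ℕ) : Finset (ℤ × ℤ) :=
  (linearArcs (polyL l) (polyR l)).erase (polyL l, polyR l)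

/-- The almost positive root of type `A_l` of a diagonal. -/
def vecA (l : ℕ) (u : ℤ × ℤ) (i : Fin l) : ℤ := crossNum u (snakeL (i : ℕ)) (snakeR (i : ℕ))

/-- The reflections `x ↦ -x` and `x ↦ 1 - x` modulo `l + 3` of the polygon. -/
def reflA (l : ℕ) (s : Bool) (u : ℤ × ℤ) : ℤ × ℤ :=
  if polyR l < shift s - u.1 then (polyL l, shift s - u.2)
  else if shift s - u.2 < polyL l then (shift s - u.1, polyR l)
  else (shift s - u.2, shift s - u.1)

theorem mem_arcsA {l : ℕ} {u : ℤ × ℤ} : u ∈ arcsA l ↔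
    -1 - (l : ℤ) / 2 ≤ u.1 ∧ u.1 + 2 ≤ u.2 ∧ u.2 ≤ 1 + ((l : ℤ) + 1) / 2 ∧
      ¬ (u.1 = -1 - (l : ℤ) / 2 ∧ u.2 = 1 + ((l : ℤ) + 1) / 2) := by
  simp only [arcsA, Finset.mem_erase, mem_linearArcs, polyL, polyR, snakeL, snakeR, ne_eq,
    Prod.ext_iff]
  tauto

theorem vecA_refl {l : ℕ} (s : Bool) {u : ℤ × ℤ} (hu : u ∈ arcsA l) :
    vecA l (reflA l s u) = tau (CartanMatrix.A l) (pathSign l) s (vecA l u) := by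
  rw [mem_arcsA] at hu
  ext i
  have hi := i.2
  have h1 : vecA l (reflA l s u) i = crossNum (shift s - u.2, shift s - u.1)
      (snakeL (i : ℕ)) (snakeR (i : ℕ)) := by
    obtain ⟨a, b⟩ := u
    rcases shift_eq s with ⟨rfl, hs⟩ | ⟨rfl, hs⟩ <;>
    · simp only [vecA, reflA, hs, polyL, polyR, snakeL, snakeR] at *
      split_ifs
      · simp only [crossNum]
        split_ifs <;> omega
      · simp only [crossNum]
        split_ifs <;> omega
      · rfl
  have h2 : ∑ j ∈ Finset.univ.erase i, CartanMatrix.A l j i * max (vecA l u j) 0 =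
      -(max (crossNum u (snakeL ((i : ℕ) - 1)) (snakeR ((i : ℕ) - 1))) 0 +
        max (crossNum u (snakeL ((i : ℕ) + 1)) (snakeR ((i : ℕ) + 1))) 0) := by
    refine sum_erase_cartanA (fun i => max (crossNum u (snakeL i) (snakeR i)) 0) ?_ ?_ i
    · simp only [max_crossNum, snakeL, snakeR]
      split_ifs <;> omega
    · simp only [max_crossNum, snakeL, snakeR]
      split_ifs <;> omega
  rw [h1, crossNum_reflect, crossNum_reflect_snake hu.2.1 (by omega), tau, h2, sub_neg_eq_add]
  have e : (decide (((i : ℕ) : ℤ) % 2 = 0) = s) ↔ pathSign l i = s := by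
    rw [pathSign]
    have : ((i : ℕ) : ℤ) % 2 = 0 ↔ (i : ℕ) % 2 = 0 := by omega
    simp only [this]
  simp only [e]
  rfl

/-- The diagonals of a polygon form a model of the cluster complex of type `A_l`. -/
theorem isArcModel_A (l : ℕ) : IsArcModel (CartanMatrix.A l) (pathSign l) (arcsA l) (vecA l)
    (reflA l) Noncrossing (fun i => (snakeL (i : ℕ), snakeR (i : ℕ))) where
  diag i := congrFun (CartanMatrix.A_diag l) i
  bipartite i j hij h := by
    simp only [pathSign, decide_eq_decide] at h
    simp only [CartanMatrix.A, Matrix.of_apply]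
    rw [if_neg hij, if_neg (by omega)]
  refl_mem s u hu := by
    obtain ⟨a, b⟩ := u
    rw [mem_arcsA] at *
    rcases shift_eq s with ⟨rfl, hs⟩ | ⟨rfl, hs⟩ <;>
    · simp only [reflA, hs, polyL, polyR, snakeL, snakeR] at *
      split_ifs <;> simp only <;> omega
  refl_refl s u hu := by
    obtain ⟨a, b⟩ := u
    rw [mem_arcsA] at hu
    rcases shift_eq s with ⟨rfl, hs⟩ | ⟨rfl, hs⟩ <;>
    · simp only [reflA, hs, polyL, polyR, snakeL, snakeR] at *
      split_ifs <;> simp only [Prod.mk.injEq] at * <;> omega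
  vec_refl s u hu := vecA_refl s hu
  compat_refl s u hu w hw h := by
    obtain ⟨a, b⟩ := u
    obtain ⟨a', b'⟩ := w
    rw [mem_arcsA] at hu hw
    rcases shift_eq s with ⟨rfl, hs⟩ | ⟨rfl, hs⟩ <;>
    · simp only [reflA, hs, polyL, polyR, snakeL, snakeR, Noncrossing] at *
      split_ifs <;> simp only at * <;> omega
  neg_mem i := by
    have := i.2
    simp only [mem_arcsA, snakeL, snakeR]
    omega
  vec_neg i := by
    ext k
    have hk := k.2
    simp only [Pi.neg_apply, Pi.single_apply, Fin.ext_iff]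
    simp only [vecA, crossNum, snakeL, snakeR]
    split_ifs <;> omega
  compat_neg i w hw := by
    obtain ⟨a, b⟩ := w
    simp only [vecA, crossNum, Noncrossing]
    split_ifs <;> omega
  nonneg_or u hu := by
    by_cases h : ∃ i : Fin l, u.1 = snakeL (i : ℕ) ∧ u.2 = snakeR (i : ℕ)
    · obtain ⟨i, h1, h2⟩ := h
      exact Or.inr ⟨i, Prod.ext h1 h2⟩
    · left
      intro i
      simp only [vecA, crossNum]
      rw [if_neg fun h' => h ⟨i, h'⟩]
      split_ifs <;> simp
  induction P hneg hrefl := by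
    have key : ∀ n : ℕ, ∀ u ∈ arcsA l, (2 * (u.1 + u.2) - 1).natAbs ≤ n → P u := by
      intro n
      induction n using Nat.strong_induction_on with
      | _ n ih =>
      rintro ⟨a, b⟩ hu hn
      have hu' := mem_arcsA.1 hu
      simp only at hn hu'
      -- composing the two reflections gives the translations by `1` and `-1`
      have step : ∀ s, (a + 1 - 2 * shift s, b + 1 - 2 * shift s) ∈ arcsA l →
          (a + b < 0 ∨ 1 < a + b) →
          (reflA l s (reflA l (!s) (a + 1 - 2 * shift s, b + 1 - 2 * shift s))) = (a, b) := by
        intro s h1 h2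
        rw [mem_arcsA] at h1
        have e : shift (!s) = 1 - shift s := by cases s <;> simp [shift]
        rcases shift_eq s with ⟨rfl, hs⟩ | ⟨rfl, hs⟩ <;>
        · simp only [reflA, e, hs, polyL, polyR, snakeL, snakeR] at *
          split_ifs <;> simp only [Prod.mk.injEq] at * <;> omega
      have refl_mem : ∀ s, ∀ u ∈ arcsA l, reflA l s u ∈ arcsA l := by
        rintro s ⟨a, b⟩ hu
        rw [mem_arcsA] at *
        rcases shift_eq s with ⟨rfl, hs⟩ | ⟨rfl, hs⟩ <;>
        · simp only [reflA, hs, polyL, polyR, snakeL, snakeR] at *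
          split_ifs <;> simp only <;> omega
      rcases (by omega : a + b < 0 ∨ 1 < a + b ∨ a + b = 0 ∨ a + b = 1) with h | h | h
      · have h1 : (a + 1 - 2 * shift false, b + 1 - 2 * shift false) ∈ arcsA l := by
          simp only [mem_arcsA, shift]; simp; omega
        have h2 := ih _ (by simp [shift]; omega) _ h1 le_rfl
        rw [← step false h1 (Or.inl h)]
        exact hrefl _ _ (refl_mem _ _ h1) (hrefl _ _ h1 h2)
      · have h1 : (a + 1 - 2 * shift true, b + 1 - 2 * shift true) ∈ arcsA l := by
          simp only [mem_arcsA, shift]; simp; omega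
        have h2 := ih _ (by simp [shift]; omega) _ h1 le_rfl
        rw [← step true h1 (Or.inr h)]
        exact hrefl _ _ (refl_mem _ _ h1) (hrefl _ _ h1 h2)
      · have h1 := hneg ⟨(b - a - 2).toNat, by omega⟩
        have h2 : (((b - a - 2).toNat : ℕ) : ℤ) = b - a - 2 := by omega
        simp only [h2, snakeL, snakeR] at h1
        rwa [show -1 - (b - a - 2) / 2 = a by omega, show 1 + (b - a - 2 + 1) / 2 = b by omega]
          at h1
    exact fun u hu => key _ u hu le_rfl
  surj v hv h0 := by
    obtain ⟨p, q, hp, hp', hq, hq', hpq, h⟩ := isRoot_A hv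
    have hlt : p < q := by
      by_contra hlt
      have h1 := h0 ⟨q.toNat, by omega⟩
      rw [h] at h1
      dsimp only at h1
      rw [if_neg (by omega), if_pos (by omega)] at h1
      omega
    refine ⟨(min (snakeVertex p) (snakeVertex (q + 2)), max (snakeVertex p) (snakeVertex (q + 2))),
      ?_, ?_⟩
    · simp only [mem_arcsA, snakeVertex]
      split_ifs <;> omega
    · ext i
      have hi := i.2
      rw [h]
      simp only [vecA, crossNum, snakeVertex, snakeL, snakeR]
      generalize ((i : ℕ) : ℤ) = k at *
      split_ifs <;> omega

theorem indepPoly_arcsA (l : ℕ) : indepPoly Noncrossing (arcsA l) = dissPoly (l + 2) := by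
  rw [dissPoly]
  symm
  refine (indepPoly_bij (fun u => (u.1 - polyL l, u.2 - polyL l)) ?_ ?_ ?_ ?_)
  · intro u hu
    rw [mem_arcsA] at hu
    simp only [Finset.mem_erase, mem_linearArcs, ne_eq, Prod.mk.injEq, polyL, snakeL]
    omega
  · intro u _ w _ h
    simpa [Prod.ext_iff] using h
  · intro v hv
    refine ⟨(v.1 + polyL l, v.2 + polyL l), ?_, by simp⟩
    simp only [Finset.mem_erase, mem_linearArcs, ne_eq, Prod.ext_iff] at hv
    simp only [mem_arcsA, polyL, snakeL]
    omega
  · intro u _ w _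
    simp only [Noncrossing]
    omega

theorem eval_fA (l : ℕ) (t : ℝ) : (fA l).eval t = (dissPoly (l + 2)).eval (-t) := by
  rw [fA, (isArcModel_A l).eval_fPolynomial, indepPoly_arcsA]
  rw [indepPoly_arcsA, Fintype.card_fin]
  exact natDegree_dissPoly_le (l + 2)

end TypeA

/-! ### Type `B` -/

section TypeB

theorem sum_erase_cartanB {l : ℕ} (F : ℤ → ℤ) (h0 : F (-1) = 0) (i : Fin l) :
    ∑ j ∈ Finset.univ.erase i, CartanMatrix.B l j i * F (j : ℕ) =
      if (i : ℕ) + 1 = l then -(2 * F ((i : ℕ) - 1)) else -(F ((i : ℕ) - 1) + F ((i : ℕ) + 1)) := by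
  have hi := i.2
  have e : ∀ j : Fin l, (if j = i then 0 else CartanMatrix.B l j i * F (j : ℕ)) =
      -((if ((j : ℕ) : ℤ) = (i : ℕ) - 1 then
          (if (i : ℕ) + 1 = l then 2 else 1) * F (j : ℕ) else 0) +
        (if ((j : ℕ) : ℤ) = (i : ℕ) + 1 then F (j : ℕ) else 0)) := by
    intro j
    simp only [CartanMatrix.B, Matrix.of_apply, Fin.ext_iff]
    split_ifs <;> omega
  have e1 : ∑ j ∈ Finset.univ.erase i, CartanMatrix.B l j i * F (j : ℕ) =
      ∑ j, (if j = i then 0 else CartanMatrix.B l j i * F (j : ℕ)) := by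
    rw [← Finset.add_sum_erase _ _ (Finset.mem_univ i), if_pos rfl, zero_add]
    exact Finset.sum_congr rfl fun j hj => (if_neg (Finset.ne_of_mem_erase hj)).symm
  rw [e1, Finset.sum_congr rfl fun j _ => e j, Finset.sum_neg_distrib, Finset.sum_add_distrib,
    sum_fin_ite l _ (fun m => (if (i : ℕ) + 1 = l then 2 else 1) * F m), sum_fin_ite]
  have h1 : (if 0 ≤ ((i : ℕ) : ℤ) - 1 ∧ ((i : ℕ) : ℤ) - 1 < l then
      (if (i : ℕ) + 1 = l then 2 else 1) * F ((i : ℕ) - 1) else 0) =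
      (if (i : ℕ) + 1 = l then 2 else 1) * F ((i : ℕ) - 1) := by
    by_cases h : ((i : ℕ) : ℤ) = 0
    · rw [h, zero_sub, h0, mul_zero, ite_self]
    · rw [if_pos (by omega)]
  rw [h1]
  split_ifs <;> omega

/-- The roots of type `B_l` are the vectors `± f_p ± f_q` with `p ≠ q`, where `f_p` has the
coordinates `if p ≤ i then 1 else 0`; in particular `f_l = 0`. -/
theorem isRoot_B {l : ℕ} {v : Fin l → ℤ} (hv : IsRoot (CartanMatrix.B l) v) :
    ∃ p q a b : ℤ, 0 ≤ p ∧ p ≤ l ∧ 0 ≤ q ∧ q ≤ l ∧ p ≠ q ∧ (a = 1 ∨ a = -1) ∧ (b = 1 ∨ b = -1) ∧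
      ∀ i : Fin l, v i = a * (if p ≤ (i : ℕ) then 1 else 0) +
        b * (if q ≤ (i : ℕ) then 1 else 0) := by
  induction hv with
  | simple j =>
    have hj := j.2
    refine ⟨(j : ℕ), (j : ℕ) + 1, 1, -1, by omega, by omega, by omega, by omega, by omega,
      Or.inl rfl, Or.inr rfl, fun i => ?_⟩
    simp only [Pi.single_apply, Fin.ext_iff]
    split_ifs <;> omega
  | reflect j v _ ih =>
    obtain ⟨p, q, a, b, hp, hp', hq, hq', hpq, ha, hb, h⟩ := ih
    have hj := j.2
    set F : ℤ → ℤ := fun i => a * (if p ≤ i then 1 else 0) + b * (if q ≤ i then 1 else 0) with hF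
    have hv : ∀ i : Fin l, v i = F (i : ℕ) := h
    have h1 := sum_erase_cartanB F
      (by simp only [hF]; rw [if_neg (by omega), if_neg (by omega)]; ring) j
    have h2 : ∀ k, simpleReflection (CartanMatrix.B l) j v k =
        if k = j then (if (j : ℕ) + 1 = l then 2 * F ((j : ℕ) - 1) - F (j : ℕ) else
          F ((j : ℕ) - 1) + F ((j : ℕ) + 1) - F (j : ℕ)) else F (k : ℕ) := by
      intro k
      rw [simpleReflection_apply (CartanMatrix.B_diag l), Finset.sum_congr rfl fun i _ => by
        rw [hv i], h1, hv, hv]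
      split_ifs <;> ring
    by_cases hjl : (j : ℕ) + 1 = l
    · refine ⟨p, q, if p = (j : ℕ) then -a else a, if q = (j : ℕ) then -b else b, hp, hp', hq, hq',
        hpq, by split_ifs <;> omega, by split_ifs <;> omega, fun k => ?_⟩
      have aux : ∀ p a : ℤ, p ≤ l → (if p = (j : ℕ) then -a else a) *
          (if p ≤ (k : ℕ) then (1 : ℤ) else 0) = if k = j then
          2 * (a * (if p ≤ ((j : ℕ) : ℤ) - 1 then 1 else 0)) - a * (if p ≤ (j : ℕ) then 1 else 0)
          else a * (if p ≤ (k : ℕ) then 1 else 0) := by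
        intro p a hp
        have hk := k.2
        simp only [Fin.ext_iff]
        split_ifs <;> omega
      rw [h2, aux p a hp', aux q b hq', if_pos hjl]
      simp only [hF]
      by_cases hk : k = j
      · simp only [hk, if_true]; ring
      · simp only [hk, if_false]
    · refine ⟨if p = (j : ℕ) then (j : ℕ) + 1 else if p = (j : ℕ) + 1 then (j : ℕ) else p,
        if q = (j : ℕ) then (j : ℕ) + 1 else if q = (j : ℕ) + 1 then (j : ℕ) else q, a, b,
        by split_ifs <;> omega, by split_ifs <;> omega, by split_ifs <;> omega,
        by split_ifs <;> omega, by split_ifs <;> omega, ha, hb, fun k => ?_⟩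
      have aux : ∀ p : ℤ, (if (if p = (j : ℕ) then ((j : ℕ) : ℤ) + 1 else if p = (j : ℕ) + 1 then
          (j : ℕ) else p) ≤ (k : ℕ) then (1 : ℤ) else 0) = if k = j then
          (if p ≤ ((j : ℕ) : ℤ) - 1 then 1 else 0) + (if p ≤ ((j : ℕ) : ℤ) + 1 then 1 else 0) -
            (if p ≤ (j : ℕ) then 1 else 0) else (if p ≤ (k : ℕ) then 1 else 0) := by
        intro p
        simp only [Fin.ext_iff]
        split_ifs <;> omega
      rw [h2, aux, aux, if_neg hjl]
      simp only [hF]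
      by_cases hk : k = j
      · simp only [hk, if_true]; ring
      · simp only [hk, if_false]

/-- The left end of the window of length `N` that is used for representing arcs modulo `N`. -/
def window (N : ℕ) : ℤ := -((N : ℤ) / 2)

/-- The coordinates of the almost positive root of type `B` of an arc. An arc of length less than
`N` stands for two diagonals of the polygon with `2N` vertices, an arc of length `N` for a
diameter. -/
def vecCyc (N : ℕ) (u : ℤ × ℤ) (i : ℤ) : ℤ :=
  crossNum u (snakeL i) (snakeR i) +
    if u.2 < u.1 + N then crossNum (u.1 - N, u.2 - N) (snakeL i) (snakeR i) else 0

/-- The reflections `x ↦ -x` and `x ↦ 1 - x` on the arcs modulo `N`. -/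
def reflCyc (N : ℕ) (s : Bool) (u : ℤ × ℤ) : ℤ × ℤ :=
  if shift s - u.2 < window N then (shift s - u.2 + N, shift s - u.1 + N)
  else (shift s - u.2, shift s - u.1)

theorem mem_cyclicArcs_window {N : ℕ} {u : ℤ × ℤ} : u ∈ cyclicArcs (window N) N ↔
    -((N : ℤ) / 2) ≤ u.1 ∧ u.1 < -((N : ℤ) / 2) + N ∧ u.1 + 2 ≤ u.2 ∧ u.2 ≤ u.1 + N :=
  mem_cyclicArcs

theorem reflCyc_mem {N : ℕ} (s : Bool) {u : ℤ × ℤ} (hu : u ∈ cyclicArcs (window N) N) :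
    reflCyc N s u ∈ cyclicArcs (window N) N := by
  obtain ⟨a, b⟩ := u
  rw [mem_cyclicArcs_window] at *
  rcases shift_eq s with ⟨rfl, hs⟩ | ⟨rfl, hs⟩ <;>
  · simp only [reflCyc, hs, window] at *
    split_ifs <;> simp only <;> omega

theorem reflCyc_reflCyc {N : ℕ} (s : Bool) {u : ℤ × ℤ} (hu : u ∈ cyclicArcs (window N) N) :
    reflCyc N s (reflCyc N s u) = u := by
  obtain ⟨a, b⟩ := u
  rw [mem_cyclicArcs_window] at *
  rcases shift_eq s with ⟨rfl, hs⟩ | ⟨rfl, hs⟩ <;>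
  · simp only [reflCyc, hs, window] at *
    split_ifs <;> simp only [Prod.mk.injEq] at * <;> omega

theorem cyclicNoncrossing_refl {N : ℕ} (s : Bool) {u w : ℤ × ℤ}
    (hu : u ∈ cyclicArcs (window N) N) (hw : w ∈ cyclicArcs (window N) N)
    (h : CyclicNoncrossing N u w) :
    CyclicNoncrossing N (reflCyc N s u) (reflCyc N s w) := by
  obtain ⟨a, b⟩ := u
  obtain ⟨a', b'⟩ := w
  rw [mem_cyclicArcs_window] at *
  simp only [CyclicNoncrossing, Noncrossing] at h
  rcases shift_eq s with ⟨rfl, hs⟩ | ⟨rfl, hs⟩ <;>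
  · simp only [reflCyc, hs, window] at *
    split_ifs <;> simp only [CyclicNoncrossing, Noncrossing] <;> omega

/-- The sum of the crossing numbers with three translates. -/
theorem sum_translates {N : ℕ} {u : ℤ × ℤ} (hu : u ∈ cyclicArcs (window N) N) {i : ℤ}
    (hi : 0 ≤ i) (hiN : i + 2 < N) :
    crossNum (u.1 - N, u.2 - N) (snakeL i) (snakeR i) + crossNum u (snakeL i) (snakeR i) +
      crossNum (u.1 + N, u.2 + N) (snakeL i) (snakeR i) =
    (if u.2 < u.1 + N then 1 else 2) * vecCyc N u i := by
  obtain ⟨a, b⟩ := u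
  rw [mem_cyclicArcs_window] at hu
  have h0 : crossNum (a + N, b + N) (snakeL i) (snakeR i) = 0 := by
    simp only [crossNum, snakeL, snakeR] at *
    split_ifs <;> omega
  simp only [vecCyc] at *
  rw [h0]
  split_ifs with h
  · ring
  · have h1 : crossNum (a - N, b - N) (snakeL i) (snakeR i) =
        crossNum (a, b) (snakeL i) (snakeR i) := by
      simp only [crossNum, snakeL, snakeR] at *
      split_ifs <;> omega
    rw [h1]
    ring

theorem sum_translates_max {N : ℕ} {u : ℤ × ℤ} (hu : u ∈ cyclicArcs (window N) N) {i : ℤ}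
    (hi : -1 ≤ i) (hiN : i + 2 ≤ N) :
    max (crossNum (u.1 - N, u.2 - N) (snakeL i) (snakeR i)) 0 +
      max (crossNum u (snakeL i) (snakeR i)) 0 +
      max (crossNum (u.1 + N, u.2 + N) (snakeL i) (snakeR i)) 0 =
    (if u.2 < u.1 + N then 1 else 2) * max (vecCyc N u i) 0 := by
  obtain ⟨a, b⟩ := u
  rw [mem_cyclicArcs_window] at hu
  have h0 : crossNum (a + N, b + N) (snakeL i) (snakeR i) = 0 := by
    simp only [crossNum, snakeL, snakeR] at *
    split_ifs <;> omega
  simp only [vecCyc] at *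
  rw [h0]
  split_ifs with h
  · simp only [crossNum, snakeL, snakeR] at *
    split_ifs <;> omega
  · have h1 : max (crossNum (a - N, b - N) (snakeL i) (snakeR i)) 0 =
        max (crossNum (a, b) (snakeL i) (snakeR i)) 0 := by
      simp only [max_crossNum, snakeL, snakeR] at *
      split_ifs <;> omega
    rw [h1, add_zero]
    simp
    ring

theorem vecCyc_neg_one {N : ℕ} {u : ℤ × ℤ} (hu : u.1 + 2 ≤ u.2) :
    max (vecCyc N u (-1)) 0 = 0 := by
  obtain ⟨a, b⟩ := u
  simp only [vecCyc, crossNum, snakeL, snakeR] at *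
  split_ifs <;> omega

/-- The coordinate belonging to the diameter of the zigzag. -/
theorem vecCyc_last {N : ℕ} {u : ℤ × ℤ} (hu : u ∈ cyclicArcs (window N) N) :
    vecCyc N u (N - 2) = if u.2 < u.1 + N then (if window N + N < u.2 then 2 else 0)
      else if u.1 = window N then -1 else 1 := by
  obtain ⟨a, b⟩ := u
  have h1 : snakeL (N - 2) = window N := by simp only [snakeL, window]; omega
  have h2 : snakeR (N - 2) = window N + N := by simp only [snakeR, window]; omega
  rw [mem_cyclicArcs] at hu
  rw [vecCyc, h1, h2]
  simp only [crossNum] at *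
  split_ifs <;> omega

theorem vecCyc_reflCyc {N : ℕ} (s : Bool) {u : ℤ × ℤ} (hu : u ∈ cyclicArcs (window N) N) {i : ℤ}
    (hi : 0 ≤ i) (hiN : i + 2 < N) :
    vecCyc N (reflCyc N s u) i = if decide (i % 2 = 0) = s then
      -vecCyc N u i + (max (vecCyc N u (i - 1)) 0 + max (vecCyc N u (i + 1)) 0)
      else vecCyc N u i := by
  have hmem := reflCyc_mem s hu
  have e1 := sum_translates hmem hi hiN
  have hlen : (reflCyc N s u).2 < (reflCyc N s u).1 + N ↔ u.2 < u.1 + N := by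
    simp only [reflCyc]
    split_ifs <;> simp only <;> omega
  simp only [hlen] at e1
  have e2 : crossNum ((reflCyc N s u).1 - N, (reflCyc N s u).2 - N) (snakeL i) (snakeR i) +
      crossNum (reflCyc N s u) (snakeL i) (snakeR i) +
      crossNum ((reflCyc N s u).1 + N, (reflCyc N s u).2 + N) (snakeL i) (snakeR i) =
      crossNum (u.1 - N, u.2 - N) (shift s - snakeR i) (shift s - snakeL i) +
      crossNum u (shift s - snakeR i) (shift s - snakeL i) +
      crossNum (u.1 + N, u.2 + N) (shift s - snakeR i) (shift s - snakeL i) := by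
    rw [← crossNum_reflect, ← crossNum_reflect, ← crossNum_reflect]
    obtain ⟨a, b⟩ := u
    rw [mem_cyclicArcs_window] at hu
    simp only [reflCyc] at *
    split_ifs with h
    · simp only at *
      have h0 : crossNum (shift s - b + N + N, shift s - a + N + N) (snakeL i) (snakeR i) = 0 := by
        rcases shift_eq s with ⟨rfl, hs⟩ | ⟨rfl, hs⟩ <;>
        · simp only [crossNum, snakeL, snakeR, hs, window] at *
          split_ifs <;> omega
      have h1 : crossNum (shift s - (b + N), shift s - (a + N)) (snakeL i) (snakeR i) = 0 := by
        rcases shift_eq s with ⟨rfl, hs⟩ | ⟨rfl, hs⟩ <;>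
        · simp only [crossNum, snakeL, snakeR, hs, window] at *
          split_ifs <;> omega
      rw [h0, h1]
      rw [show shift s - (b - N) = shift s - b + N by ring,
        show shift s - (a - N) = shift s - a + N by ring,
        show shift s - b + N - N = shift s - b by ring,
        show shift s - a + N - N = shift s - a by ring]
      ring
    · rw [show shift s - (b - N) = shift s - b + N by ring,
        show shift s - (a - N) = shift s - a + N by ring,
        show shift s - b - N = shift s - (b + N) by ring,
        show shift s - a - N = shift s - (a + N) by ring]
      ring
  have hu' := mem_cyclicArcs_window.1 hu
  rw [e2, crossNum_reflect_snake hu'.2.2.1 hi, crossNum_reflect_snake (by simp only; omega) hi,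
    crossNum_reflect_snake (by simp only; omega) hi] at e1
  have e3 := sum_translates hu hi hiN
  have e4 := sum_translates_max hu (i := i - 1) (by omega) (by omega)
  have e5 := sum_translates_max hu (i := i + 1) (by omega) (by omega)
  split_ifs at * <;> linarith

theorem decide_emod_two_eq (n : ℤ) (s : Bool) :
    (decide (n % 2 = 0) = s) ↔ n % 2 = 1 - shift s := by
  cases s <;> simp [shift]

/-- The coordinate next to the last one. -/
theorem max_vecCyc_even {N : ℕ} (h2 : (N : ℤ) % 2 = 0) {u : ℤ × ℤ}
    (hu : u ∈ cyclicArcs (window N) N) : max (vecCyc N u (N - 3)) 0 =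
      if u.2 < u.1 + N then (if u.1 = window N then 1 else 0) +
        (if window N + N < u.2 then (if u.2 = window N + N + 1 then 1 else 2) else 0)
      else if window N + 1 < u.1 then 1 else 0 := by
  obtain ⟨a, b⟩ := u
  rw [mem_cyclicArcs_window] at hu
  obtain ⟨m, hm⟩ : ∃ m : ℤ, (N : ℤ) = 2 * m := ⟨N / 2, by omega⟩
  have h1 : snakeL (N - 3) = 1 - m := by simp only [snakeL]; omega
  have h2 : snakeR (N - 3) = m := by simp only [snakeR]; omega
  have h3 : window N = -m := by simp only [window]; omega
  have h4 : (N : ℤ) / 2 = m := by omega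
  simp only [vecCyc, crossNum, h1, h2, h3, h4] at *
  rw [hm] at *
  clear h1 h2 h3 h4 hm
  split_ifs <;> omega

/-- The coordinate next to the last one, for odd `N`. -/
theorem max_vecCyc_odd {N : ℕ} (h2 : (N : ℤ) % 2 = 1) {u : ℤ × ℤ}
    (hu : u ∈ cyclicArcs (window N) N) : max (vecCyc N u (N - 3)) 0 =
      if u.2 < u.1 + N then (if window N + N ≤ u.2 ∧ u.1 ≠ window N + N - 1 then 1 else 0) +
        (if window N + N < u.2 then 1 else 0)
      else if window N < u.1 ∧ u.1 < window N + N - 1 then 1 else 0 := by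
  obtain ⟨a, b⟩ := u
  rw [mem_cyclicArcs_window] at hu
  obtain ⟨m, hm⟩ : ∃ m : ℤ, (N : ℤ) = 2 * m + 1 := ⟨N / 2, by omega⟩
  have h1 : snakeL (N - 3) = -m := by simp only [snakeL]; omega
  have h2 : snakeR (N - 3) = m := by simp only [snakeR]; omega
  have h3 : window N = -m := by simp only [window]; omega
  have h4 : (N : ℤ) / 2 = m := by omega
  simp only [vecCyc, crossNum, h1, h2, h3, h4] at *
  rw [hm] at *
  clear h1 h2 h3 h4 hm
  split_ifs <;> omega

/-- The last coordinate changes as prescribed by the Cartan matrix of type `B`. -/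
theorem vecCyc_reflCyc_last {N : ℕ} (hN : 2 ≤ N) (s : Bool) {u : ℤ × ℤ}
    (hu : u ∈ cyclicArcs (window N) N) :
    vecCyc N (reflCyc N s u) (N - 2) = if decide ((N : ℤ) % 2 = 0) = s then
      -vecCyc N u (N - 2) + 2 * max (vecCyc N u (N - 3)) 0 else vecCyc N u (N - 2) := by
  rw [vecCyc_last (reflCyc_mem s hu), vecCyc_last hu]
  simp only [decide_emod_two_eq]
  rcases Int.emod_two_eq_zero_or_one N with h | h
  · rw [max_vecCyc_even h hu, h]
    obtain ⟨a, b⟩ := u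
    rw [mem_cyclicArcs_window] at hu
    rcases shift_eq s with ⟨rfl, hs⟩ | ⟨rfl, hs⟩
    · rw [if_pos (show (0 : ℤ) = 1 - shift true by omega)]
      simp only [reflCyc, window, hs] at *
      split_ifs <;> simp only at * <;> omega
    · rw [if_neg (show ¬ (0 : ℤ) = 1 - shift false by omega)]
      simp only [reflCyc, window, hs] at *
      split_ifs <;> simp only at * <;> omega
  · rw [max_vecCyc_odd h hu, h]
    obtain ⟨a, b⟩ := u
    rw [mem_cyclicArcs_window] at hu
    rcases shift_eq s with ⟨rfl, hs⟩ | ⟨rfl, hs⟩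
    · rw [if_neg (show ¬ (1 : ℤ) = 1 - shift true by omega)]
      simp only [reflCyc, window, hs] at *
      split_ifs <;> simp only at * <;> omega
    · rw [if_pos (show (1 : ℤ) = 1 - shift false by omega)]
      simp only [reflCyc, window, hs] at *
      split_ifs <;> simp only at * <;> omega

end TypeB

section ModelB

/-- Up to symmetry every arc modulo `N` is an arc of the zigzag. -/
theorem reflCyc_induction {N : ℕ} (P : ℤ × ℤ → Prop)
    (hsnake : ∀ i : ℤ, 0 ≤ i → i + 2 ≤ N → P (snakeL i, snakeR i))
    (hrefl : ∀ s, ∀ u ∈ cyclicArcs (window N) N, P u → P (reflCyc N s u)) :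
    ∀ u ∈ cyclicArcs (window N) N, P u := by
  have key : ∀ n : ℕ, ∀ u ∈ cyclicArcs (window N) N, (u.1 - snakeL (u.2 - u.1 - 2)).natAbs ≤ n →
      P u := by
    intro n
    induction n using Nat.strong_induction_on with
    | _ n ih =>
    rintro ⟨a, b⟩ hu hn
    have hu' := mem_cyclicArcs_window.1 hu
    simp only at hn hu'
    -- composing the two reflections gives the translations by `1` and `-1`
    have step : ∀ s, (a + 1 - 2 * shift s, b + 1 - 2 * shift s) ∈ cyclicArcs (window N) N →
        reflCyc N s (reflCyc N (!s) (a + 1 - 2 * shift s, b + 1 - 2 * shift s)) = (a, b) := by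
      intro s h1
      rw [mem_cyclicArcs_window] at h1
      have e : shift (!s) = 1 - shift s := by cases s <;> simp [shift]
      rcases shift_eq s with ⟨rfl, hs⟩ | ⟨rfl, hs⟩ <;>
      · simp only [reflCyc, e, hs, window] at *
        split_ifs <;> simp only [Prod.mk.injEq] at * <;> omega
    have move : ∀ s, (a + 1 - 2 * shift s, b + 1 - 2 * shift s) ∈ cyclicArcs (window N) N →
        (a + 1 - 2 * shift s - snakeL (b - a - 2)).natAbs <
          (a - snakeL (b - a - 2)).natAbs → P (a, b) := by
      intro s h1 h2
      have h3 : b + 1 - 2 * shift s - (a + 1 - 2 * shift s) - 2 = b - a - 2 := by ring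
      have h4 := ih _ (lt_of_lt_of_le h2 hn) _ h1 (by rw [h3])
      rw [← step s h1]
      exact hrefl _ _ (reflCyc_mem _ h1) (hrefl _ _ h1 h4)
    rcases lt_trichotomy a (snakeL (b - a - 2)) with h | h | h
    · refine move false ?_ ?_
      · rw [mem_cyclicArcs_window]
        simp only [shift, snakeL] at *
        simp
        omega
      · simp [shift]
        omega
    · have h1 := hsnake (b - a - 2) (by omega) (by omega)
      rw [← h] at h1
      simp only [snakeL, snakeR] at h h1
      rwa [show 1 + (b - a - 2 + 1) / 2 = b by omega] at h1
    · refine move true ?_ ?_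
      · rw [mem_cyclicArcs_window]
        simp only [shift, snakeL] at *
        simp
        omega
      · simp [shift]
        omega
  exact fun u hu => key _ u hu le_rfl

/-- The almost positive root of type `B_l` of an arc modulo `l + 1`. -/
def vecB (l : ℕ) (u : ℤ × ℤ) (i : Fin l) : ℤ := vecCyc (l + 1) u (i : ℕ)

theorem vecB_refl {l : ℕ} (s : Bool) {u : ℤ × ℤ}
    (hu : u ∈ cyclicArcs (window (l + 1)) (l + 1)) :
    vecB l (reflCyc (l + 1) s u) = tau (CartanMatrix.B l) (pathSign l) s (vecB l u) := by
  ext i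
  have hi := i.2
  have h1 := sum_erase_cartanB (fun i => max (vecCyc (l + 1) u i) 0)
    (vecCyc_neg_one (mem_cyclicArcs_window.1 hu).2.2.1) i
  rw [tau]
  simp only [vecB]
  rw [h1]
  by_cases hil : (i : ℕ) + 1 = l
  · have h2 := vecCyc_reflCyc_last (by omega) s hu
    have e2 : ((l + 1 : ℕ) : ℤ) - 2 = (i : ℕ) := by omega
    have e3 : ((l + 1 : ℕ) : ℤ) - 3 = (i : ℕ) - 1 := by omega
    rw [e2, e3] at h2
    have e : (decide (((l + 1 : ℕ) : ℤ) % 2 = 0) = s) ↔ pathSign l i = s := by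
      rw [pathSign]
      have : ((l + 1 : ℕ) : ℤ) % 2 = 0 ↔ (i : ℕ) % 2 = 0 := by omega
      simp only [this]
    simp only [e] at h2
    rw [h2, if_pos hil, sub_neg_eq_add]
  · have e : (decide (((i : ℕ) : ℤ) % 2 = 0) = s) ↔ pathSign l i = s := by
      rw [pathSign]
      have : ((i : ℕ) : ℤ) % 2 = 0 ↔ (i : ℕ) % 2 = 0 := by omega
      simp only [this]
    rw [vecCyc_reflCyc s hu (by omega) (by omega), if_neg hil, sub_neg_eq_add]
    simp only [e]

theorem cyclicNoncrossing_snake {N : ℕ} {i : ℤ} (hi : 0 ≤ i) (hiN : i + 2 ≤ N) {w : ℤ × ℤ}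
    (hw : w ∈ cyclicArcs (window N) N) :
    CyclicNoncrossing N (snakeL i, snakeR i) w ↔ vecCyc N w i ≤ 0 := by
  obtain ⟨a, b⟩ := w
  rw [mem_cyclicArcs_window] at hw
  simp only [CyclicNoncrossing, Noncrossing, vecCyc, crossNum, snakeL, snakeR] at *
  split_ifs <;> omega

theorem snake_mem_cyclicArcs {N : ℕ} {i : ℤ} (hi : 0 ≤ i) (hiN : i + 2 ≤ N) :
    (snakeL i, snakeR i) ∈ cyclicArcs (window N) N := by
  simp only [mem_cyclicArcs_window, snakeL, snakeR]
  omega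

theorem vecCyc_snake {N : ℕ} {i j : ℤ} (hi : 0 ≤ i) (hiN : i + 2 ≤ N) (hj : 0 ≤ j)
    (hjN : j + 2 ≤ N) : vecCyc N (snakeL i, snakeR i) j = if j = i then -1 else 0 := by
  simp only [vecCyc, crossNum, snakeL, snakeR]
  split_ifs <;> omega

theorem vecCyc_nonneg {N : ℕ} {u : ℤ × ℤ} (hu : u ∈ cyclicArcs (window N) N) {i : ℤ}
    (hi : 0 ≤ i) (hiN : i + 2 ≤ N) (h : u ≠ (snakeL i, snakeR i)) : 0 ≤ vecCyc N u i := by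
  obtain ⟨a, b⟩ := u
  rw [mem_cyclicArcs_window] at hu
  simp only [ne_eq, Prod.mk.injEq] at h
  simp only [vecCyc, crossNum]
  rw [if_neg h]
  simp only [snakeL, snakeR] at *
  split_ifs <;> omega

/-- The arc of the difference of two coordinate vectors. -/
theorem vecCyc_arc_sub {N : ℕ} {p q i : ℤ} (hp : 0 ≤ p) (hpq : p < q) (hq : q + 2 ≤ N)
    (hi : 0 ≤ i) (hiN : i + 2 ≤ N) :
    vecCyc N (min (snakeVertex p) (snakeVertex (q + 2)),
      max (snakeVertex p) (snakeVertex (q + 2))) i =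
      (if p ≤ i then 1 else 0) - (if q ≤ i then 1 else 0) := by
  simp only [vecCyc, crossNum, snakeVertex, snakeL, snakeR]
  split_ifs <;> omega

/-- The arc of the sum of two coordinate vectors. -/
theorem vecCyc_arc_add {N : ℕ} {p q i : ℤ} (hp : 0 ≤ p) (hpq : p < q) (hq : q + 2 ≤ N)
    (hi : 0 ≤ i) (hiN : i + 2 ≤ N) :
    vecCyc N (max (snakeVertex p) (snakeVertex q), min (snakeVertex p) (snakeVertex q) + N) i =
      (if p ≤ i then 1 else 0) + (if q ≤ i then 1 else 0) := by
  simp only [vecCyc, crossNum, snakeVertex, snakeL, snakeR]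
  split_ifs <;> omega

/-- The diameter of a coordinate vector. -/
theorem vecCyc_diameter {N : ℕ} {p i : ℤ} (hp : 0 ≤ p) (hpN : p + 2 ≤ N)
    (hi : 0 ≤ i) (hiN : i + 2 ≤ N) :
    vecCyc N (snakeVertex p, snakeVertex p + N) i = if p ≤ i then 1 else 0 := by
  simp only [vecCyc, crossNum, snakeVertex, snakeL, snakeR]
  split_ifs <;> omega

theorem arc_sub_mem {N : ℕ} {p q : ℤ} (hp : 0 ≤ p) (hpq : p < q) (hq : q + 2 ≤ N) :
    (min (snakeVertex p) (snakeVertex (q + 2)), max (snakeVertex p) (snakeVertex (q + 2))) ∈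
      cyclicArcs (window N) N := by
  simp only [mem_cyclicArcs_window, snakeVertex]
  split_ifs <;> omega

theorem arc_add_mem {N : ℕ} {p q : ℤ} (hp : 0 ≤ p) (hpq : p < q) (hq : q + 2 ≤ N) :
    (max (snakeVertex p) (snakeVertex q), min (snakeVertex p) (snakeVertex q) + N) ∈
      cyclicArcs (window N) N := by
  simp only [mem_cyclicArcs_window, snakeVertex]
  split_ifs <;> omega

theorem diameter_mem {N : ℕ} {p : ℤ} (hp : 0 ≤ p) (hpN : p + 2 ≤ N) :
    (snakeVertex p, snakeVertex p + N) ∈ cyclicArcs (window N) N := by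
  simp only [mem_cyclicArcs_window, snakeVertex]
  split_ifs <;> omega

/-- The centrally symmetric diagonals of a polygon with `2 * (l + 1)` vertices, which are the arcs
modulo `l + 1`, form a model of the cluster complex of type `B_l`. -/
theorem isArcModel_B (l : ℕ) : IsArcModel (CartanMatrix.B l) (pathSign l)
    (cyclicArcs (window (l + 1)) (l + 1)) (vecB l) (reflCyc (l + 1)) (CyclicNoncrossing (l + 1))
    (fun i => (snakeL (i : ℕ), snakeR (i : ℕ))) where
  diag i := CartanMatrix.B_diag l i
  bipartite i j hij h := by
    simp only [pathSign, decide_eq_decide] at h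
    simp only [CartanMatrix.B, Matrix.of_apply]
    have := i.2
    have := j.2
    rw [if_neg hij, if_neg (by omega), if_neg (by omega)]
  refl_mem s u hu := reflCyc_mem s hu
  refl_refl s u hu := reflCyc_reflCyc s hu
  vec_refl s u hu := vecB_refl s hu
  compat_refl s u hu w hw h := cyclicNoncrossing_refl s hu hw h
  neg_mem i := snake_mem_cyclicArcs (by omega) (by omega)
  vec_neg i := by
    ext k
    rw [vecB, vecCyc_snake (by omega) (by omega) (by omega) (by omega)]
    simp only [Pi.neg_apply, Pi.single_apply, Fin.ext_iff, Nat.cast_inj]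
    split_ifs <;> rfl
  compat_neg i w hw := cyclicNoncrossing_snake (by omega) (by omega) hw
  nonneg_or u hu := by
    by_cases h : ∃ i : Fin l, u = (snakeL (i : ℕ), snakeR (i : ℕ))
    · exact Or.inr h
    · exact Or.inl fun i => vecCyc_nonneg hu (by omega) (by omega) fun h' => h ⟨i, h'⟩
  induction P hneg hrefl := by
    refine reflCyc_induction P (fun i hi hiN => ?_) hrefl
    have := hneg ⟨i.toNat, by omega⟩
    rwa [show ((i.toNat : ℕ) : ℤ) = i by omega] at this
  surj v hv h0 := by
    have key : ∀ p q a b : ℤ, 0 ≤ p → q ≤ l → p < q → (a = 1 ∨ a = -1) → (b = 1 ∨ b = -1) →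
        (∀ i : Fin l, v i = a * (if p ≤ (i : ℕ) then 1 else 0) +
          b * (if q ≤ (i : ℕ) then 1 else 0)) →
        ∃ u ∈ cyclicArcs (window (l + 1)) (l + 1), vecB l u = v := by
      intro p q a b hp hq hpq ha hb h
      have h1 := h0 ⟨p.toNat, by omega⟩
      rw [h] at h1
      dsimp only at h1
      rw [if_pos (by omega), if_neg (by omega)] at h1
      obtain rfl : a = 1 := by omega
      by_cases hql : q = l
      · refine ⟨_, diameter_mem hp (by omega), ?_⟩
        ext i
        rw [vecB, vecCyc_diameter hp (by omega) (by omega) (by omega), h, hql]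
        rw [if_neg (c := (l : ℤ) ≤ _) (by omega)]
        ring
      · rcases hb with rfl | rfl
        · refine ⟨_, arc_add_mem hp hpq (by omega), ?_⟩
          ext i
          rw [vecB, vecCyc_arc_add hp hpq (by omega) (by omega) (by omega), h, one_mul, one_mul]
        · refine ⟨_, arc_sub_mem hp hpq (by omega), ?_⟩
          ext i
          rw [vecB, vecCyc_arc_sub hp hpq (by omega) (by omega) (by omega), h]
          ring
    obtain ⟨p, q, a, b, hp, hp', hq, hq', hpq, ha, hb, h⟩ := isRoot_B hv
    rcases lt_or_gt_of_ne hpq with h1 | h1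
    · exact key p q a b hp hq' h1 ha hb h
    · exact key q p b a hq hp' h1 hb ha fun i => by rw [h, add_comm]

theorem natDegree_indepPoly_cyclicArcs_le {N : ℕ} (hN : 2 ≤ N) (L : ℤ) :
    (indepPoly (CyclicNoncrossing N) (cyclicArcs L N)).natDegree ≤ N - 1 := by
  rw [indepPoly_cyclicArcs hN]
  refine natDegree_sum_le_of_forall_le _ _ fun k hk => ?_
  rw [Finset.mem_Icc] at hk
  rw [← C_eq_natCast]
  refine (natDegree_C_mul_le _ _).trans (natDegree_mul_le.trans ?_)
  have h1 := natDegree_sidePoly_le k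
  have h2 := natDegree_basedPoly_le (N - k)
  omega

theorem eval_fB {l : ℕ} (hl : 1 ≤ l) (t : ℝ) : (fB l).eval t = symValue (-t) l := by
  rw [fB, (isArcModel_B l).eval_fPolynomial, indepPoly_cyclicArcs (by omega), symValue]
  · simp [eval_finsetSum]
  · rw [Fintype.card_fin]
    exact natDegree_indepPoly_cyclicArcs_le (by omega) _

end ModelB

/-! ### Type `D` -/

section TypeD

/-- The sum of `F` over the neighbours of the vertex `i` in the Dynkin diagram of type `D_l`. -/
def neighborSumD (l : ℕ) (F : ℤ → ℤ) (i : ℤ) : ℤ :=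
  if i + 3 < l then F (i - 1) + F (i + 1)
  else if i + 3 = l then F (i - 1) + (F (i + 1) + F (i + 2))
  else F (l - 3)

theorem neighborSumD_of_lt {l : ℕ} {i : ℤ} (hi : i + 3 < l) (F : ℤ → ℤ) :
    neighborSumD l F i = F (i - 1) + F (i + 1) := if_pos hi

theorem neighborSumD_of_eq {l : ℕ} {i : ℤ} (hi : i + 3 = l) (F : ℤ → ℤ) :
    neighborSumD l F i = F (i - 1) + (F (i + 1) + F (i + 2)) := by
  rw [neighborSumD, if_neg (by omega), if_pos hi]

theorem neighborSumD_of_gt {l : ℕ} {i : ℤ} (hi : (l : ℤ) < i + 3) (F : ℤ → ℤ) :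
    neighborSumD l F i = F (l - 3) := by
  rw [neighborSumD, if_neg (by omega), if_neg (by omega)]

theorem sum_erase_cartanD {l : ℕ} (hl : 3 ≤ l) (F : ℤ → ℤ) (h0 : F (-1) = 0) (i : Fin l) :
    ∑ j ∈ Finset.univ.erase i, CartanMatrix.D l j i * F (j : ℕ) =
      -neighborSumD l F (i : ℕ) := by
  have hi := i.2
  have e : ∀ j : Fin l, (if j = i then 0 else CartanMatrix.D l j i * F (j : ℕ)) =
      -((if ((j : ℕ) : ℤ) = (if (i : ℕ) + 1 = l then (l : ℤ) - 3 else (i : ℕ) - 1) then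
          F (j : ℕ) else 0) +
        ((if ((j : ℕ) : ℤ) = (i : ℕ) + 1 then (if (i : ℕ) + 2 < l then 1 else 0) * F (j : ℕ)
          else 0) +
        (if ((j : ℕ) : ℤ) = (i : ℕ) + 2 then (if (i : ℕ) + 3 = l then 1 else 0) * F (j : ℕ)
          else 0))) := by
    intro j
    simp only [CartanMatrix.D, Matrix.of_apply, Fin.ext_iff]
    split_ifs <;> omega
  have e1 : ∑ j ∈ Finset.univ.erase i, CartanMatrix.D l j i * F (j : ℕ) =
      ∑ j, (if j = i then 0 else CartanMatrix.D l j i * F (j : ℕ)) := by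
    rw [← Finset.add_sum_erase _ _ (Finset.mem_univ i), if_pos rfl, zero_add]
    exact Finset.sum_congr rfl fun j hj => (if_neg (Finset.ne_of_mem_erase hj)).symm
  rw [e1, Finset.sum_congr rfl fun j _ => e j, Finset.sum_neg_distrib, Finset.sum_add_distrib,
    Finset.sum_add_distrib, sum_fin_ite l _ F,
    sum_fin_ite l _ (fun m => (if (i : ℕ) + 2 < l then 1 else 0) * F m),
    sum_fin_ite l _ (fun m => (if (i : ℕ) + 3 = l then 1 else 0) * F m)]
  congr 1
  rw [neighborSumD]
  by_cases h : (i : ℕ) + 1 = l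
  · simp only [h, if_true]
    split_ifs <;> omega
  · rw [if_neg h]
    have h1 : (if 0 ≤ ((i : ℕ) : ℤ) - 1 ∧ ((i : ℕ) : ℤ) - 1 < l then F ((i : ℕ) - 1) else 0) =
        F ((i : ℕ) - 1) := by
      by_cases h : ((i : ℕ) : ℤ) = 0
      · rw [h, zero_sub, h0, ite_self]
      · rw [if_pos (by omega)]
    rw [h1]
    by_cases h2 : (i : ℕ) + 2 = l
    · rw [show (l : ℤ) - 3 = (i : ℕ) - 1 by omega]
      split_ifs <;> omega
    · split_ifs <;> omega

/-- Twice the coordinates of the `p`-th vector of the orthogonal basis in which the roots of type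
`D_l` are the vectors with two nonzero coordinates, both of them `± 1`. -/
def orthoD (l : ℕ) (p i : ℤ) : ℤ :=
  if i + 2 < l then (if p ≤ i then 2 else 0)
  else if i + 2 = l then (if p + 2 ≤ l then 1 else -1) else 1

theorem orthoD_of_lt {l : ℕ} {i : ℤ} (hi : i + 2 < l) (p : ℤ) :
    orthoD l p i = if p ≤ i then 2 else 0 := if_pos hi

theorem orthoD_of_eq {l : ℕ} {i : ℤ} (hi : i + 2 = l) (p : ℤ) :
    orthoD l p i = if p + 2 ≤ l then 1 else -1 := by
  rw [orthoD, if_neg (by omega), if_pos hi]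

theorem orthoD_of_gt {l : ℕ} {i : ℤ} (hi : (l : ℤ) < i + 2) (p : ℤ) : orthoD l p i = 1 := by
  rw [orthoD, if_neg (by omega), if_neg (by omega)]

theorem orthoD_swap {l : ℕ} {p j k : ℤ} (hp' : p < l) (hj' : j + 1 < l)
    (hk' : k < l) :
    orthoD l (if p = j then j + 1 else if p = j + 1 then j else p) k =
      if k = j then neighborSumD l (orthoD l p) j - orthoD l p j else orthoD l p k := by
  by_cases hk : k = j
  · rw [if_pos hk, hk]
    rcases (by omega : j + 3 < l ∨ j + 3 = l ∨ j + 2 = l) with h | h | h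
    · rw [neighborSumD_of_lt h]
      simp only [orthoD_of_lt (show j - 1 + 2 < (l : ℤ) by omega),
        orthoD_of_lt (show j + 1 + 2 < (l : ℤ) by omega),
        orthoD_of_lt (show j + 2 < (l : ℤ) by omega)]
      split_ifs <;> omega
    · rw [neighborSumD_of_eq h]
      simp only [orthoD_of_lt (show j - 1 + 2 < (l : ℤ) by omega),
        orthoD_of_eq (show j + 1 + 2 = (l : ℤ) by omega),
        orthoD_of_gt (show (l : ℤ) < j + 2 + 2 by omega),
        orthoD_of_lt (show j + 2 < (l : ℤ) by omega)]
      split_ifs <;> omega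
    · rw [neighborSumD_of_gt (by omega)]
      simp only [orthoD_of_lt (show (l : ℤ) - 3 + 2 < (l : ℤ) by omega), orthoD_of_eq h]
      split_ifs <;> omega
  · rw [if_neg hk]
    rcases (by omega : k + 2 < l ∨ k + 2 = l ∨ (l : ℤ) < k + 2) with h | h | h
    · simp only [orthoD_of_lt h]
      split_ifs <;> omega
    · simp only [orthoD_of_eq h]
      split_ifs <;> omega
    · simp only [orthoD_of_gt h]

theorem orthoD_swap_neg {l : ℕ} {p k : ℤ} (hp' : p < l) (hk' : k < l) :
    (if p + 3 ≤ l then 1 else -1) *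
      orthoD l (if p = (l : ℤ) - 1 then (l : ℤ) - 2 else if p = (l : ℤ) - 2 then (l : ℤ) - 1
        else p) k =
      if k = (l : ℤ) - 1 then neighborSumD l (orthoD l p) (l - 1) - orthoD l p (l - 1)
      else orthoD l p k := by
  have e : neighborSumD l (orthoD l p) (l - 1) = if p + 3 ≤ l then 2 else 0 := by
    rw [neighborSumD_of_gt (by omega), orthoD_of_lt (by omega)]
    split_ifs <;> omega
  rw [e, orthoD_of_gt (show (l : ℤ) < (l : ℤ) - 1 + 2 by omega)]
  rcases (by omega : k + 2 < l ∨ k + 2 = l ∨ (l : ℤ) < k + 2) with h | h | h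
  · simp only [orthoD_of_lt h]
    split_ifs <;> omega
  · simp only [orthoD_of_eq h]
    split_ifs <;> omega
  · simp only [orthoD_of_gt h]
    split_ifs <;> omega

theorem isRoot_D {l : ℕ} (hl : 3 ≤ l) {v : Fin l → ℤ} (hv : IsRoot (CartanMatrix.D l) v) :
    ∃ p q a b : ℤ, 0 ≤ p ∧ p < l ∧ 0 ≤ q ∧ q < l ∧ p ≠ q ∧ (a = 1 ∨ a = -1) ∧ (b = 1 ∨ b = -1) ∧
      ∀ i : Fin l, 2 * v i = a * orthoD l p (i : ℕ) + b * orthoD l q (i : ℕ) := by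
  induction hv with
  | simple j =>
    have hj := j.2
    by_cases hjl : (j : ℕ) + 1 = l
    · refine ⟨(l : ℤ) - 2, (l : ℤ) - 1, 1, 1, by omega, by omega, by omega, by omega, by omega,
        Or.inl rfl, Or.inl rfl, fun i => ?_⟩
      have hi := i.2
      simp only [Pi.single_apply, Fin.ext_iff, orthoD]
      split_ifs <;> omega
    · refine ⟨(j : ℕ), (j : ℕ) + 1, 1, -1, by omega, by omega, by omega, by omega, by omega,
        Or.inl rfl, Or.inr rfl, fun i => ?_⟩
      have hi := i.2
      simp only [Pi.single_apply, Fin.ext_iff, orthoD]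
      split_ifs <;> omega
  | reflect j v _ ih =>
    obtain ⟨p, q, a, b, hp, hp', hq, hq', hpq, ha, hb, h⟩ := ih
    have hj := j.2
    -- the effect of the reflection on twice the coordinates
    set G : ℤ → ℤ := fun i => a * orthoD l p i + b * orthoD l q i with hG
    have hG0 : G (-1) = 0 := by
      have e : ∀ p, 0 ≤ p → orthoD l p (-1) = 0 := by
        intro p hp
        simp only [orthoD]
        split_ifs <;> omega
      simp only [hG, e p hp, e q hq, mul_zero, add_zero]
    have h1 : ∑ i ∈ Finset.univ.erase j, CartanMatrix.D l i j * G (i : ℕ) =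
        -neighborSumD l G (j : ℕ) := by
      rw [sum_erase_cartanD hl G hG0 j]
    have h2 : ∀ k, 2 * simpleReflection (CartanMatrix.D l) j v k =
        if k = j then neighborSumD l G (j : ℕ) - G (j : ℕ) else G (k : ℕ) := by
      intro k
      rw [simpleReflection_apply (CartanMatrix.D_diag l)]
      split_ifs with hk
      · have : ∑ i ∈ Finset.univ.erase j, CartanMatrix.D l i j * G (i : ℕ) =
            2 * ∑ i ∈ Finset.univ.erase j, CartanMatrix.D l i j * v i := by
          rw [Finset.mul_sum]
          refine Finset.sum_congr rfl fun i _ => ?_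
          rw [show G (i : ℕ) = 2 * v i from (h i).symm]
          ring
        have h3 := h j
        change 2 * v j = G (j : ℕ) at h3
        linarith
      · exact h k
    have hfin : ∀ p' q' ε δ : ℤ, (∀ k : Fin l, ε * orthoD l p' (k : ℕ) = if k = j then
        neighborSumD l (orthoD l p) (j : ℕ) - orthoD l p (j : ℕ) else orthoD l p (k : ℕ)) →
        (∀ k : Fin l, δ * orthoD l q' (k : ℕ) = if k = j then
        neighborSumD l (orthoD l q) (j : ℕ) - orthoD l q (j : ℕ) else orthoD l q (k : ℕ)) →
        ∀ k, 2 * simpleReflection (CartanMatrix.D l) j v k =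
          a * ε * orthoD l p' (k : ℕ) + b * δ * orthoD l q' (k : ℕ) := by
      intro p' q' ε δ hp hq k
      rw [mul_assoc, hp, mul_assoc, hq, h2]
      split_ifs with hk
      · simp only [hG, neighborSumD]
        split_ifs <;> ring
      · rfl
    have hkj : ∀ k : Fin l, ((k : ℕ) : ℤ) = (j : ℕ) ↔ k = j := fun k => by
      rw [Nat.cast_inj, Fin.ext_iff]
    by_cases hjl : (j : ℕ) + 1 = l
    · have aux := fun (p : ℤ) (h' : p < l) (k : Fin l) =>
        orthoD_swap_neg h' (k := (k : ℕ)) (by omega)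
      have hjl' : (l : ℤ) - 1 = (j : ℕ) := by omega
      simp only [hjl', hkj] at aux
      refine ⟨_, _, _, _, ?_, ?_, ?_, ?_, ?_, ?_, ?_, hfin _ _ _ _ (aux p hp') (aux q hq')⟩
        <;> split_ifs <;> omega
    · have aux := fun (p : ℤ) (h' : p < l) (k : Fin l) =>
        (one_mul _).trans (orthoD_swap h' (j := (j : ℕ)) (k := (k : ℕ)) (by omega) (by omega))
      simp only [hkj] at aux
      refine ⟨_, _, _, _, ?_, ?_, ?_, ?_, ?_, ?_, ?_, hfin _ _ _ _ (aux p hp') (aux q hq')⟩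
        <;> (try split_ifs) <;> omega

end TypeD

section ModelD

/-- The two coordinates of the end vertices of the fork, selected by `c`, of the almost positive
root of type `D` of a tagged arc. -/
def forkCoord (N : ℕ) (u : (ℤ × ℤ) × Bool) (c : Bool) : ℤ :=
  if u.1.2 < u.1.1 + N then (if window N + N < u.1.2 then 1 else 0)
  else if u.1.1 = window N then (if c = u.2 then -1 else 0)
  else if c = u.2 then 0 else 1

/-- The reflections of the tagged arcs. The tag of a radius changes under the reflection that
belongs to the sign of the two end vertices of the fork. -/
def reflD (N : ℕ) (s : Bool) (u : (ℤ × ℤ) × Bool) : (ℤ × ℤ) × Bool :=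
  (reflCyc N s u.1,
    if u.1.2 = u.1.1 + N ∧ decide ((N : ℤ) % 2 = 0) = s then !u.2 else u.2)

/-- The almost positive root of type `D_l` of a tagged arc. -/
def vecD (l : ℕ) (u : (ℤ × ℤ) × Bool) (i : Fin l) : ℤ :=
  if (i : ℕ) + 2 < l then vecCyc l u.1 (i : ℕ) else forkCoord l u (decide ((i : ℕ) + 1 = l))

theorem mem_taggedArcs_iff {N : ℕ} {L : ℤ} {u : (ℤ × ℤ) × Bool} : u ∈ taggedArcs L N ↔
    u.1 ∈ cyclicArcs L N ∧ (u.1.2 < u.1.1 + N → u.2 = false) := by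
  rw [mem_taggedArcs, mem_cyclicArcs]
  tauto

theorem reflCyc_length {N : ℕ} (s : Bool) (u : ℤ × ℤ) :
    (reflCyc N s u).2 - (reflCyc N s u).1 = u.2 - u.1 := by
  simp only [reflCyc]
  split_ifs <;> simp only <;> ring

theorem reflD_snd (N : ℕ) (s : Bool) (u : (ℤ × ℤ) × Bool) : (reflD N s u).2 =
    if u.1.2 = u.1.1 + N ∧ decide ((N : ℤ) % 2 = 0) = s then !u.2 else u.2 := rfl

theorem reflD_mem {N : ℕ} (s : Bool) {u : (ℤ × ℤ) × Bool} (hu : u ∈ taggedArcs (window N) N) :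
    reflD N s u ∈ taggedArcs (window N) N := by
  rw [mem_taggedArcs_iff] at *
  have h := reflCyc_length (N := N) s u.1
  refine ⟨reflCyc_mem s hu.1, fun h1 => ?_⟩
  simp only [reflD] at *
  rw [if_neg (by omega), hu.2 (by omega)]

theorem reflD_reflD {N : ℕ} (s : Bool) {u : (ℤ × ℤ) × Bool}
    (hu : u ∈ taggedArcs (window N) N) : reflD N s (reflD N s u) = u := by
  rw [mem_taggedArcs_iff] at hu
  have h := reflCyc_length (N := N) s u.1
  refine Prod.ext (reflCyc_reflCyc s hu.1) ?_
  have h2 : (reflD N s u).1 = reflCyc N s u.1 := rfl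
  rw [reflD_snd, reflD_snd, h2]
  by_cases h1 : u.1.2 = u.1.1 + N ∧ decide ((N : ℤ) % 2 = 0) = s
  · rw [if_pos h1, if_pos ⟨by omega, h1.2⟩, Bool.not_not]
  · rw [if_neg h1, if_neg fun h2 => h1 ⟨by omega, h2.2⟩]

theorem taggedCompat_refl {N : ℕ} (s : Bool) {u w : (ℤ × ℤ) × Bool}
    (hu : u ∈ taggedArcs (window N) N) (hw : w ∈ taggedArcs (window N) N)
    (h : TaggedCompat N u w) : TaggedCompat N (reflD N s u) (reflD N s w) := by
  rcases h with h | ⟨h1, h2, h3⟩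
  · exact Or.inl (cyclicNoncrossing_refl s (mem_taggedArcs_iff.1 hu).1
      (mem_taggedArcs_iff.1 hw).1 h)
  · have e1 := reflCyc_length (N := N) s u.1
    have e2 := reflCyc_length (N := N) s w.1
    refine Or.inr ⟨by simp only [reflD]; omega, by simp only [reflD]; omega, ?_⟩
    simp only [reflD, h1, h2, h3]

theorem two_mul_forkCoord {N : ℕ} {u : (ℤ × ℤ) × Bool} (hu : u.1 ∈ cyclicArcs (window N) N)
    (h : u.1.2 < u.1.1 + N) (c : Bool) : 2 * forkCoord N u c = vecCyc N u.1 (N - 2) := by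
  rw [vecCyc_last hu, if_pos h, forkCoord, if_pos h]
  split_ifs <;> rfl

theorem forkCoord_radius (N : ℕ) (a : ℤ) (c d : Bool) : forkCoord N ((a, a + N), d) c =
    if a = window N then (if c = d then -1 else 0) else if c = d then 0 else 1 := by
  rw [forkCoord, if_neg (lt_irrefl _)]

theorem reflCyc_radius (N : ℕ) (s : Bool) (a : ℤ) : reflCyc N s (a, a + N) =
    ((if shift s - a < window N + N then shift s - a else shift s - a - N),
      (if shift s - a < window N + N then shift s - a else shift s - a - N) + N) := by
  rw [reflCyc]
  dsimp only
  by_cases h : shift s - a < window N + N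
  · rw [if_pos (by omega), if_pos h, sub_add_eq_sub_sub, sub_add_cancel]
  · rw [if_neg (by omega), if_neg h, sub_add_eq_sub_sub, sub_add_cancel]

theorem forkCoord_reflD {N : ℕ} (hN : 2 ≤ N) (s : Bool) {u : (ℤ × ℤ) × Bool}
    (hu : u ∈ taggedArcs (window N) N) (c : Bool) :
    forkCoord N (reflD N s u) c = if decide ((N : ℤ) % 2 = 0) = s then
      -forkCoord N u c + max (vecCyc N u.1 (N - 3)) 0 else forkCoord N u c := by
  obtain ⟨⟨a, b⟩, d⟩ := u
  have hu1 := (mem_taggedArcs_iff.1 hu).1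
  have hu2 := mem_cyclicArcs.1 hu1
  by_cases h : b < a + N
  · have h1 := reflCyc_length (N := N) s (a, b)
    have e1 := two_mul_forkCoord (u := ((a, b), d)) hu1 h c
    have e2 := two_mul_forkCoord (u := reflD N s ((a, b), d)) (reflCyc_mem s hu1)
      (by simp only [reflD]; omega) c
    rw [show (reflD N s ((a, b), d)).1 = reflCyc N s (a, b) from rfl,
      vecCyc_reflCyc_last hN s hu1] at e2
    dsimp only at e1 e2 ⊢
    split_ifs at e2 ⊢ <;> linarith
  · obtain rfl : b = a + N := by simp only at hu2; omega
    have hflip : (c = (!d)) ↔ ¬ c = d := by cases c <;> cases d <;> decide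
    rw [reflD, reflCyc_radius, forkCoord_radius, forkCoord_radius]
    simp only [decide_emod_two_eq, true_and]
    rcases Int.emod_two_eq_zero_or_one N with h | h
    · rw [max_vecCyc_even h hu1, h]
      simp only [lt_irrefl, if_false]
      rcases shift_eq s with ⟨rfl, hs⟩ | ⟨rfl, hs⟩
      · simp only [eq_true (show (0 : ℤ) = 1 - shift true by omega), if_true, hflip]
        simp only [window, hs] at *
        split_ifs <;> omega
      · simp only [(show ¬ (0 : ℤ) = 1 - shift false by omega), if_false]
        simp only [window, hs] at *
        split_ifs <;> omega
    · rw [max_vecCyc_odd h hu1, h]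
      simp only [lt_irrefl, if_false]
      rcases shift_eq s with ⟨rfl, hs⟩ | ⟨rfl, hs⟩
      · simp only [(show ¬ (1 : ℤ) = 1 - shift true by omega), if_false]
        simp only [window, hs] at *
        split_ifs <;> omega
      · simp only [eq_true (show (1 : ℤ) = 1 - shift false by omega), if_true, hflip]
        simp only [window, hs] at *
        split_ifs <;> omega

/-- The two end vertices of the fork together contribute like the last vertex of type `B`. -/
theorem max_forkCoord {N : ℕ} {u : (ℤ × ℤ) × Bool} (hu : u ∈ taggedArcs (window N) N) :
    max (forkCoord N u false) 0 + max (forkCoord N u true) 0 = max (vecCyc N u.1 (N - 2)) 0 := by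
  rw [vecCyc_last (mem_taggedArcs_iff.1 hu).1]
  obtain ⟨⟨a, b⟩, d⟩ := u
  simp only [forkCoord]
  cases d <;> simp only [if_true, Bool.false_eq_true, Bool.true_eq_false, if_false] <;>
  split_ifs <;> rfl

theorem vecD_refl {l : ℕ} (hl : 4 ≤ l) (s : Bool) {u : (ℤ × ℤ) × Bool}
    (hu : u ∈ taggedArcs (window l) l) :
    vecD l (reflD l s u) = tau (CartanMatrix.D l) (forkSign l) s (vecD l u) := by
  have hu1 := (mem_taggedArcs_iff.1 hu).1
  have hneg := vecCyc_neg_one (mem_cyclicArcs_window.1 hu1).2.2.1 (N := l)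
  set F : ℤ → ℤ := fun i => if i + 2 < l then max (vecCyc l u.1 i) 0
    else max (forkCoord l u (decide (i + 1 = l))) 0 with hF
  have hFv : ∀ j : Fin l, max (vecD l u j) 0 = F (j : ℕ) := by
    intro j
    have e : (((j : ℕ) : ℤ) + 1 = l) ↔ (j : ℕ) + 1 = l := by omega
    have e' : (((j : ℕ) : ℤ) + 2 < l) ↔ (j : ℕ) + 2 < l := by omega
    simp only [hF, vecD, e, e']
    split_ifs <;> rfl
  have hFlt : ∀ i : ℤ, i + 2 < l → F i = max (vecCyc l u.1 i) 0 := fun i hi => if_pos hi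
  have hlast : F (l - 2) + F (l - 1) = max (vecCyc l u.1 (l - 2)) 0 := by
    rw [← max_forkCoord hu]
    simp only [hF]
    rw [if_neg (by omega), if_neg (by omega), decide_eq_false (by omega), decide_eq_true (by omega)]
  ext i
  have hi := i.2
  rw [tau, Finset.sum_congr rfl fun j _ => by rw [hFv j],
    sum_erase_cartanD (by omega) F (by rw [hFlt _ (by omega), hneg]), sub_neg_eq_add]
  by_cases h : (i : ℕ) + 2 < l
  · have e : (decide (((i : ℕ) : ℤ) % 2 = 0) = s) ↔ forkSign l i = s := by
      rw [forkSign]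
      have : ((i : ℕ) : ℤ) % 2 = 0 ↔ min (i : ℕ) (l - 2) % 2 = 0 := by omega
      simp only [this]
    have e1 : neighborSumD l F (i : ℕ) = max (vecCyc l u.1 ((i : ℕ) - 1)) 0 +
        max (vecCyc l u.1 ((i : ℕ) + 1)) 0 := by
      by_cases h3 : (i : ℕ) + 3 < l
      · rw [neighborSumD_of_lt (by omega), hFlt _ (by omega), hFlt _ (by omega)]
      · rw [neighborSumD_of_eq (by omega), hFlt _ (by omega),
          show ((i : ℕ) : ℤ) + 2 = l - 1 by omega, show ((i : ℕ) : ℤ) + 1 = l - 2 by omega, hlast]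
    rw [e1]
    simp only [vecD, if_pos h]
    rw [show (reflD l s u).1 = reflCyc l s u.1 from rfl, vecCyc_reflCyc s hu1 (by omega) (by omega)]
    simp only [e]
  · have e : (decide ((l : ℤ) % 2 = 0) = s) ↔ forkSign l i = s := by
      rw [forkSign]
      have : (l : ℤ) % 2 = 0 ↔ min (i : ℕ) (l - 2) % 2 = 0 := by omega
      simp only [this]
    rw [neighborSumD_of_gt (by omega), hFlt _ (by omega)]
    simp only [vecD, if_neg h]
    rw [forkCoord_reflD (by omega) s hu]
    simp only [e]

theorem taggedCompat_radius {N : ℕ} (hN : 2 ≤ N) (c : Bool) {w : (ℤ × ℤ) × Bool}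
    (hw : w ∈ taggedArcs (window N) N) :
    TaggedCompat N ((window N, window N + N), c) w ↔ forkCoord N w c ≤ 0 := by
  rw [mem_taggedArcs_iff] at hw
  obtain ⟨⟨a, b⟩, d⟩ := w
  replace hw := mem_cyclicArcs.1 hw.1
  simp only [TaggedCompat, CyclicNoncrossing, Noncrossing, forkCoord, true_and] at *
  by_cases hcd : c = d
  · simp only [hcd, if_true, and_true]
    split_ifs <;> omega
  · simp only [hcd, if_false, and_false, or_false]
    split_ifs <;> omega

theorem snakeL_last (N : ℕ) : snakeL (N - 2) = window N := by
  simp only [snakeL, window]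
  omega

theorem snakeR_last (N : ℕ) : snakeR (N - 2) = window N + N := by
  simp only [snakeR, window]
  omega

/-- The tagged arc of a negative simple root of type `D_l`. -/
def negD (l : ℕ) (i : Fin l) : (ℤ × ℤ) × Bool :=
  if (i : ℕ) + 2 < l then ((snakeL (i : ℕ), snakeR (i : ℕ)), false)
  else ((window l, window l + l), decide ((i : ℕ) + 1 = l))

/-- The tagged arcs of a polygon with `l` vertices and a puncture form a model of the cluster
complex of type `D_l`. -/
theorem isArcModel_D {l : ℕ} (hl : 4 ≤ l) : IsArcModel (CartanMatrix.D l) (forkSign l)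
    (taggedArcs (window l) l) (vecD l) (reflD l) (TaggedCompat l) (negD l) where
  diag i := CartanMatrix.D_diag l i
  bipartite i j hij h := by
    simp only [forkSign, decide_eq_decide] at h
    simp only [CartanMatrix.D, Matrix.of_apply]
    have := i.2
    have := j.2
    rw [if_neg hij, if_neg (by omega), if_neg (by omega), if_neg (by omega), if_neg (by omega),
      if_neg (by omega)]
  refl_mem s u hu := reflD_mem s hu
  refl_refl s u hu := reflD_reflD s hu
  vec_refl s u hu := vecD_refl hl s hu
  compat_refl s u hu w hw h := taggedCompat_refl s hu hw h
  neg_mem i := by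
    rw [negD, mem_taggedArcs_iff]
    split_ifs with h
    · exact ⟨snake_mem_cyclicArcs (by omega) (by omega), fun _ => rfl⟩
    · refine ⟨?_, fun h => absurd h (lt_irrefl _)⟩
      rw [mem_cyclicArcs]
      dsimp only
      omega
  vec_neg i := by
    ext k
    have hi := i.2
    have hk := k.2
    simp only [Pi.neg_apply, Pi.single_apply, Fin.ext_iff, vecD, negD]
    by_cases h : (i : ℕ) + 2 < l
    · simp only [if_pos h]
      split_ifs with h1 h2 h2
      · rw [vecCyc_snake (by omega) (by omega) (by omega) (by omega), if_pos (by omega)]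
      · rw [vecCyc_snake (by omega) (by omega) (by omega) (by omega), if_neg (by omega)]; rfl
      · omega
      · rw [forkCoord, if_pos (by simp only [snakeL, snakeR]; omega),
          if_neg (by simp only [snakeR, window]; omega)]; rfl
    · simp only [if_neg h]
      split_ifs with h1 h2 h2
      · omega
      · rw [← snakeR_last, ← snakeL_last,
          vecCyc_snake (by omega) (by omega) (by omega) (by omega), if_neg (by omega)]; rfl
      · simp [forkCoord, h2]
      · have : ¬ (k : ℕ) + 1 = l ↔ (i : ℕ) + 1 = l := by omega
        simp only [forkCoord, lt_irrefl, if_false, if_true, decide_eq_decide]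
        rw [if_neg (by omega)]; rfl
  compat_neg i w hw := by
    rw [negD, vecD]
    split_ifs with h
    · rw [← cyclicNoncrossing_snake (by omega) (by omega) (mem_taggedArcs_iff.1 hw).1, TaggedCompat]
      simp only [snakeL, snakeR]
      rw [or_iff_left]
      omega
    · exact taggedCompat_radius (by omega) _ hw
  nonneg_or u hu := by
    by_cases h : ∃ i : Fin l, u = negD l i
    · exact Or.inr h
    · refine Or.inl fun i => ?_
      have hu' := mem_taggedArcs_iff.1 hu
      have hi := i.2
      have h1 : u ≠ negD l i := fun h' => h ⟨i, h'⟩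
      rw [negD] at h1
      rw [vecD]
      split_ifs at h1 ⊢ with h2
      · refine vecCyc_nonneg hu'.1 (by omega) (by omega) fun h3 => h1 (Prod.ext h3 (hu'.2 ?_))
        rw [h3]
        simp only [snakeL, snakeR]
        omega
      · have hmem := mem_cyclicArcs.1 hu'.1
        rw [forkCoord]
        split_ifs with h3 h4 h5 h6
        · exact zero_le_one
        · exact le_rfl
        · exact absurd (Prod.ext (Prod.ext h5 (by dsimp only; omega)) h6.symm) h1
        · exact le_rfl
        · exact le_rfl
        · exact zero_le_one
  induction P hneg hrefl := by
    have key := reflCyc_induction (N := l)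
      (fun u => ∀ c, (u, c) ∈ taggedArcs (window l) l → P (u, c)) ?_ ?_
    · exact fun u hu => key u.1 (mem_taggedArcs_iff.1 hu).1 u.2 hu
    · intro i hi hiN c hc
      by_cases h : i + 2 = l
      · obtain rfl : i = l - 2 := by omega
        rw [snakeL_last, snakeR_last]
        cases c
        · have := hneg ⟨l - 2, by omega⟩
          rw [negD] at this
          dsimp only at this
          rwa [if_neg (by omega), decide_eq_false (by omega)] at this
        · have := hneg ⟨l - 1, by omega⟩
          rw [negD] at this
          dsimp only at this
          rwa [if_neg (by omega), decide_eq_true (by omega)] at this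
      · have := hneg ⟨i.toNat, by omega⟩
        rw [negD] at this
        dsimp only at this
        rw [if_pos (by omega), show ((i.toNat : ℕ) : ℤ) = i by omega] at this
        have hc' := (mem_taggedArcs_iff.1 hc).2
        simp only [snakeL, snakeR] at hc'
        rwa [hc' (by omega)]
    · intro s u hu ih c hc
      have h1 := reflD_mem s hc
      have h2 := reflD_reflD s hc
      have e : (reflD l s (reflCyc l s u, c)).1 = u := reflCyc_reflCyc s hu
      have h3 := ih (reflD l s (reflCyc l s u, c)).2
      rw [show (u, (reflD l s (reflCyc l s u, c)).2) = reflD l s (reflCyc l s u, c) from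
        Prod.ext e.symm rfl] at h3
      have h4 := hrefl s _ h1 (h3 h1)
      rwa [h2] at h4
  surj v hv h0 := by
    have key : ∀ p q a b : ℤ, 0 ≤ p → q < l → p < q → (a = 1 ∨ a = -1) → (b = 1 ∨ b = -1) →
        (∀ i : Fin l, 2 * v i = a * orthoD l p (i : ℕ) + b * orthoD l q (i : ℕ)) →
        ∃ u ∈ taggedArcs (window l) l, vecD l u = v := by
      intro p q a b hp hq hpq ha hb h
      have h1 := h0 ⟨p.toNat, by omega⟩
      have h2 := h ⟨p.toNat, by omega⟩
      have h3 := h0 ⟨l - 1, by omega⟩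
      have h4 := h ⟨l - 1, by omega⟩
      have ep : ((p.toNat : ℕ) : ℤ) = p := by omega
      have el : ((l - 1 : ℕ) : ℤ) = l - 1 := by omega
      simp only [ep, el] at h1 h2 h3 h4
      -- for `a = -1` the coordinate of index `p` or the last one would be negative
      obtain rfl : a = 1 := by
        rcases ha with rfl | rfl
        · rfl
        · simp only [orthoD] at h2 h4
          rcases hb with rfl | rfl <;> split_ifs at h2 h4 <;> omega
      clear h1 h2 h3 h4
      by_cases hql : q + 1 = l
      · refine ⟨((snakeVertex p, snakeVertex p + l), decide (b = -1)), ?_, ?_⟩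
        · exact mem_taggedArcs_iff.2 ⟨diameter_mem hp (by omega), fun h => absurd h (lt_irrefl _)⟩
        · ext i
          have hi := h i
          have hil := i.2
          rw [vecD]
          split_ifs with h1
          · dsimp only
            rw [vecCyc_diameter hp (by omega) (by omega) (by omega)]
            rw [orthoD_of_lt (by omega), orthoD_of_lt (by omega)] at hi
            split_ifs at hi ⊢ <;> omega
          · have hne : snakeVertex p ≠ window l := by
              simp only [snakeVertex, window]
              split_ifs <;> omega
            simp only [forkCoord, lt_irrefl, if_false, hne, decide_eq_decide]
            by_cases h2 : (i : ℕ) + 1 = l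
            · rw [orthoD_of_gt (by omega), orthoD_of_gt (by omega)] at hi
              split_ifs <;> omega
            · rw [orthoD_of_eq (by omega), orthoD_of_eq (by omega), if_pos (by omega),
                if_neg (by omega)] at hi
              split_ifs <;> omega
      · rcases hb with rfl | rfl
        · refine ⟨((_, _), false), mem_taggedArcs_iff.2 ⟨arc_add_mem hp hpq (by omega),
            fun _ => rfl⟩, ?_⟩
          ext i
          have hi := h i
          have hil := i.2
          rw [vecD]
          split_ifs with h1
          · rw [vecCyc_arc_add hp hpq (by omega) (by omega) (by omega)]
            rw [orthoD_of_lt (by omega), orthoD_of_lt (by omega)] at hi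
            split_ifs at hi ⊢ <;> omega
          · have h2 : v i = 1 := by
              simp only [orthoD] at hi
              split_ifs at hi <;> omega
            rw [h2, forkCoord, if_pos, if_pos]
            · simp only [snakeVertex, window]
              split_ifs <;> omega
            · simp only [snakeVertex]
              split_ifs <;> omega
        · refine ⟨((_, _), false), mem_taggedArcs_iff.2 ⟨arc_sub_mem hp hpq (by omega),
            fun _ => rfl⟩, ?_⟩
          ext i
          have hi := h i
          have hil := i.2
          rw [vecD]
          split_ifs with h1
          · rw [vecCyc_arc_sub hp hpq (by omega) (by omega) (by omega)]
            rw [orthoD_of_lt (by omega), orthoD_of_lt (by omega)] at hi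
            split_ifs at hi ⊢ <;> omega
          · have h2 : v i = 0 := by
              simp only [orthoD] at hi
              split_ifs at hi <;> omega
            rw [h2, forkCoord, if_pos, if_neg]
            · simp only [snakeVertex, window]
              split_ifs <;> omega
            · simp only [snakeVertex]
              split_ifs <;> omega
    obtain ⟨p, q, a, b, hp, hp', hq, hq', hpq, ha, hb, h⟩ := isRoot_D (by omega) hv
    rcases lt_or_gt_of_ne hpq with h1 | h1
    · exact key p q a b hp hq' h1 ha hb h
    · exact key q p b a hq hp' h1 hb ha fun i => by rw [h, add_comm]

theorem natDegree_indepPoly_taggedArcs_le {N : ℕ} (hN : 2 ≤ N) (L : ℤ) :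
    (indepPoly (TaggedCompat N) (taggedArcs L N)).natDegree ≤ N := by
  have hX : (1 + X : ℝ[X]).natDegree ≤ 1 := by compute_degree
  have hN' := natDegree_dissPoly_le N
  rw [indepPoly_taggedArcs hN, indepPoly_cyclicArcs_radial hN, indepPoly_shortArcs hN]
  refine natDegree_add_le_of_degree_le ((natDegree_sub_le _ _).trans (max_le ?_ ?_)) ?_
  · refine (natDegree_C_mul_le 2 _).trans (natDegree_sum_le_of_forall_le _ _ fun k hk => ?_)
    rw [Finset.mem_Ico] at hk
    rw [← C_eq_natCast]
    refine (natDegree_C_mul_le _ _).trans (natDegree_mul_le.trans ?_)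
    have h1 := natDegree_sidePoly_le k
    have h2 := natDegree_basedPoly_le (N - k + 1)
    have h3 := natDegree_mul_le (p := (1 + X : ℝ[X])) (q := basedPoly (N - k + 1))
    omega
  · refine natDegree_sum_le_of_forall_le _ _ fun k hk => ?_
    rw [Finset.mem_Ico] at hk
    rw [← C_eq_natCast]
    refine (natDegree_C_mul_le _ _).trans (natDegree_mul_le.trans ?_)
    have h1 := natDegree_sidePoly_le k
    have h2 := natDegree_basedPoly_le (N - k)
    omega
  · rw [← C_eq_natCast]
    refine (natDegree_C_mul_le _ _).trans (natDegree_mul_le.trans ?_)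
    rw [natDegree_X_pow]
    omega

theorem eval_fD {l : ℕ} (hl : 4 ≤ l) (t : ℝ) :
    (fD l).eval t = (indepPoly (TaggedCompat l) (taggedArcs (window l) l)).eval (-t) := by
  rw [fD, (isArcModel_D hl).eval_fPolynomial]
  rw [Fintype.card_fin]
  exact natDegree_indepPoly_taggedArcs_le (by omega) _

end ModelD

/-! ### The smallest roots -/

section Roots

theorem eval_fPolynomial_pos {ι : Type*} [Fintype ι] [DecidableEq ι] (A : Matrix ι ι ℤ)
    (ε : ι → Bool) {t : ℝ} (ht : t ≤ 0) : 0 < (fPolynomial A ε).eval t := by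
  rw [fPolynomial, eval_finsetSum, Finset.sum_range_succ']
  refine add_pos_of_nonneg_of_pos (Finset.sum_nonneg fun i _ => ?_) (by simp [faceNumber])
  simp only [eval_mul, eval_natCast, eval_pow, eval_neg, eval_X]
  have := neg_nonneg.2 ht
  positivity

theorem dissPoly_two : dissPoly 2 = 1 := by
  rw [dissPoly_eq le_rfl]
  simp [sidePoly, basedPoly_one]

theorem dissPoly_three : dissPoly 3 = 1 + 2 * X := by
  rw [dissPoly_eq (by norm_num)]
  simp [Finset.sum_Ico_succ_top, sidePoly, basedPoly_one, basedPoly_eq, dissPoly_two]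
  ring

theorem symValue_zero (y : ℝ) : symValue y 0 = 1 := by
  simp [symValue, sidePoly, basedPoly_zero]

theorem symValue_one (y : ℝ) : symValue y 1 = 1 + 2 * y := by
  simp [symValue, Finset.sum_Icc_succ_top, sidePoly, basedPoly_zero, basedPoly_one, dissPoly_two]

theorem least_roots_fA : ∃ r : ℕ → ℝ, (∀ l : ℕ, 1 ≤ l → IsLeast {t : ℝ | (fA l).IsRoot t} (r l)) ∧
    StrictAntiOn r (Set.Ici 1) ∧ Tendsto r atTop (𝓝 0) := by
  obtain ⟨r, h1, h2, h3, -⟩ := least_roots_of_three_term (p := fA)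
    (a := fun l => (l : ℝ) + 4) (c := fun l => (l : ℝ) + 1)
    (fun t => by rw [eval_fA, dissPoly_two, eval_one])
    (fun t => by rw [eval_fA, dissPoly_three]; simp; ring)
    (fun l t ht => eval_fPolynomial_pos _ _ ht) (fun l => by positivity) (fun l => by positivity)
    (fun l t ht ht' => by
      have h := dissPoly_three_term (y := -t) (by linarith) (by linarith) l
      rw [eval_fA, eval_fA, eval_fA]
      simp only [add_assoc, Nat.reduceAdd] at h ⊢
      linarith)
    (fun l => by nlinarith)
  exact ⟨r, h1, h2, h3⟩

/-- The `f`-polynomials of type `B`, with `1` in place of the one of rank `0`. -/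
noncomputable def fB' (l : ℕ) : ℝ[X] := if l = 0 then 1 else fB l

theorem fB'_of_pos {l : ℕ} (hl : 1 ≤ l) : fB' l = fB l := if_neg (by omega)

theorem eval_fB' (l : ℕ) (t : ℝ) : (fB' l).eval t = symValue (-t) l := by
  rcases Nat.eq_zero_or_pos l with rfl | h
  · rw [fB', if_pos rfl, eval_one, symValue_zero]
  · rw [fB'_of_pos h, eval_fB h]

theorem least_roots_fB' : ∃ r : ℕ → ℝ,
    (∀ l, 1 ≤ l → IsLeast {t : ℝ | (fB' l).IsRoot t} (r l)) ∧
      StrictAntiOn r (Set.Ici 1) ∧ Tendsto r atTop (𝓝 0) ∧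
      (∀ l, 1 ≤ l → 0 < r l ∧ r l ≤ 1 / 2) ∧ (∀ l, 1 ≤ l → ∀ t < r l, 0 < (fB' l).eval t) ∧
      (∀ l, 1 ≤ l → (fB' (l + 1)).eval (r l) < 0) := by
  refine least_roots_of_three_term (a := fun l => (l : ℝ) + 2) (c := fun l => (l : ℝ) + 1)
    (fun t => by rw [eval_fB', symValue_zero])
    (fun t => by rw [eval_fB', symValue_one]; ring)
    (fun l t ht => ?_) (fun l => by positivity) (fun l => by positivity)
    (fun l t ht ht' => ?_) (fun l => by nlinarith)
  · rw [fB']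
    split_ifs
    · simp
    · exact eval_fPolynomial_pos _ _ ht
  · have h := symValue_rec (y := -t) (by linarith) l
    rw [eval_fB', eval_fB', eval_fB']
    linarith

theorem least_roots_fB : ∃ r : ℕ → ℝ, (∀ l : ℕ, 1 ≤ l → IsLeast {t : ℝ | (fB l).IsRoot t} (r l)) ∧
    StrictAntiOn r (Set.Ici 1) ∧ Tendsto r atTop (𝓝 0) := by
  obtain ⟨r, h1, h2, h3, -⟩ := least_roots_fB'
  exact ⟨r, fun l hl => fB'_of_pos hl ▸ h1 l hl, h2, h3⟩

theorem least_roots_fD : ∃ r : ℕ → ℝ, (∀ l : ℕ, 4 ≤ l → IsLeast {t : ℝ | (fD l).IsRoot t} (r l)) ∧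
    StrictAntiOn r (Set.Ici 4) ∧ Tendsto r atTop (𝓝 0) := by
  obtain ⟨r, h1, h2, h3, h4, h5, h6⟩ := least_roots_fB'
  have hcast : ∀ l : ℕ, 4 ≤ l → (4 : ℝ) ≤ l := fun l hl => by exact_mod_cast hl
  refine least_roots_of_interlacing (by norm_num)
    (a := fun l => ((l : ℝ) - 2) / (2 * (l - 1))) (c := fun l => (l : ℝ) / (2 * (l - 1)))
    (fun l hl => ?_) (fun l hl => ?_) (fun l hl t ht ht' => ?_)
    (fun l _ t ht => eval_fPolynomial_pos _ _ ht) h1 h2 h3 h4 h5 h6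
  · have := hcast l hl
    exact div_pos (by linarith) (by linarith)
  · have := hcast l hl
    exact div_pos (by linarith) (by linarith)
  · obtain ⟨n, rfl⟩ : ∃ n, l = n + 2 := ⟨l - 2, by omega⟩
    have h := taggedArcs_eval (y := -t) (by linarith) (window (n + 2)) n
    rw [eval_fD hl, eval_fB', eval_fB', show n + 2 - 1 = n + 1 by omega]
    push_cast
    rw [show (n : ℝ) + 2 - 1 = n + 1 by ring, div_mul_eq_mul_div, div_mul_eq_mul_div,
      div_mul_eq_mul_div, ← add_div, eq_div_iff (by positivity)]
    linarith

end Roots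

end ClusterComplex

theorem theorem6p1 :
    (∃ r : ℕ → ℝ, (∀ l : ℕ, 1 ≤ l → IsLeast {t : ℝ | (ClusterComplex.fA l).IsRoot t} (r l)) ∧
      StrictAntiOn r (Set.Ici 1) ∧ Tendsto r atTop (𝓝 0)) ∧
    (∃ r : ℕ → ℝ, (∀ l : ℕ, 1 ≤ l → IsLeast {t : ℝ | (ClusterComplex.fB l).IsRoot t} (r l)) ∧
      StrictAntiOn r (Set.Ici 1) ∧ Tendsto r atTop (𝓝 0)) ∧
    (∃ r : ℕ → ℝ, (∀ l : ℕ, 4 ≤ l → IsLeast {t : ℝ | (ClusterComplex.fD l).IsRoot t} (r l)) ∧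
      StrictAntiOn r (Set.Ici 4) ∧ Tendsto r atTop (𝓝 0)) :=
  ⟨ClusterComplex.least_roots_fA, ClusterComplex.least_roots_fB, ClusterComplex.least_roots_fD⟩
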